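/- **Setting.** Let $\mathbf T^4=[-\pi,\pi]^4/\!\sim$ with Lebesgue measure, let $\xi$ be white noise on $\mathbf T^4$ (a centred Gaussian process indexed by $L^2(\mathbf T^4)$ with $\mathbb E[\xi(f)\xi(g)]=\langle f,g\rangle$), let $G$ be the Green's function of $1-\Delta$ on $\mathbf T^4$, let $\varrho:\mathbf R^4\to\mathbf R$ be non-negative, radial, smooth, compactly supported with $\int\varrho=1$, and for $\varepsilon\in(0,1)$ let $\varrho_\varepsilon(x)=\varepsilon^{-4}\varrho(x/\varepsilon)$ and $G_\varepsilon=\varrho_\varepsilon\star G$. **Diagrams and valuation.** A Feynman diagram $\Gamma=(V,E)$ is a finite directed multigraph with a set $L\subseteq V$ of leaves; $V_\star=V\setminus L$. For $\Gamma$ connected put $$\Pi_\varepsilon\Gamma(x_L)=\int\prod_{e=(e_-,e_+)\in E}G_\varepsilon(x_{e_+}-x_{e_-})\,dx ,$$ where one integrates over all variables $x_v$, $v\in V_\star$, if $L\ne\emptyset$, and over all of them but an arbitrary one if $L=\emptyset$. For general $\Gamma$, $\Pi_\varepsilon\Gamma$ is the product over the connected components; $\Pi_\varepsilon$ is extended to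 a ring homomorphism on the polynomial ring generated by all diagrams. **Renormalised valuation.** A subdiagram $\bar\Gamma=(\bar V,\bar E)$ of $\Gamma$ is a subgraph with $\bar V\subseteq V_\star$ (regarded as a diagram without leaves); it is full if it contains each of its edges with the multiplicity that the edge has in $\Gamma$. It is divergent if it is connected (in particular non-empty), full, and $4(|\bar V|-1)-2|\bar E|<0$. A forest is a set $\mathfrak F$ of divergent subdiagrams any two of which are nested or vertex-disjoint; $\mathcal F^-_\Gamma$ is the set of all forests. Contracting a subdiagram means identifying its vertices to one vertex and deleting its edges. Let $\mathcal C_{\mathfrak F}\Gamma$ be the product of the diagram obtained from $\Gamma$ by contracting the maximal elements of $\mathfrak F$ and of the diagrams obtained from each $\gamma\in\mathfrak F$ by contracting the maximal elements of $\{\delta\in\mathfrak F:\delta\subsetneq\gamma\}$. The BPHZ renormalised valuation is given by the forest formula $$\hat\Pi_\varepsilon\Gamma=\Pi_\varepsilon\sum_{\mathfrak F\in\mathcal F^-_\Gamma}(-1)^{|\mathfrak F|}\,\mathcal C_{\mathfrak F}\Gamma .$$ **Renormalised trees.** For $n\ge1$ let $\mathcal I_n$ be the linear tree with vertices $0,\dots,n+1$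 and edges $(j,j+1)$, $0\le j\le n$; its leaves are $0$ (with variable $x$) and $n+1$ (with variable $y$), and $1,\dots,n$ are its internal vertices. A pairing $\kappa$ of a finite set is a set of disjoint two-element subsets; it is complete if these cover the set. For a pairing $\kappa$ of $\{1,\dots,n\}$ with set $V_o$ of unpaired elements let $\mathcal I^{\rm int}_{n,\kappa}$ be the Feynman diagram obtained from $\mathcal I_n$ by identifying paired vertices, with set of leaves $\{0,n+1\}\cup V_o$. The BPHZ renormalised tree is the random variable $$\mathfrak R_\varepsilon\mathcal I_n(x,y)=\sum_{\kappa}\int_{(\mathbf T^4)^{V_o}}\hat\Pi_\varepsilon\mathcal I^{\rm int}_{n,\kappa}(x,y,x_{V_o})\prod_{v\in V_o}\xi(x_v)\,dx_{V_o},$$ where $\kappa$ runs over all pairings of $\{1,\dots,n\}$ and the integrals are multiple Wiener–Itô integrals. **Proposition.** Let $k\in\mathbf N$, $\tau_i=\mathcal I_{n_i}$ with $n_i\ge1$ for $i=1,\dots,k$, $\varepsilon\in(0,1)$ and $x_i,y_i\in\mathbf T^4$. Let $\mathcal K(\tau_1,\dots,\tau_k)$ be the set of complete pairings of the disjoint union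 of the sets of internal vertices of $\tau_1,\dots,\tau_k$, and for such a $\kappa$ let $(\tau_1,\dots,\tau_k)_\kappa$ be the Feynman diagram obtained from the disjoint union of the trees by identifying paired vertices, whose leaves are the $2k$ leaves of the trees, with variables $x_i,y_i$. Then $\prod_{i}\mathfrak R_\varepsilon\tau_i(x_i,y_i)$ is integrable and $$\mathbb E\big[\mathfrak R_\varepsilon\tau_1(x_1,y_1)\cdots\mathfrak R_\varepsilon\tau_k(x_k,y_k)\big]=\sum_{\kappa\in\mathcal K(\tau_1,\dots,\tau_k)}\hat\Pi_\varepsilon(\tau_1,\dots,\tau_k)_\kappa(x_{1:k},y_{1:k}).$$ -/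

import Mathlib

noncomputable section

open MeasureTheory ProbabilityTheory Set

namespace AndersonBPHZ

/-! ### The torus and the mollified Green's function -/

instance fact_two_pi_pos : Fact (0 < 2 * Real.pi) := ⟨Real.two_pi_pos⟩

/-- The torus `[-π, π]⁴ / ∼`; its `volume` is Lebesgue measure, of total mass `(2π)⁴`. -/
abbrev T4 : Type := Fin 4 → AddCircle (2 * Real.pi)

/-- The canonical projection `ℝ⁴ → T⁴`. -/
def toTorus (y : EuclideanSpace ℝ (Fin 4)) : T4 := fun i => (y i : AddCircle (2 * Real.pi))

/-- The representative in `[-π, π)` of a point of the circle. -/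
def circleRep (a : AddCircle (2 * Real.pi)) : ℝ :=
  (AddCircle.equivIco (2 * Real.pi) (-Real.pi) a : ℝ)

/-- The heat kernel of `∂ₜ - Δ` on `T⁴`: the periodisation of
`(4πt)⁻² exp (-|x|² / (4t))`. -/
def heatKernel (t : ℝ) (x : T4) : ℝ :=
  ∑' m : Fin 4 → ℤ, ((4 * Real.pi * t) ^ 2)⁻¹ *
    Real.exp (-(∑ i, (circleRep (x i) + 2 * Real.pi * (m i : ℝ)) ^ 2) / (4 * t))

/-- The Green's function of `1 - Δ` on `T⁴`, i.e. the kernel of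
`(1 - Δ)⁻¹ = ∫₀^∞ e⁻ᵗ e^{tΔ} dt`. -/
def greenFunction (x : T4) : ℝ :=
  ∫ t in Ioi (0 : ℝ), Real.exp (-t) * heatKernel t x

/-- Mollifiers: non-negative, radial, smooth, compactly supported, of integral one. -/
structure IsMollifier (ρ : EuclideanSpace ℝ (Fin 4) → ℝ) : Prop where
  nonneg : ∀ y, 0 ≤ ρ y
  radial : ∀ y z, ‖y‖ = ‖z‖ → ρ y = ρ z
  smooth : ContDiff ℝ (⊤ : ℕ∞) ρ
  compact : HasCompactSupport ρ
  integral_eq_one : ∫ y, ρ y = 1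

/-- `G_ε = ρ_ε ⋆ G` with `ρ_ε(y) = ε⁻⁴ ρ(y / ε)`. -/
def mollifiedGreen (ρ : EuclideanSpace ℝ (Fin 4) → ℝ) (ε : ℝ) (x : T4) : ℝ :=
  ∫ y : EuclideanSpace ℝ (Fin 4), (ε ^ 4)⁻¹ * ρ (ε⁻¹ • y) * greenFunction (x - toTorus y)

/-! ### White noise and multiple Wiener-Itô integrals -/

/-- White noise on `T⁴`: a centred Gaussian process indexed by `L²(T⁴)` whose covariance is the
`L²` inner product. The noise is allowed to be defined only up to null sets. -/
structure WhiteNoise {Ω : Type*} [MeasurableSpace Ω] (P : Measure Ω) where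
  toFun : Lp ℝ 2 (volume : Measure T4) → Ω → ℝ
  gaussian : IsGaussianProcess toFun P
  centred : ∀ f, ∫ ω, toFun f ω ∂P = 0
  covariance : ∀ f g, ∫ ω, toFun f ω * toFun g ω ∂P = inner ℝ f g

section Wiener

variable {Ω : Type*} [MeasurableSpace Ω] {P : Measure Ω}

/-- The noise `ξ(A)` of a measurable set `A`. -/
def WhiteNoise.ofSet (ξ : WhiteNoise P) {A : Set T4} (hA : MeasurableSet A) : Ω → ℝ :=
  ξ.toFun (indicatorConstLp 2 hA (measure_ne_top volume A) (1 : ℝ))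

theorem WhiteNoise.memLp_prod_ofSet (ξ : WhiteNoise P) {ι : Type*} [Fintype ι]
    (A : ι → Set T4) (hA : ∀ i, MeasurableSet (A i)) :
    MemLp (fun ω => ∏ i, ξ.ofSet (hA i) ω) 2 P := by
  have : IsProbabilityMeasure P := ξ.gaussian.isProbabilityMeasure
  have h : ∀ i ∈ (Finset.univ : Finset ι),
      MemLp (ξ.ofSet (hA i)) (2 * (Fintype.card ι : ENNReal)) P := fun i _ =>
    (ξ.gaussian.hasGaussianLaw_eval _).memLp
      (ENNReal.mul_ne_top (by simp) (by simp))
  have h2 := MemLp.prod' h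
  refine h2.mono_exponent ?_
  rcases Nat.eq_zero_or_pos (Fintype.card ι) with h0 | hpos
  · simp [h0]
  · have hc : (Fintype.card ι : ENNReal) ≠ 0 := by exact_mod_cast hpos.ne'
    simp only [Finset.sum_const, Finset.card_univ, nsmul_eq_mul]
    rw [ENNReal.mul_inv (a := 2) (Or.inl (by simp)) (Or.inl (by simp)),
      mul_comm (2⁻¹ : ENNReal), ← mul_assoc, ENNReal.mul_inv_cancel hc (by simp), one_mul, inv_inv]

/-- Families `(A_i)_{i ∈ ι}` of pairwise disjoint measurable subsets of the torus. -/
abbrev DisjointFamily (ι : Type) : Type :=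
  {A : ι → Set T4 // (∀ i, MeasurableSet (A i)) ∧ Pairwise fun i j => Disjoint (A i) (A j)}

variable (ι : Type) [Fintype ι]

/-- The elementary function `∑ c_A 𝟙_{∏ A_i}` attached to a formal combination of families of
pairwise disjoint sets. -/
def elementaryFun : (DisjointFamily ι →₀ ℝ) →ₗ[ℝ] Lp ℝ 2 (volume : Measure (ι → T4)) :=
  Finsupp.linearCombination ℝ fun A : DisjointFamily ι =>
    indicatorConstLp 2 (MeasurableSet.univ_pi A.2.1)
      (measure_ne_top volume (Set.univ.pi A.1)) (1 : ℝ)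

/-- The integral `∑ c_A ∏ ξ(A_i)` of an elementary function. -/
def elementaryIntegral (ξ : WhiteNoise P) : (DisjointFamily ι →₀ ℝ) →ₗ[ℝ] Lp ℝ 2 P :=
  Finsupp.linearCombination ℝ fun A : DisjointFamily ι =>
    (ξ.memLp_prod_ofSet A.1 A.2.1).toLp _

/-- The multiple Wiener-Itô integral, with variables indexed by the finite set `ι`, on
`L²((T⁴)^ι)`: the continuous extension of the integral of elementary functions. -/
def wienerIntegralLp (ξ : WhiteNoise P) :
    Lp ℝ 2 (volume : Measure (ι → T4)) →L[ℝ] Lp ℝ 2 P :=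
  (elementaryIntegral ι ξ).extendOfNorm (elementaryFun ι)

variable {ι}

open Classical in
/-- The multiple Wiener-Itô integral `∫ f(z) ∏_{i ∈ ι} ξ(z_i) dz` of a square integrable
function. -/
def wienerIntegral (ξ : WhiteNoise P) (f : (ι → T4) → ℝ) : Ω → ℝ :=
  if h : MemLp f 2 (volume : Measure (ι → T4)) then wienerIntegralLp ι ξ (h.toLp f) else 0

end Wiener

/-! ### Feynman diagrams and their valuation -/

/-- A Feynman diagram: a finite directed multigraph, with individually named edges, and a set of
leaves. The leaves are the vertices `v` with `label v ≠ none`; they carry labels in `Λ`, which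
name the variables on which the valuation depends. Diagrams without leaves are allowed. -/
structure FeynmanDiagram (Λ : Type) where
  V : Type
  E : Type
  [fintypeV : Fintype V]
  [fintypeE : Fintype E]
  src : E → V
  tgt : E → V
  label : V → Option Λ

attribute [instance] FeynmanDiagram.fintypeV FeynmanDiagram.fintypeE

namespace FeynmanDiagram

variable {Λ : Type} (Γ : FeynmanDiagram Λ)

/-- There is an edge from `v` to `w`. -/
def Adj (v w : Γ.V) : Prop := ∃ e, Γ.src e = v ∧ Γ.tgt e = w

/-- Connectedness of the underlying undirected graph; the empty graph is not connected. -/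
def Connected : Prop := Nonempty Γ.V ∧ ∀ v w, Relation.EqvGen Γ.Adj v w

/-- The connected components of the underlying undirected graph. -/
abbrev Component : Type := Quot Γ.Adj

instance : Fintype Γ.Component := Fintype.ofFinite _

open Classical in
/-- A connected component, as a diagram. -/
def component (c : Γ.Component) : FeynmanDiagram Λ where
  V := {v : Γ.V // Quot.mk Γ.Adj v = c}
  E := {e : Γ.E // Quot.mk Γ.Adj (Γ.src e) = c}
  src e := ⟨Γ.src e.1, e.2⟩
  tgt e := ⟨Γ.tgt e.1, (Quot.sound ⟨e.1, rfl, rfl⟩ : Quot.mk Γ.Adj (Γ.src e.1) = _).symm.trans e.2⟩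
  label v := Γ.label v.1

/-- `∏_e G(x_{e₊} - x_{e₋})` for an assignment of points to all vertices. -/
def kernel (G : T4 → ℝ) (x : Γ.V → T4) : ℝ :=
  ∏ e : Γ.E, G (x (Γ.tgt e) - x (Γ.src e))

/-- The internal vertices. -/
abbrev Internal : Type := {v : Γ.V // Γ.label v = none}

instance : Fintype Γ.Internal := Fintype.ofFinite _

/-- The assignment of points given by `x` on the leaves and by `z` on the internal vertices. -/
def assign (x : Λ → T4) (z : Γ.Internal → T4) (v : Γ.V) : T4 :=
  match h : Γ.label v with
  | some l => x l
  | none => z ⟨v, h⟩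

open Classical in
/-- Valuation of a connected diagram. If there are leaves, all internal variables are integrated;
otherwise all variables but that of the vertex `v₀`, which is put at the origin (by
translation invariance neither the choice of `v₀` nor that of the point matters). -/
def connectedValuation (G : T4 → ℝ) (v₀ : Γ.V) (x : Λ → T4) : ℝ :=
  if ∃ v, Γ.label v ≠ none then
    ∫ z : Γ.Internal → T4, Γ.kernel G (Γ.assign x z)
  else
    ∫ z : {v : Γ.V // v ≠ v₀} → T4,
      Γ.kernel G fun v => if h : v = v₀ then 0 else z ⟨v, h⟩

/-- The valuation `Π Γ`: the product of the valuations of the connected components. -/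
def valuation (G : T4 → ℝ) (x : Λ → T4) : ℝ :=
  ∏ c : Γ.Component, (Γ.component c).connectedValuation G ⟨Quot.out c, Quot.out_eq c⟩ x

/-! ### Subdiagrams, contractions, forests -/

/-- Subdiagrams: subgraphs made of internal vertices (hence of internal edges). -/
@[ext]
structure Subdiagram where
  verts : Set Γ.V
  edges : Set Γ.E
  internal : ∀ v ∈ verts, Γ.label v = none
  src_mem : ∀ e ∈ edges, Γ.src e ∈ verts
  tgt_mem : ∀ e ∈ edges, Γ.tgt e ∈ verts

variable {Γ}

theorem Subdiagram.toPair_injective :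
    Function.Injective fun γ : Γ.Subdiagram => (γ.verts, γ.edges) := fun _ _ h =>
  Subdiagram.ext (congrArg Prod.fst h) (congrArg Prod.snd h)

/-- Inclusion of subdiagrams. -/
instance : PartialOrder Γ.Subdiagram := PartialOrder.lift _ Subdiagram.toPair_injective

instance : Finite Γ.Subdiagram := Finite.of_injective _ Subdiagram.toPair_injective

instance : Fintype Γ.Subdiagram := Fintype.ofFinite _

namespace Subdiagram

variable (γ : Γ.Subdiagram)

open Classical in
/-- A subdiagram is itself a diagram, without leaves. -/
def toDiagram : FeynmanDiagram Λ where
  V := {v : Γ.V // v ∈ γ.verts}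
  E := {e : Γ.E // e ∈ γ.edges}
  src e := ⟨Γ.src e.1, γ.src_mem e.1 e.2⟩
  tgt e := ⟨Γ.tgt e.1, γ.tgt_mem e.1 e.2⟩
  label _ := none

/-- A subdiagram is full if with an edge it contains all edges with the same source and target,
that is, if it contains each of its edges with full multiplicity. -/
def Full : Prop :=
  ∀ e ∈ γ.edges, ∀ e', Γ.src e' = Γ.src e → Γ.tgt e' = Γ.tgt e → e' ∈ γ.edges

/-- The degree of a connected subdiagram. -/
def deg : ℤ := 4 * ((γ.verts.ncard : ℤ) - 1) - 2 * (γ.edges.ncard : ℤ)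

/-- The divergent subdiagrams: connected, full, and of strictly negative degree. -/
def Divergent : Prop := γ.toDiagram.Connected ∧ γ.Full ∧ γ.deg < 0

/-- The subdiagram `δ`, seen as a subdiagram of `γ` (used for `δ ≤ γ`). -/
def restrict (δ : Γ.Subdiagram) : γ.toDiagram.Subdiagram where
  verts := {v | v.1 ∈ δ.verts}
  edges := {e | e.1 ∈ δ.edges}
  internal _ _ := rfl
  src_mem e he := δ.src_mem e.1 he
  tgt_mem e he := δ.tgt_mem e.1 he

end Subdiagram

open Classical in
/-- The diagram `Γ / S` in which each of the (pairwise vertex disjoint) subdiagrams in `S` is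
contracted to a vertex: its vertices are identified and its edges are removed. -/
def contract (Γ : FeynmanDiagram Λ) (S : Set Γ.Subdiagram) : FeynmanDiagram Λ where
  V := Quot fun v w : Γ.V => ∃ γ ∈ S, v ∈ γ.verts ∧ w ∈ γ.verts
  E := {e : Γ.E // ∀ γ ∈ S, e ∉ γ.edges}
  fintypeV := Fintype.ofFinite _
  src e := Quot.mk _ (Γ.src e.1)
  tgt e := Quot.mk _ (Γ.tgt e.1)
  label := Quot.lift Γ.label (by
    rintro v w ⟨γ, -, hv, hw⟩
    rw [γ.internal v hv, γ.internal w hw])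

/-- Forests: sets of divergent subdiagrams any two of which are nested or vertex disjoint. -/
def IsForest (F : Finset Γ.Subdiagram) : Prop :=
  (∀ γ ∈ F, γ.Divergent) ∧
    ∀ γ₁ ∈ F, ∀ γ₂ ∈ F, γ₁ ≤ γ₂ ∨ γ₂ ≤ γ₁ ∨ Disjoint γ₁.verts γ₂.verts

/-- The roots of a forest: its maximal elements. -/
def roots (F : Finset Γ.Subdiagram) : Set Γ.Subdiagram := {γ | Maximal (· ∈ F) γ}

/-- The children of `γ` in a forest: the maximal elements strictly below `γ`. -/
def children (F : Finset Γ.Subdiagram) (γ : Γ.Subdiagram) : Set Γ.Subdiagram :=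
  {δ | Maximal (fun δ' => δ' ∈ F ∧ δ' < γ) δ}

/-- The extraction `C_F Γ`, in the polynomial ring generated by all diagrams. Every element of the
forest is extracted, smaller elements being extracted from larger ones; this leaves, for each
`γ ∈ F`, the diagram `γ` with its children contracted, and `Γ` with the roots contracted. -/
def extract (F : Finset Γ.Subdiagram) : MvPolynomial (FeynmanDiagram Λ) ℝ :=
  (∏ γ ∈ F, MvPolynomial.X (γ.toDiagram.contract (γ.restrict '' children F γ))) *
    MvPolynomial.X (Γ.contract (roots F))

variable (Γ)

open Classical in
/-- BPHZ renormalisation of a diagram, by Zimmermann's forest formula. -/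
def renormalise : MvPolynomial (FeynmanDiagram Λ) ℝ :=
  ∑ F : Finset Γ.Subdiagram with IsForest F, (-1) ^ F.card * extract F

/-- The renormalised valuation: the valuation, extended to a ring homomorphism on the polynomial
ring generated by all diagrams, of the renormalised diagram. -/
def renormalisedValuation (G : T4 → ℝ) (x : Λ → T4) : ℝ :=
  MvPolynomial.eval (fun Γ' : FeynmanDiagram Λ => Γ'.valuation G x) Γ.renormalise

end FeynmanDiagram

/-! ### Trees, pairings, and paired diagrams

The linear tree with `n` internal vertices has vertices `0, …, n + 1`, of which `0` (bottom) and
`n + 1` (top) are leaves, and edges `(j, j + 1)`. Its `j`-th internal vertex, `j : Fin n`, is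
`j + 1`. -/

/-- The two leaves of a tree. -/
inductive Leaf : Type
  | bottom
  | top

/-- The points attached to the two leaves. -/
def Leaf.point (x y : T4) : Leaf → T4
  | bottom => x
  | top => y

/-- The vertex of the tree that corresponds to the `j`-th noise. -/
def innerVertex {n : ℕ} (j : Fin n) : Fin (n + 2) := j.succ.castSucc

/-- Case distinction on the vertices of a tree: bottom, top, or internal. -/
def vertexCases {α : Type} {n : ℕ} (bottom top : α) (inner : Fin n → α) (v : Fin (n + 2)) : α :=
  Fin.lastCases top (fun w => Fin.cases bottom inner w) v

@[simp]
theorem vertexCases_innerVertex {α : Type} {n : ℕ} (b t : α) (f : Fin n → α) (j : Fin n) :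
    vertexCases b t f (innerVertex j) = f j := by
  simp only [vertexCases, innerVertex, Fin.lastCases_castSucc, Fin.cases_succ]

/-- Pairings of a set `S`, not necessarily complete: involutions of `S`; the elements `s` and `κ s`
are paired if they differ, and `s` is unpaired if `κ s = s`. -/
abbrev Pairing (S : Type) : Type := {κ : S → S // Function.Involutive κ}

/-- Complete pairings: involutions without fixed points. -/
abbrev CompletePairing (S : Type) : Type :=
  {κ : S → S // Function.Involutive κ ∧ ∀ s, κ s ≠ s}

instance {S : Type} [Finite S] : Fintype (Pairing S) := Fintype.ofFinite _

instance {S : Type} [Finite S] : Fintype (CompletePairing S) := Fintype.ofFinite _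

/-- The unpaired elements. -/
abbrev Pairing.Unpaired {S : Type} (κ : Pairing S) : Type := {s : S // κ.1 s = s}

instance {S : Type} [Finite S] (κ : Pairing S) : Fintype κ.Unpaired := Fintype.ofFinite _

open Classical in
/-- The tree with `n` internal vertices, with internal vertices identified according to the
internal pairing `κ`, in which the unpaired internal vertices (those carrying a noise) are
considered as leaves as well. -/
def internalDiagram (n : ℕ) (κ : Pairing (Fin n)) : FeynmanDiagram (Leaf ⊕ κ.Unpaired) where
  V := Quot fun v w : Fin (n + 2) => ∃ j, v = innerVertex j ∧ w = innerVertex (κ.1 j)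
  E := Fin (n + 1)
  fintypeV := Fintype.ofFinite _
  src e := Quot.mk _ e.castSucc
  tgt e := Quot.mk _ e.succ
  label := Quot.lift
    (vertexCases (some (Sum.inl Leaf.bottom)) (some (Sum.inl Leaf.top)) fun j =>
      if h : κ.1 j = j then some (Sum.inr ⟨j, h⟩) else none)
    (by
      rintro v w ⟨j, rfl, rfl⟩
      by_cases h : κ.1 j = j
      · rw [h]
      · have h' : κ.1 (κ.1 j) ≠ κ.1 j := fun h' => h (κ.2.injective h')
        simp [h, h'])

/-- The Feynman diagram `(τ_1, …, τ_k)_κ`, where `τ_i` is the tree with `n i` internal vertices: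
the disjoint union of the trees, with internal vertices identified according to the complete
pairing `κ`. -/
def pairedDiagram {k : ℕ} (n : Fin k → ℕ) (κ : CompletePairing (Σ i, Fin (n i))) :
    FeynmanDiagram (Fin k × Leaf) where
  V := Quot fun v w : Σ i, Fin (n i + 2) =>
    ∃ p : Σ i, Fin (n i), v = ⟨p.1, innerVertex p.2⟩ ∧ w = ⟨(κ.1 p).1, innerVertex (κ.1 p).2⟩
  E := Σ i, Fin (n i + 1)
  fintypeV := Fintype.ofFinite _
  src e := Quot.mk _ ⟨e.1, e.2.castSucc⟩
  tgt e := Quot.mk _ ⟨e.1, e.2.succ⟩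
  label := Quot.lift
    (fun v => vertexCases (some (v.1, Leaf.bottom)) (some (v.1, Leaf.top)) (fun _ => none) v.2)
    (by
      rintro v w ⟨p, rfl, rfl⟩
      simp)

/-! ### Renormalised trees -/

section RenormalisedTrees

variable {Ω : Type*} [MeasurableSpace Ω] {P : Measure Ω}

/-- The renormalisation of the component of the tree that belongs to the internal pairing `κ`:
the renormalised valuation of the paired tree, integrated against the noises at the unpaired
vertices. -/
def renormalisedPairedTree (ξ : WhiteNoise P) (G : T4 → ℝ) (n : ℕ) (κ : Pairing (Fin n))
    (x y : T4) : Ω → ℝ :=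
  wienerIntegral ξ fun z : κ.Unpaired → T4 =>
    (internalDiagram n κ).renormalisedValuation G (Sum.elim (Leaf.point x y) z)

/-- The BPHZ renormalised tree with `n` internal vertices. -/
def renormalisedTree (ξ : WhiteNoise P) (G : T4 → ℝ) (n : ℕ) (x y : T4) (ω : Ω) : ℝ :=
  ∑ κ : Pairing (Fin n), renormalisedPairedTree ξ G n κ x y ω

end RenormalisedTrees

end AndersonBPHZ

end

/-!
The noise enters only through multiple Wiener-Itô integrals. For indicator functions of products of
disjoint sets, Isserlis' theorem gives the expectation of a product of such integrals as a sum over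
complete pairings of the noises, to which pairs inside one integral do not contribute. Both sides
are continuous and multilinear on `L^q`, for `q` at least the number of factors, and the elementary
functions are dense there; so `E[∏ i, I(f i)]` is the sum, over the external pairings `σ` of the
arguments of the `f i`, of the integral of `∏ i, f i` with paired arguments identified.

For the renormalised trees this gives a sum over internal pairings `κ i` of each tree and an
external pairing `σ` of the noises they leave unpaired, that is, over all complete pairings. It
remains to see that the renormalised valuation of the diagram obtained from `κ` and `σ` is the
integral, over the externally paired vertices, of the product of the renormalised valuations of the
trees paired by the `κ i`. Contractions and valuations are compatible with gluing diagrams along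
leaves, so this holds if the divergent subdiagrams are the same before and after gluing. Counting
edges shows that a divergent subdiagram cannot meet two trees; in particular it contains no
externally paired vertex.

Of the kernel only measurability and boundedness matter. For `G_ε` they follow from the
integrability of `G`, which is the integral over `t` of `exp (-t)` times a probability density.
-/

noncomputable section

open MeasureTheory ProbabilityTheory Set

namespace AndersonBPHZ

/-! ### Moments of Gaussian vectors -/

section Gaussian

theorem memLp_finsetProd_of_forall_ne_top {Ω S : Type*} [MeasurableSpace Ω] {P : Measure Ω}
    [IsFiniteMeasure P] {X : S → Ω → ℝ} (t : Finset S)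
    (hX : ∀ s ∈ t, ∀ q : ENNReal, q ≠ ⊤ → MemLp (X s) q P) {q : ENNReal} (hq : q ≠ ⊤) :
    MemLp (fun ω => ∏ s ∈ t, X s ω) q P := by
  have hcard : (t.card : ENNReal) * ((t.card : ENNReal) * q)⁻¹ ≤ q⁻¹ := by
    rw [ENNReal.mul_inv (Or.inr hq) (Or.inl (ENNReal.natCast_ne_top _)), ← mul_assoc]
    exact mul_le_of_le_one_left' (ENNReal.mul_inv_le_one _)
  have h := MemLp.prod' fun s hs => hX s hs (t.card * q) (ENNReal.mul_ne_top (by simp) hq)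
  exact h.mono_exponent (by simpa [ENNReal.le_inv_iff_le_inv] using hcard)

theorem integrable_eval_gaussianReal (m : ℝ) (v : NNReal) (f : Polynomial ℝ) :
    Integrable (fun x => f.eval x) (gaussianReal m v) := by
  simp_rw [Polynomial.eval_eq_sum_range]
  refine integrable_finsetSum _ fun i _ => Integrable.const_mul ?_ _
  have h := (memLp_id_gaussianReal (μ := m) (v := v) (i : NNReal)).integrable_norm_pow'
  exact h.mono (by fun_prop) (by simp)

theorem hasDerivAt_gaussianPDFReal (m : ℝ) {v : NNReal} (hv : v ≠ 0) (x : ℝ) :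
    HasDerivAt (gaussianPDFReal m v) (-((x - m) / v) * gaussianPDFReal m v x) x := by
  have hv' : (v : ℝ) ≠ 0 := by exact_mod_cast hv
  have hexponent : HasDerivAt (fun x : ℝ => -(x - m) ^ 2 / (2 * v)) (-((x - m) / v)) x :=
    ((((hasDerivAt_id x).sub_const m).pow 2).neg.div_const (2 * (v : ℝ))).congr_deriv
      (by simp only [id]; push_cast; field_simp)
  rw [gaussianPDFReal_def]
  exact (hexponent.exp.const_mul ((√(2 * Real.pi * v))⁻¹)).congr_deriv (by ring)

theorem integral_sub_mul_eval_gaussianReal (m : ℝ) (v : NNReal) (f : Polynomial ℝ) :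
    ∫ x, (x - m) * f.eval x ∂(gaussianReal m v) =
      v * ∫ x, f.derivative.eval x ∂(gaussianReal m v) := by
  rcases eq_or_ne v 0 with rfl | hv
  · simp
  have hv' : (v : ℝ) ≠ 0 := by exact_mod_cast hv
  have hint (g : Polynomial ℝ) : Integrable (fun x => g.eval x * gaussianPDFReal m v x) := by
    have h := integrable_eval_gaussianReal m v g
    rw [gaussianReal_of_var_ne_zero m hv, integrable_withDensity_iff (by fun_prop)
      (by simp [gaussianPDF])] at h
    simpa using h
  have hint' : Integrable (fun x => f.eval x * (-((x - m) / v) * gaussianPDFReal m v x)) := by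
    refine ((hint ((Polynomial.X - Polynomial.C m) * f)).const_mul (-(v : ℝ)⁻¹)).congr ?_
    filter_upwards with x
    simp only [Polynomial.eval_mul, Polynomial.eval_sub, Polynomial.eval_X, Polynomial.eval_C]
    ring
  have hparts := integral_mul_deriv_eq_deriv_mul_of_integrable (fun x _ => f.hasDerivAt x)
    (fun x _ => hasDerivAt_gaussianPDFReal m hv x) hint' (hint _) (hint f)
  simp only [integral_gaussianReal_eq_integral_smul hv, smul_eq_mul]
  calc ∫ x, gaussianPDFReal m v x * ((x - m) * f.eval x)
    _ = ∫ x, -v * (f.eval x * (-((x - m) / v) * gaussianPDFReal m v x)) := by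
      congr with x; field_simp
    _ = v * ∫ x, gaussianPDFReal m v x * f.derivative.eval x := by
      rw [integral_const_mul, hparts]
      simp only [mul_comm (gaussianPDFReal m v _)]
      ring

theorem integral_mul_prod_affine_gaussianReal {S : Type*} [Fintype S] [DecidableEq S]
    (v : NNReal) (a b : S → ℝ) :
    ∫ x, x * ∏ s, (a s * x + b s) ∂(gaussianReal 0 v) =
      ∑ s, a s * v * ∫ x, ∏ t ∈ Finset.univ.erase s, (a t * x + b t) ∂(gaussianReal 0 v) := by
  have h := integral_sub_mul_eval_gaussianReal 0 v
    (∏ s, (Polynomial.C (a s) * Polynomial.X + Polynomial.C (b s)))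
  simp only [sub_zero, Polynomial.eval_prod, Polynomial.eval_add, Polynomial.eval_mul,
    Polynomial.eval_C, Polynomial.eval_X, Polynomial.derivative_prod_finset,
    Polynomial.eval_finsetSum, Polynomial.derivative_add, Polynomial.derivative_mul,
    Polynomial.derivative_C, Polynomial.derivative_X, zero_mul, mul_one, zero_add,
    add_zero] at h
  rw [h, integral_finsetSum, Finset.mul_sum]
  · refine Finset.sum_congr rfl fun s _ => ?_
    rw [integral_mul_const]
    ring
  · intro s _
    have hint := integrable_eval_gaussianReal 0 v
      ((∏ t ∈ Finset.univ.erase s, (Polynomial.C (a t) * Polynomial.X + Polynomial.C (b t))) *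
        Polynomial.C (a s))
    simpa only [Polynomial.eval_mul, Polynomial.eval_prod, Polynomial.eval_add, Polynomial.eval_C,
      Polynomial.eval_X] using hint

variable {Ω S : Type*} [MeasurableSpace Ω] {P : Measure Ω} {Z : Ω → ℝ}
  {X : S → Ω → ℝ}

theorem covariance_eq_zero_of_variance_eq_zero [IsProbabilityMeasure P] {Y : Ω → ℝ}
    (hZ : MemLp Z 2 P) (hvar : Var[Z; P] = 0) : cov[Z, Y; P] = 0 := by
  have hconst : Z =ᵐ[P] fun _ => ∫ ω, Z ω ∂P :=
    ae_eq_integral_of_variance_eq_zero hZ hvar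
  refine integral_eq_zero_of_ae ?_
  filter_upwards [hconst] with ω hω
  simp [hω]

theorem exists_indepFun_sub_const_mul [Finite S]
    (h : HasGaussianLaw (fun ω => (Z ω, fun s => X s ω)) P) :
    ∃ a : S → ℝ, (∀ s, a s * Var[Z; P] = cov[Z, X s; P]) ∧
      IndepFun Z (fun ω s => X s ω - a s * Z ω) P := by
  have := Fintype.ofFinite S
  have := h.isProbabilityMeasure
  have hZ : MemLp Z 2 P := h.fst.memLp_two
  have hX (s : S) : MemLp (X s) 2 P := (h.snd.eval s).memLp_two
  let a (s : S) : ℝ := cov[Z, X s; P] / Var[Z; P]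
  have ha (s : S) : a s * Var[Z; P] = cov[Z, X s; P] :=
    div_mul_cancel_of_imp fun hvar => covariance_eq_zero_of_variance_eq_zero hZ hvar
  let L : (ℝ × (S → ℝ)) →L[ℝ] ((Unit → ℝ) × (S → ℝ)) :=
    (ContinuousLinearMap.pi fun _ => ContinuousLinearMap.fst ℝ ℝ (S → ℝ)).prod
      (ContinuousLinearMap.snd ℝ ℝ (S → ℝ) -
        ContinuousLinearMap.pi fun s => a s • ContinuousLinearMap.fst ℝ ℝ (S → ℝ))
  have hindep : IndepFun (fun ω (_ : Unit) => Z ω) (fun ω s => X s ω - a s * Z ω) P := by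
    refine HasGaussianLaw.indepFun_of_covariance_eval (h.map L) fun _ s => ?_
    rw [covariance_fun_sub_right hZ (hX s) (hZ.const_mul _), covariance_const_mul_right,
      covariance_self hZ.aemeasurable, ha, sub_self]
  exact ⟨a, ha, hindep.comp (φ := fun f : Unit → ℝ => f ()) (by fun_prop) measurable_id⟩

theorem integrable_and_integral_comp_of_indepFun [IsFiniteMeasure P] {α β : Type*}
    [MeasurableSpace α] [MeasurableSpace β] {U : Ω → α} {V : Ω → β} (hUV : IndepFun U V P)
    (hU : AEMeasurable U P) (hV : AEMeasurable V P) {F : α × β → ℝ} (hF : Measurable F)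
    (hint : Integrable (fun ω => F (U ω, V ω)) P) :
    Integrable (fun v => ∫ u, F (u, v) ∂(P.map U)) (P.map V) ∧
      ∫ ω, F (U ω, V ω) ∂P = ∫ v, ∫ u, F (u, v) ∂(P.map U) ∂(P.map V) := by
  have hlaw := (indepFun_iff_map_prod_eq_prod_map_map hU hV).1 hUV
  have hintF : Integrable F ((P.map U).prod (P.map V)) := by
    rwa [← hlaw, integrable_map_measure hF.aestronglyMeasurable (hU.prodMk hV)]
  refine ⟨hintF.integral_prod_right, ?_⟩
  rw [← integral_prod_symm _ hintF, ← hlaw,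
    integral_map (hU.prodMk hV) hF.aestronglyMeasurable]

-- `X` is split into its regression on `Z` and a part independent of `Z`; given the latter, Stein's
-- lemma applies to the polynomial `∏ s, (a s * z + Y s)` in the Gaussian variable `z`.
theorem integral_mul_prod_of_hasGaussianLaw [Fintype S] [DecidableEq S]
    (h : HasGaussianLaw (fun ω => (Z ω, fun s => X s ω)) P) (hmean : ∫ ω, Z ω ∂P = 0) :
    ∫ ω, Z ω * ∏ s, X s ω ∂P =
      ∑ s, cov[Z, X s; P] * ∫ ω, ∏ t ∈ Finset.univ.erase s, X t ω ∂P := by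
  have := h.isProbabilityMeasure
  have hX (t : Finset S) {q : ENNReal} (hq : q ≠ ⊤) : MemLp (fun ω => ∏ s ∈ t, X s ω) q P :=
    memLp_finsetProd_of_forall_ne_top t (fun s _ q hq => (h.snd.eval s).memLp hq) hq
  obtain ⟨a, ha, hindep⟩ := exists_indepFun_sub_const_mul h
  set Y : Ω → S → ℝ := fun ω s => X s ω - a s * Z ω
  have hXY (s : S) (ω : Ω) : X s ω = a s * Z ω + Y ω s := by simp [Y]
  have hlawZ : P.map Z = gaussianReal 0 Var[Z; P].toNNReal := by
    rw [h.fst.map_eq_gaussianReal, hmean]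
  have hYm : AEMeasurable Y P := aemeasurable_pi_lambda _ fun s =>
    (h.snd.eval s).aemeasurable.sub (h.fst.aemeasurable.const_mul _)
  have hfubini {F : ℝ × (S → ℝ) → ℝ} := integrable_and_integral_comp_of_indepFun (F := F)
    hindep h.fst.aemeasurable hYm
  rw [hlawZ] at hfubini
  obtain ⟨-, hfull⟩ := hfubini (F := fun p => p.1 * ∏ s, (a s * p.1 + p.2 s)) (by fun_prop)
    (by simp only [← hXY]; exact h.fst.memLp_two.integrable_mul (hX Finset.univ (q := 2) (by simp)))
  have herase (s : S) := hfubini (F := fun p => ∏ t ∈ Finset.univ.erase s, (a t * p.1 + p.2 t))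
    (by fun_prop) (by simpa only [← hXY] using memLp_one_iff_integrable.1 (hX _ ENNReal.one_ne_top))
  simp only [← hXY] at hfull herase
  rw [hfull]
  rw [Finset.sum_congr rfl fun s _ => by rw [(herase s).2, ← integral_const_mul],
    ← integral_finsetSum _ fun s _ => (herase s).1.const_mul _]
  refine integral_congr_ae (Filter.Eventually.of_forall fun y => ?_)
  simp only [integral_mul_prod_affine_gaussianReal, Real.coe_toNNReal _ (variance_nonneg Z P), ha]

end Gaussian

/-! ### Complete pairings and Isserlis' theorem -/

namespace CompletePairing

section Pairs

variable {S : Type} (κ : CompletePairing S)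

/-- The set of pairs of a complete pairing, as a quotient of the paired set. -/
abbrev Pairs : Type := Quot fun p q : S => q = κ.1 p

instance [Finite S] : Fintype κ.Pairs := Fintype.ofFinite _

variable {κ} in
/-- A pair of a complete pairing, as an unordered pair of elements of the paired set. -/
def Pairs.toSym2 : κ.Pairs → Sym2 S :=
  Quot.lift (fun p => s(p, κ.1 p)) fun p q hq => by rw [hq, κ.2.1 p, Sym2.eq_swap]

theorem mk_eq_mk_iff {p q : S} : (Quot.mk _ p : κ.Pairs) = Quot.mk _ q ↔ q = p ∨ q = κ.1 p := by
  refine ⟨fun h => ?_, ?_⟩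
  · have hpair : s(p, κ.1 p) = s(q, κ.1 q) := congrArg Pairs.toSym2 h
    exact Sym2.mem_iff.1 (hpair ▸ Sym2.mem_mk_left q _)
  · rintro (rfl | rfl)
    · rfl
    · exact Quot.sound rfl

/-- The product of `c` over the pairs of a complete pairing. -/
def weight [Finite S] (c : Sym2 S → ℝ) : ℝ := ∏ o : κ.Pairs, c o.toSym2

end Pairs

variable {S : Type}

/-- The pairing induced by `κ` on the complement of the pair of `s`. -/
def erase (κ : CompletePairing S) (s : S) : CompletePairing {p : S // p ≠ s ∧ p ≠ κ.1 s} where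
  val p := ⟨κ.1 p.1, fun h => p.2.2 ((κ.2.1 p.1).symm.trans (congrArg κ.1 h)),
    fun h => p.2.1 (κ.2.1.injective h)⟩
  property := ⟨fun _ => Subtype.ext (κ.2.1 _), fun _ h => κ.2.2 _ (congrArg Subtype.val h)⟩

variable [DecidableEq S]

/-- The pairing of `S` in which `s` is paired with `t` and the other elements according to `κ`. -/
def extend (s : S) (t : {t : S // t ≠ s}) (κ : CompletePairing {p : S // p ≠ s ∧ p ≠ t.1}) :
    CompletePairing S where
  val p := if h₁ : p = s then t.1 else if h₂ : p = t.1 then s else (κ.1 ⟨p, h₁, h₂⟩).1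
  property := by
    obtain ⟨t, ht⟩ := t
    refine ⟨fun p => ?_, fun p => ?_⟩
    all_goals
      by_cases h₁ : p = s
      · subst h₁; simp [ht]
      by_cases h₂ : p = t
      · subst h₂; simp [h₁, Ne.symm h₁]
    · have h := (κ.1 ⟨p, h₁, h₂⟩).2
      simp only [h₁, h₂, dite_false, h.1, h.2, Subtype.coe_eta, κ.2.1 ⟨p, h₁, h₂⟩]
    · simp only [h₁, h₂, dite_false]
      exact fun h => κ.2.2 ⟨p, h₁, h₂⟩ (Subtype.ext h)

section Extend

variable {s : S} {t : {t : S // t ≠ s}} (κ : CompletePairing {p : S // p ≠ s ∧ p ≠ t.1})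

theorem extend_self : (extend s t κ).1 s = t.1 := by simp [extend]

theorem extend_of_ne (p : {p : S // p ≠ s ∧ p ≠ t.1}) : (extend s t κ).1 p.1 = (κ.1 p).1 := by
  simp [extend, p.2.1, p.2.2]

end Extend

theorem extend_erase (κ : CompletePairing S) (s : S) :
    extend s ⟨κ.1 s, κ.2.2 s⟩ (κ.erase s) = κ := by
  refine Subtype.ext (funext fun p => ?_)
  simp only [extend, erase]
  split_ifs with h₁ h₂
  · rw [h₁]
  · rw [h₂, κ.2.1]
  · rfl

theorem extend_bijective (s : S) :
    Function.Bijective fun a : (Σ t : {t : S // t ≠ s},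
      CompletePairing {p : S // p ≠ s ∧ p ≠ t.1}) => extend s a.1 a.2 := by
  refine ⟨?_, fun κ => ⟨⟨⟨κ.1 s, κ.2.2 s⟩, κ.erase s⟩, extend_erase κ s⟩⟩
  rintro ⟨t, κ⟩ ⟨t', κ'⟩ (h : extend s t κ = extend s t' κ')
  obtain rfl : t = t' := Subtype.ext (by rw [← extend_self κ, h, extend_self])
  obtain rfl : κ = κ' :=
    Subtype.ext (funext fun p => Subtype.ext (by rw [← extend_of_ne, h, extend_of_ne]))
  rfl

section Weight

variable {s : S} {t : {t : S // t ≠ s}} (κ : CompletePairing {p : S // p ≠ s ∧ p ≠ t.1})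

/-- The pairs of `extend s t κ`: the pair of `s`, indexed by `none`, and those of `κ`. -/
def extendPairs : Option κ.Pairs → (extend s t κ).Pairs
  | none => Quot.mk _ s
  | some o => Quot.map Subtype.val (fun p q hq => by rw [hq, extend_of_ne]) o

theorem extendPairs_bijective : Function.Bijective (extendPairs κ) := by
  have hne (p : {p : S // p ≠ s ∧ p ≠ t.1}) :
      (Quot.mk _ s : (extend s t κ).Pairs) ≠ Quot.mk _ p.1 := by
    rw [Ne, mk_eq_mk_iff, extend_self, not_or]
    exact p.2
  constructor
  · rintro (_ | ⟨⟨p⟩⟩) (_ | ⟨⟨q⟩⟩) h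
    · rfl
    · exact (hne q h).elim
    · exact (hne p h.symm).elim
    · have h' := (mk_eq_mk_iff _).1 h
      rw [extend_of_ne] at h'
      exact congrArg some ((mk_eq_mk_iff κ).2 (h'.imp Subtype.ext Subtype.ext))
  · rintro ⟨p⟩
    by_cases h₁ : p = s
    · exact ⟨none, by rw [h₁]; rfl⟩
    by_cases h₂ : p = t.1
    · exact ⟨none, Quot.sound (by rw [h₂, extend_self])⟩
    · exact ⟨some (Quot.mk _ ⟨p, h₁, h₂⟩), rfl⟩

theorem weight_extend [Finite S] (c : Sym2 S → ℝ) :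
    (extend s t κ).weight c = c s(s, t.1) * κ.weight fun z => c (z.map Subtype.val) := by
  rw [weight, ← Fintype.prod_bijective _ (extendPairs_bijective κ) _ _ fun _ => rfl,
    Fintype.prod_option, weight]
  congr 1
  · exact congrArg c (congrArg (s(s, ·)) (extend_self κ))
  · refine Fintype.prod_congr _ _ ?_
    rintro ⟨p⟩
    exact congrArg c (congrArg (s(p.1, ·)) (extend_of_ne κ p))

end Weight

end CompletePairing

section Isserlis

variable {Ω S : Type*} [MeasurableSpace Ω] {P : Measure Ω}

/-- The covariances of a family of random variables, as a function of unordered pairs. -/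
def covariances (X : S → Ω → ℝ) (P : Measure Ω) : Sym2 S → ℝ :=
  Sym2.lift ⟨fun p q => cov[X p, X q; P], fun _ _ => covariance_comm _ _⟩

theorem covariances_map {S' : Type*} (X : S → Ω → ℝ) (f : S' → S) (z : Sym2 S') :
    covariances X P (z.map f) = covariances (fun p => X (f p)) P z := by
  induction z
  rfl

theorem integral_prod_of_hasGaussianLaw {S : Type} [Fintype S] {X : S → Ω → ℝ}
    (h : HasGaussianLaw (fun ω s => X s ω) P) (hmean : ∀ s, ∫ ω, X s ω ∂P = 0) :
    ∫ ω, ∏ s, X s ω ∂P = ∑ κ : CompletePairing S, κ.weight (covariances X P) := by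
  classical
  have := h.isProbabilityMeasure
  induction hN : Fintype.card S using Nat.strong_induction_on generalizing S with
  | _ N ih =>
  rcases isEmpty_or_nonempty S with hS | ⟨⟨s⟩⟩
  · let κ₀ : CompletePairing S := ⟨id, fun _ => rfl, isEmptyElim⟩
    rw [Fintype.sum_eq_single κ₀ fun κ hκ => (hκ (Subtype.ext (Subsingleton.elim _ _))).elim]
    have : IsEmpty κ₀.Pairs := ⟨fun o => hS.false o.out⟩
    simp [CompletePairing.weight]
  have hproj {T : Type} [Finite T] (f : T → S) : HasGaussianLaw (fun ω p => X (f p) ω) P :=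
    have := Fintype.ofFinite T
    h.map (ContinuousLinearMap.pi fun p => ContinuousLinearMap.proj (R := ℝ) (f p))
  have hs : HasGaussianLaw (fun ω => (X s ω, fun t : {t : S // t ≠ s} => X t.1 ω)) P :=
    h.map ((ContinuousLinearMap.proj (R := ℝ) (φ := fun _ : S => ℝ) s).prod
      (ContinuousLinearMap.pi fun t : {t : S // t ≠ s} =>
        ContinuousLinearMap.proj (R := ℝ) (φ := fun _ : S => ℝ) t.1))
  have hrest (t : {t : S // t ≠ s}) (ω : Ω) :
      ∏ p ∈ Finset.univ.erase t, X p.1 ω = ∏ p : {p : S // p ≠ s ∧ p ≠ t.1}, X p.1 ω :=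
    Finset.prod_bij' (fun p hp => ⟨p.1, p.2, fun h => (Finset.ne_of_mem_erase hp) (Subtype.ext h)⟩)
      (fun p _ => ⟨p.1, p.2.1⟩) (by simp)
      (fun p _ => by simpa using fun h => p.2.2 (congrArg Subtype.val h))
      (by simp) (by simp) (by simp)
  simp_rw [fun ω => Fintype.prod_eq_mul_prod_subtype_ne (fun s => X s ω) s]
  rw [integral_mul_prod_of_hasGaussianLaw hs (hmean s),
    ← Fintype.sum_bijective _ (CompletePairing.extend_bijective s) _ _ fun _ => rfl,
    Fintype.sum_sigma]
  refine Finset.sum_congr rfl fun t _ => ?_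
  have hcard : Fintype.card {p : S // p ≠ s ∧ p ≠ t.1} < N :=
    hN ▸ Fintype.card_subtype_lt (x := s) (by simp)
  simp only [hrest, CompletePairing.weight_extend, ← Finset.mul_sum, covariances_map]
  rw [ih _ hcard (hproj Subtype.val) (fun p => hmean p.1) rfl]
  rfl

end Isserlis

/-! ### Density of elementary functions -/

section IndicatorSets

variable {α : Type*} [MeasurableSpace α] {μ : Measure α} [IsFiniteMeasure μ] {p : ENNReal}
  {W : Submodule ℝ (Lp ℝ p μ)} {s t : Set α}

/-- The measurable sets whose indicator functions belong to a given subspace of `L^p`. -/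
def indicatorSets (W : Submodule ℝ (Lp ℝ p μ)) : Set (Set α) :=
  {s | ∃ hs : MeasurableSet s, indicatorConstLp p hs (measure_ne_top μ s) (1 : ℝ) ∈ W}

theorem empty_mem_indicatorSets : ∅ ∈ indicatorSets W :=
  ⟨MeasurableSet.empty, by rw [indicatorConstLp_empty]; exact W.zero_mem⟩

theorem union_mem_indicatorSets (hs : s ∈ indicatorSets W) (ht : t ∈ indicatorSets W)
    (hst : Disjoint s t) : s ∪ t ∈ indicatorSets W := by
  obtain ⟨hsm, hs⟩ := hs
  obtain ⟨htm, ht⟩ := ht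
  refine ⟨hsm.union htm, ?_⟩
  rw [indicatorConstLp_disjoint_union hsm htm (measure_ne_top μ s) (measure_ne_top μ t) hst]
  exact W.add_mem hs ht

theorem diff_mem_indicatorSets (hs : s ∈ indicatorSets W) (ht : t ∈ indicatorSets W)
    (hts : t ⊆ s) : s \ t ∈ indicatorSets W := by
  obtain ⟨hsm, hs⟩ := hs
  obtain ⟨htm, ht⟩ := ht
  refine ⟨hsm.diff htm, ?_⟩
  have hunion := indicatorConstLp_disjoint_union (p := p) (hsm.diff htm) htm
    (measure_ne_top μ (s \ t)) (measure_ne_top μ t) disjoint_sdiff_left (1 : ℝ)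
  simp only [sdiff_union_of_subset hts] at hunion
  rw [eq_sub_of_add_eq hunion.symm]
  exact W.sub_mem hs ht

theorem mem_indicatorSets_of_ae_eq_iUnion [Fact (1 ≤ p)] (hp : p ≠ ⊤)
    (hW : IsClosed (W : Set (Lp ℝ p μ))) {β : Type*} [Countable β] {B : β → Set α}
    (hs : MeasurableSet s) (hsB : ∀ᵐ x ∂μ, x ∈ s ↔ ∃ b, x ∈ B b)
    (hB : ∀ t : Finset β, ⋃ b ∈ t, B b ∈ indicatorSets W) : s ∈ indicatorSets W := by
  choose hBm hBW using hB
  refine ⟨hs, hW.mem_of_tendsto (tendsto_indicatorConstLp_set (ht := hBm)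
    (hμt := fun _ => measure_ne_top μ _) (l := Filter.atTop) hp ?_) (.of_forall hBW)⟩
  rw [← measure_empty (μ := μ)]
  refine tendsto_measure_of_ae_tendsto_indicator_of_isFiniteMeasure _ MeasurableSet.empty
    (fun t => (hBm t).symmDiff hs) ?_
  filter_upwards [hsB] with x hx
  by_cases hxs : x ∈ s
  · obtain ⟨b, hb⟩ := hx.1 hxs
    filter_upwards [Filter.eventually_ge_atTop {b}] with t ht
    have hxt : x ∈ ⋃ b ∈ t, B b := mem_biUnion (Finset.singleton_subset_iff.1 ht) hb
    simp [mem_symmDiff, hxs, hxt]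
  · have hxB (b : β) : x ∉ B b := fun hb => hxs (hx.2 ⟨b, hb⟩)
    simp [mem_symmDiff, hxs, hxB]

theorem eq_top_of_measurableSet_mem_indicatorSets [Fact (1 ≤ p)] (hp : p ≠ ⊤)
    (hW : IsClosed (W : Set (Lp ℝ p μ))) (hmem : ∀ s, MeasurableSet s → s ∈ indicatorSets W) :
    W = ⊤ := by
  refine eq_top_iff.2 fun f _ => Lp.induction hp (· ∈ W) ?_ (fun _ _ _ _ _ => W.add_mem) hW f
  intro c s hs hμs
  obtain ⟨_, hs'⟩ := hmem s hs
  have hsmul : indicatorConstLp p hs hμs.ne c = c • indicatorConstLp p hs hμs.ne (1 : ℝ) := by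
    rw [indicatorConstLp, indicatorConstLp, ← MemLp.toLp_const_smul]
    exact MemLp.toLp_congr _ _ (.of_forall fun x => by by_cases hx : x ∈ s <;> simp [hx])
  rw [Lp.simpleFunc.coe_indicatorConst, hsmul]
  exact W.smul_mem c hs'

theorem inter_mem_indicatorSets_of_isPiSystem [Fact (1 ≤ p)] (hp : p ≠ ⊤)
    (hW : IsClosed (W : Set (Lp ℝ p μ))) {𝓒 : Set (Set α)}
    (hgen : ‹MeasurableSpace α› = MeasurableSpace.generateFrom 𝓒) (hpi : IsPiSystem 𝓒)
    (ht : t ∈ indicatorSets W) (hinter : ∀ c ∈ 𝓒, c ∩ t ∈ indicatorSets W)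
    (hs : MeasurableSet s) : s ∩ t ∈ indicatorSets W := by
  induction s, hs using MeasurableSpace.induction_on_inter hgen hpi with
  | empty => rw [empty_inter]; exact empty_mem_indicatorSets
  | basic s hs => exact hinter s hs
  | compl s _ ih =>
    have := diff_mem_indicatorSets ht ih inter_subset_right
    rwa [sdiff_inter_self_eq_sdiff, sdiff_eq, inter_comm] at this
  | iUnion f hd hf ih =>
    refine mem_indicatorSets_of_ae_eq_iUnion hp hW (B := fun n => f n ∩ t)
      ((MeasurableSet.iUnion hf).inter ht.1) (.of_forall fun x => by simp) fun u => ?_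
    induction u using Finset.induction_on with
    | empty => simpa using empty_mem_indicatorSets
    | insert n u hn ihu =>
      rw [Finset.set_biUnion_insert]
      refine union_mem_indicatorSets (ih n) ihu (disjoint_iUnion₂_right.2 fun m hm => ?_)
      exact (hd (ne_of_mem_of_not_mem hm hn).symm).mono inter_subset_left inter_subset_left

theorem eq_top_of_inter_mem_indicatorSets [Fact (1 ≤ p)] (hp : p ≠ ⊤)
    (hW : IsClosed (W : Set (Lp ℝ p μ))) {β : Type*} [Countable β] {B : β → Set α}
    (hB : ∀ b, MeasurableSet (B b)) (hcover : ∀ᵐ x ∂μ, ∃ b, x ∈ B b)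
    (hmem : ∀ b s, MeasurableSet s → s ∩ B b ∈ indicatorSets W) : W = ⊤ := by
  refine eq_top_of_measurableSet_mem_indicatorSets hp hW fun s hs => ?_
  refine mem_indicatorSets_of_ae_eq_iUnion hp hW (B := fun b => s ∩ B b) hs
    (hcover.mono fun x hx => by simpa using fun _ => hx) fun u => ?_
  classical
  induction u using Finset.induction_on generalizing s with
  | empty => simpa using empty_mem_indicatorSets
  | insert b u _ ih =>
    have hsplit : ⋃ a ∈ insert b u, s ∩ B a = s ∩ B b ∪ ⋃ a ∈ u, s \ B b ∩ B a := by
      simp only [Finset.set_biUnion_insert, ← inter_iUnion₂]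
      tauto_set
    rw [hsplit]
    refine union_mem_indicatorSets (hmem b s hs) (ih _ (hs.diff (hB b))) ?_
    exact disjoint_iUnion₂_right.2 fun a _ =>
      disjoint_left.2 fun x hx hx' => hx'.1.2 hx.2

end IndicatorSets

section DisjointBoxes

theorem exists_countable_cover_injective (X ι : Type*) [Finite ι] [TopologicalSpace X] [T2Space X]
    [SecondCountableTopology X] :
    ∃ T : Set (ι → Set X), T.Countable ∧
      (∀ A ∈ T, (∀ i, IsOpen (A i)) ∧ Pairwise fun i j => Disjoint (A i) (A j)) ∧
      ∀ z : ι → X, Function.Injective z → ∃ A ∈ T, z ∈ univ.pi A := by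
  have hsep (z : ι → X) (hz : Function.Injective z) : ∃ A : ι → Set X,
      (∀ i, z i ∈ A i ∧ IsOpen (A i)) ∧ Pairwise fun i j => Disjoint (A i) (A j) := by
    obtain ⟨U, hU, hd⟩ := (finite_range z).t2_separation
    exact ⟨fun i => U (z i), fun i => hU _, fun i j hij =>
      hd (mem_range_self i) (mem_range_self j) (hz.ne hij)⟩
  choose! A hA hd using hsep
  obtain ⟨T, hT, hTc, hcover⟩ := TopologicalSpace.countable_cover_nhdsWithin
    (s := {z : ι → X | Function.Injective z}) (f := fun z => univ.pi (A z)) fun z hz =>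
      mem_nhdsWithin_of_mem_nhds
        (set_pi_mem_nhds finite_univ fun i _ => (hA z hz i).2.mem_nhds (hA z hz i).1)
  refine ⟨A '' T, hTc.image A, ?_, fun z hz => ?_⟩
  · rintro _ ⟨z, hz, rfl⟩
    exact ⟨fun i => (hA z (hT hz) i).2, hd z (hT hz)⟩
  · obtain ⟨w, hw, hzw⟩ := mem_iUnion₂.1 (hcover hz)
    exact ⟨A w, mem_image_of_mem A hw, hzw⟩

variable {X ι : Type*} [Fintype ι] [MeasurableSpace X] {μ : Measure X} [NullSingletonClass μ]

theorem ae_injective_pi [TopologicalSpace X] [OpensMeasurableSpace X] [T2Space X]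
    [SecondCountableTopology X] [SigmaFinite μ] :
    ∀ᵐ z ∂Measure.pi fun _ : ι => μ, Function.Injective z := by
  classical
  suffices hne : ∀ i j, i ≠ j → ∀ᵐ z ∂Measure.pi fun _ : ι => μ, z i ≠ z j by
    simp only [← ae_all_iff] at hne
    filter_upwards [hne] with z hz i j
    exact not_imp_not.1 (hz i j)
  intro i j hij
  have hmp := measurePreserving_piEquivPiSubtypeProd (fun _ : ι => μ) (· = j)
  refine hmp.quasiMeasurePreserving.ae (p := fun w => w.2 ⟨i, hij⟩ ≠ w.1 ⟨j, rfl⟩) ?_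
  have hm : MeasurableSet {w : ({l // l = j} → X) × ({l // ¬l = j} → X) |
      w.2 ⟨i, hij⟩ = w.1 ⟨j, rfl⟩} := measurableSet_eq_fun (by fun_prop) (by fun_prop)
  simp only [ae_iff, not_not]
  refine (Measure.measure_prod_null hm).2 (.of_forall fun a => ?_)
  exact Measure.pi_hyperplane _ _ _

theorem eq_top_of_disjoint_box_mem_indicatorSets [TopologicalSpace X] [OpensMeasurableSpace X]
    [T2Space X] [SecondCountableTopology X] [IsFiniteMeasure μ] {p : ENNReal} [Fact (1 ≤ p)]
    (hp : p ≠ ⊤) {W : Submodule ℝ (Lp ℝ p (Measure.pi fun _ : ι => μ))}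
    (hW : IsClosed (W : Set (Lp ℝ p (Measure.pi fun _ : ι => μ))))
    (hbox : ∀ A : ι → Set X, (∀ i, MeasurableSet (A i)) →
      (Pairwise fun i j => Disjoint (A i) (A j)) → univ.pi A ∈ indicatorSets W) :
    W = ⊤ := by
  obtain ⟨T, hTc, hT, hcover⟩ := exists_countable_cover_injective X ι
  have := hTc.to_subtype
  have hTm (A : T) (i : ι) : MeasurableSet (A.1 i) := ((hT A A.2).1 i).measurableSet
  refine eq_top_of_inter_mem_indicatorSets hp hW (B := fun A : T => univ.pi A.1)
    (fun A => MeasurableSet.univ_pi (hTm A)) ?_ fun A s hs => ?_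
  · filter_upwards [ae_injective_pi (ι := ι) (μ := μ)] with z hz
    simpa using hcover z hz
  · refine inter_mem_indicatorSets_of_isPiSystem hp hW generateFrom_pi.symm isPiSystem_pi
      (hbox A.1 (hTm A) (hT A A.2).2) ?_ hs
    rintro _ ⟨C, hC, rfl⟩
    rw [← pi_inter_distrib]
    exact hbox _ (fun i => (hC i trivial).inter (hTm A i)) fun i j hij =>
      ((hT A A.2).2 hij).mono inter_subset_right inter_subset_right

end DisjointBoxes

section ElementaryFunctions

instance nullSingletonClass_volume_addCircle {T : ℝ} [Fact (0 < T)] :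
    NullSingletonClass (volume : Measure (AddCircle T)) := by
  have hT : (0 : ℝ) < 0 + T := by simpa using Fact.out
  have : Infinite (Ico 0 (0 + T)) := (Ico_infinite hT).to_subtype
  have : Nontrivial (AddCircle T) := (AddCircle.equivIco T 0).nontrivial
  have : (nhdsWithin (0 : AddCircle T) {0}ᶜ).NeBot :=
    ConnectedSpace.neBot_nhdsWithin_compl_of_nontrivial_of_t1space 0
  infer_instance

/-- The elementary function `∑ c_A 𝟙_{∏ A_i}` as an element of `L^p`; for `p = 2` this is
`elementaryFun`. -/
def boxFun (p : ENNReal) (ι : Type) [Fintype ι] :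
    (DisjointFamily ι →₀ ℝ) →ₗ[ℝ] Lp ℝ p (volume : Measure (ι → T4)) :=
  Finsupp.linearCombination ℝ fun A : DisjointFamily ι =>
    indicatorConstLp p (MeasurableSet.univ_pi A.2.1)
      (measure_ne_top volume (Set.univ.pi A.1)) (1 : ℝ)

theorem denseRange_boxFun {p : ENNReal} [Fact (1 ≤ p)] (hp : p ≠ ⊤) (ι : Type) [Fintype ι] :
    DenseRange (boxFun p ι) := by
  rw [DenseRange, ← LinearMap.coe_range, Submodule.dense_iff_topologicalClosure_eq_top]
  refine eq_top_of_disjoint_box_mem_indicatorSets hp (Submodule.isClosed_topologicalClosure _)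
    fun A hA hd => ⟨MeasurableSet.univ_pi hA, Submodule.le_topologicalClosure _ ?_⟩
  exact ⟨Finsupp.single ⟨A, hA, hd⟩ 1, by simp [boxFun]⟩

end ElementaryFunctions

/-! ### Products in `L^q` and changes of variables -/

section ProdIntegral

variable {α K : Type*} [MeasurableSpace α] {μ : Measure α} [Fintype K] {q : ENNReal}

theorem card_div_toReal_le_one (hq : q ≠ ⊤) (hK : (Fintype.card K : ENNReal) ≤ q) :
    (Fintype.card K : ℝ) / q.toReal ≤ 1 :=
  div_le_one_of_le₀ (by simpa using ENNReal.toReal_mono hq hK) ENNReal.toReal_nonneg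

theorem lintegral_enorm_prod_le (hq : q ≠ ⊤) (hK : (Fintype.card K : ENNReal) ≤ q)
    {X : K → α → ℝ} (hX : ∀ i, AEStronglyMeasurable (X i) μ) :
    ∫⁻ a, ‖∏ i, X i a‖ₑ ∂μ ≤
      μ univ ^ (1 - (Fintype.card K : ℝ) / q.toReal) * ∏ i, eLpNorm (X i) q μ := by
  rcases eq_or_ne q 0 with rfl | hq0
  · have : IsEmpty K := Fintype.card_eq_zero_iff.1 (by simpa using hK)
    simp
  have hq_pos : 0 < q.toReal := ENNReal.toReal_pos hq0 hq
  have hroot (i : K) (a : α) : (‖X i a‖ₑ ^ q.toReal) ^ (1 / q.toReal) = ‖X i a‖ₑ := by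
    rw [← ENNReal.rpow_mul, mul_one_div_cancel hq_pos.ne', ENNReal.rpow_one]
  have henorm (a : α) : ‖∏ i, X i a‖ₑ = ∏ i, ‖X i a‖ₑ := by
    simp only [enorm_eq_nnnorm, nnnorm_prod, ENNReal.ofNNReal_finsetProd]
  -- Hölder's inequality, with the constant function 1 as an additional factor.
  have holder := ENNReal.lintegral_prod_norm_pow_le (μ := μ) (Finset.univ : Finset (Option K))
    (f := fun o a => o.elim 1 fun i => ‖X i a‖ₑ ^ q.toReal)
    (p := fun o => o.elim (1 - (Fintype.card K : ℝ) / q.toReal) fun _ => 1 / q.toReal)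
    (by rintro (_ | i) _
        exacts [aemeasurable_const, (hX i).enorm.pow_const _])
    (by simp [Fintype.sum_option, div_eq_mul_inv])
    (by rintro (_ | i) _
        exacts [sub_nonneg.2 (card_div_toReal_le_one hq hK), by simp])
  simpa only [Fintype.prod_option, Option.elim_none, Option.elim_some, ENNReal.one_rpow, one_mul,
    lintegral_const, hroot, ← henorm,
    ← eLpNorm_eq_lintegral_rpow_enorm_toReal hq0 hq] using holder

theorem lintegral_enorm_prod_bound_ne_top [IsFiniteMeasure μ] (hq : q ≠ ⊤)
    (hK : (Fintype.card K : ENNReal) ≤ q) {X : K → α → ℝ} (hX : ∀ i, MemLp (X i) q μ) :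
    μ univ ^ (1 - (Fintype.card K : ℝ) / q.toReal) * ∏ i, eLpNorm (X i) q μ ≠ ⊤ :=
  ENNReal.mul_ne_top
    (ENNReal.rpow_ne_top_of_nonneg (sub_nonneg.2 (card_div_toReal_le_one hq hK))
      (measure_ne_top _ _))
    (ENNReal.prod_ne_top fun i _ => (hX i).2.ne)

theorem integrable_prod_of_memLp [IsFiniteMeasure μ] (hq : q ≠ ⊤)
    (hK : (Fintype.card K : ENNReal) ≤ q) {X : K → α → ℝ} (hX : ∀ i, MemLp (X i) q μ) :
    Integrable (fun a => ∏ i, X i a) μ :=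
  ⟨Finset.aestronglyMeasurable_fun_prod _ fun i _ => (hX i).1,
    (lintegral_enorm_prod_le hq hK fun i => (hX i).1).trans_lt
      (lintegral_enorm_prod_bound_ne_top hq hK hX).lt_top⟩

theorem prod_update_lp_apply [DecidableEq K] (X : K → Lp ℝ q μ) (i : K) (x : Lp ℝ q μ) (a : α) :
    ∏ j, Function.update X i x j a = x a * ∏ j ∈ Finset.univ \ {i}, X j a := by
  simp_rw [Function.apply_update (fun _ (f : Lp ℝ q μ) => f a)]
  exact Finset.prod_update_of_mem (Finset.mem_univ i) _ _

variable [IsFiniteMeasure μ] [Fact (1 ≤ q)]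

/-- The continuous multilinear map `(X_i) ↦ ∫ ∏ X_i` on `L^q`, where `q` is at least the number of
factors. -/
def prodIntegral (μ : Measure α) [IsFiniteMeasure μ] (hq : q ≠ ⊤)
    (hK : (Fintype.card K : ENNReal) ≤ q) :
    ContinuousMultilinearMap ℝ (fun _ : K => Lp ℝ q μ) ℝ :=
  MultilinearMap.mkContinuous
    { toFun := fun X => ∫ a, ∏ i, X i a ∂μ
      map_update_add' := by
        intro _ X i x y
        rw [← integral_add (integrable_prod_of_memLp hq hK fun i => Lp.memLp _)
          (integrable_prod_of_memLp hq hK fun i => Lp.memLp _)]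
        refine integral_congr_ae ?_
        filter_upwards [Lp.coeFn_add x y] with a ha
        simp only [prod_update_lp_apply, ha, Pi.add_apply, add_mul]
      map_update_smul' := by
        intro _ X i c x
        rw [smul_eq_mul, ← integral_const_mul]
        refine integral_congr_ae ?_
        filter_upwards [Lp.coeFn_smul c x] with a ha
        simp only [prod_update_lp_apply, ha, Pi.smul_apply, smul_eq_mul, mul_assoc] }
    (μ univ ^ (1 - (Fintype.card K : ℝ) / q.toReal)).toReal
    (by
      intro X
      have hle := ENNReal.toReal_mono
        (lintegral_enorm_prod_bound_ne_top hq hK fun i => Lp.memLp (X i))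
        ((enorm_integral_le_lintegral_enorm _).trans
          (lintegral_enorm_prod_le hq hK fun i => (Lp.memLp (X i)).1))
      rwa [ENNReal.toReal_mul, ENNReal.toReal_prod, toReal_enorm] at hle)

theorem prodIntegral_apply (hq : q ≠ ⊤) (hK : (Fintype.card K : ENNReal) ≤ q)
    (X : K → Lp ℝ q μ) : prodIntegral μ hq hK X = ∫ a, ∏ i, X i a ∂μ := rfl

theorem prodIntegral_eq_integral_prod (hq : q ≠ ⊤) (hK : (Fintype.card K : ENNReal) ≤ q)
    {X : K → Lp ℝ q μ} {f : K → α → ℝ} (h : ∀ i, X i =ᵐ[μ] f i) :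
    prodIntegral μ hq hK X = ∫ a, ∏ i, f i a ∂μ := by
  refine integral_congr_ae ?_
  filter_upwards [ae_all_iff.2 h] with a ha
  exact Finset.prod_congr rfl fun i _ => ha i

theorem norm_pow_eq_prodIntegral {m : ℕ} (hq : q ≠ ⊤) (hm : q = (2 * m : ℕ)) (f : Lp ℝ q μ) :
    ‖f‖ ^ (2 * m) = prodIntegral (K := Fin (2 * m)) μ hq (by simp [hm]) fun _ => f := by
  have hq0 : q ≠ 0 := (one_pos.trans_le (Fact.out : 1 ≤ q)).ne'
  have hm0 : ((2 * m : ℕ) : ℝ) ≠ 0 := by exact_mod_cast hm ▸ hq0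
  rw [prodIntegral_apply, Lp.norm_def, (Lp.memLp f).eLpNorm_eq_integral_rpow_norm hq0 hq,
    ENNReal.toReal_ofReal (by positivity), ← Real.rpow_natCast, ← Real.rpow_mul (by positivity),
    show q.toReal = ((2 * m : ℕ) : ℝ) by rw [hm, ENNReal.toReal_natCast], inv_mul_cancel₀ hm0,
    Real.rpow_one]
  simp only [Real.rpow_natCast]
  simp [pow_mul]

/-- The inclusion of `L^q` into `L^p` for `p ≤ q` and a finite measure. -/
def lpInclusion (μ : Measure α) [IsFiniteMeasure μ] {p q : ENNReal} [Fact (1 ≤ p)]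
    [Fact (1 ≤ q)] (hpq : p ≤ q) : Lp ℝ q μ →L[ℝ] Lp ℝ p μ :=
  LinearMap.mkContinuous
    { toFun := fun f => ⟨f.1, Lp.antitone hpq f.2⟩
      map_add' := fun _ _ => rfl
      map_smul' := fun _ _ => rfl }
    (μ univ ^ (1 / p.toReal - 1 / q.toReal)).toReal
    (by
      intro f
      have hp_ne : p ≠ 0 := (one_pos.trans_le (Fact.out : 1 ≤ p)).ne'
      have hexp : 0 ≤ 1 / p.toReal - 1 / q.toReal := by
        rw [one_div, one_div, sub_nonneg, ← ENNReal.toReal_inv, ← ENNReal.toReal_inv]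
        exact ENNReal.toReal_mono (ENNReal.inv_ne_top.2 hp_ne) (ENNReal.inv_le_inv.2 hpq)
      have hle := ENNReal.toReal_mono
        (ENNReal.mul_ne_top (Lp.memLp f).2.ne
          (ENNReal.rpow_ne_top_of_nonneg hexp (measure_ne_top _ _)))
        (eLpNorm_le_eLpNorm_mul_rpow_measure_univ hpq (Lp.memLp f).1)
      rw [ENNReal.toReal_mul, mul_comm] at hle
      exact hle)

theorem coeFn_lpInclusion {p : ENNReal} [Fact (1 ≤ p)] (hpq : p ≤ q) (f : Lp ℝ q μ) :
    (lpInclusion μ hpq f : α → ℝ) = f := rfl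

end ProdIntegral

theorem lpInclusion_boxFun {p q : ENNReal} [Fact (1 ≤ p)] [Fact (1 ≤ q)] (hpq : p ≤ q)
    {ι : Type} [Fintype ι] (c : DisjointFamily ι →₀ ℝ) :
    lpInclusion volume hpq (boxFun q ι c) = boxFun p ι c := by
  have hlin : (lpInclusion volume hpq).toLinearMap ∘ₗ boxFun q ι = boxFun p ι := by
    refine Finsupp.lhom_ext' fun A => LinearMap.ext_ring ?_
    simp only [boxFun, LinearMap.comp_apply, Finsupp.lsingle_apply,
      Finsupp.linearCombination_single, one_smul]
    rfl
  exact LinearMap.congr_fun hlin c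

section Pullback

variable {X O ι : Type*} [MeasureSpace X] [IsFiniteMeasure (volume : Measure X)]
  [Fintype O] [Fintype ι] {q : ENNReal} {e : ι → O}

theorem exists_map_comp_eq_smul_volume (he : Function.Injective e) :
    ∃ C : NNReal, Measure.map (fun (z : O → X) i => z (e i)) volume =
      C • (volume : Measure (ι → X)) := by
  classical
  have hsplit := volume_preserving_piEquivPiSubtypeProd (fun _ : O => X) (· ∈ range e)
  have hreindex := (volume_measurePreserving_piCongrLeft (fun _ : range e => X)
    (Equiv.ofInjective e he)).symm
  let ν : Measure ({o : O // o ∉ range e} → X) := volume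
  have hcomp : (fun (z : O → X) i => z (e i)) =
      (MeasurableEquiv.piCongrLeft (fun _ : range e => X) (Equiv.ofInjective e he)).symm ∘
        Prod.fst ∘ MeasurableEquiv.piEquivPiSubtypeProd (fun _ : O => X) (· ∈ range e) :=
    rfl
  refine ⟨(ν univ).toNNReal, ?_⟩
  rw [hcomp, ← Measure.map_map hreindex.measurable (measurable_fst.comp hsplit.measurable),
    ← Measure.map_map measurable_fst hsplit.measurable, hsplit.map_eq,
    Measure.volume_eq_prod, Measure.map_fst_prod, Measure.map_smul,
    ← ENNReal.coe_toNNReal (measure_ne_top ν univ)]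
  congr 1
  convert hreindex.map_eq

theorem quasiMeasurePreserving_comp_injective (he : Function.Injective e) :
    Measure.QuasiMeasurePreserving (fun (z : O → X) i => z (e i)) volume volume := by
  refine ⟨by fun_prop, ?_⟩
  obtain ⟨C, hC⟩ := exists_map_comp_eq_smul_volume (X := X) he
  rw [hC]
  exact Measure.smul_absolutelyContinuous (c := (C : ENNReal))

theorem exists_eLpNorm_comp_injective_eq (hq : q ≠ ⊤) (he : Function.Injective e) :
    ∃ C : NNReal, ∀ f : (ι → X) → ℝ, AEStronglyMeasurable f volume →
      eLpNorm (fun z : O → X => f fun i => z (e i)) q volume = C * eLpNorm f q volume := by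
  obtain ⟨C, hC⟩ := exists_map_comp_eq_smul_volume (X := X) he
  refine ⟨C ^ (1 / q).toReal, fun f hf => ?_⟩
  have hf' : AEStronglyMeasurable f (Measure.map (fun (z : O → X) i => z (e i)) volume) :=
    hf.mono_ac (quasiMeasurePreserving_comp_injective he).absolutelyContinuous
  rw [← Function.comp_def f, ← eLpNorm_map_measure hf'
    (quasiMeasurePreserving_comp_injective he).aemeasurable, hC,
    ENNReal.coe_rpow_of_nonneg _ ENNReal.toReal_nonneg]
  exact eLpNorm_smul_measure_of_ne_top hq f (C : ENNReal)

theorem memLp_comp_injective (hq : q ≠ ⊤) (he : Function.Injective e) {f : (ι → X) → ℝ}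
    (hf : MemLp f q volume) : MemLp (fun z : O → X => f fun i => z (e i)) q volume := by
  obtain ⟨C, hC⟩ := exists_eLpNorm_comp_injective_eq (X := X) hq he
  refine ⟨hf.1.comp_quasiMeasurePreserving (quasiMeasurePreserving_comp_injective he), ?_⟩
  rw [hC f hf.1]
  exact ENNReal.mul_lt_top ENNReal.coe_lt_top hf.2

variable [Fact (1 ≤ q)]

/-- Composition with the reindexing `z ↦ z ∘ e` of the variables, as a map between `L^q` spaces. -/
def pullback (hq : q ≠ ⊤) (he : Function.Injective e) :
    Lp ℝ q (volume : Measure (ι → X)) →L[ℝ] Lp ℝ q (volume : Measure (O → X)) :=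
  LinearMap.mkContinuousOfExistsBound
    { toFun := fun f => (memLp_comp_injective hq he (Lp.memLp f)).toLp _
      map_add' := by
        intro f g
        rw [← MemLp.toLp_add]
        exact MemLp.toLp_congr _ _
          ((quasiMeasurePreserving_comp_injective he).ae_eq_comp (Lp.coeFn_add f g))
      map_smul' := by
        intro c f
        rw [RingHom.id_apply, ← MemLp.toLp_const_smul]
        exact MemLp.toLp_congr _ _
          ((quasiMeasurePreserving_comp_injective he).ae_eq_comp (Lp.coeFn_smul c f)) }
    (by
      obtain ⟨C, hC⟩ := exists_eLpNorm_comp_injective_eq (X := X) hq he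
      refine ⟨C, fun f => le_of_eq ?_⟩
      rw [LinearMap.coe_mk, AddHom.coe_mk, Lp.norm_toLp, hC f (Lp.memLp f).1, ENNReal.toReal_mul,
        ENNReal.coe_toReal, Lp.norm_def])

theorem pullback_ae_eq (hq : q ≠ ⊤) (he : Function.Injective e)
    {F : Lp ℝ q (volume : Measure (ι → X))} {f : (ι → X) → ℝ} (hF : F =ᵐ[volume] f) :
    pullback (O := O) hq he F =ᵐ[volume] fun z => f fun i => z (e i) :=
  (MemLp.coeFn_toLp (memLp_comp_injective hq he (Lp.memLp F))).trans
    ((quasiMeasurePreserving_comp_injective he).ae_eq_comp hF)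

end Pullback

/-! ### Moments of multiple Wiener-Itô integrals -/

/-- Complete pairings of a disjoint union without pairs inside one of the summands. -/
abbrev ExternalPairing {K : Type} (ι : K → Type) : Type :=
  {σ : CompletePairing (Σ i, ι i) // ∀ p, (σ.1 p).1 ≠ p.1}

instance {K : Type} [Finite K] (ι : K → Type) [∀ i, Finite (ι i)] :
    Fintype (ExternalPairing ι) := Fintype.ofFinite _

/-- The pair of an element of the `i`-th summand. -/
def ExternalPairing.slot {K : Type} {ι : K → Type} (σ : ExternalPairing ι) (i : K) (j : ι i) :
    σ.1.Pairs :=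
  Quot.mk _ ⟨i, j⟩

theorem ExternalPairing.slot_injective {K : Type} {ι : K → Type} (σ : ExternalPairing ι) (i : K) :
    Function.Injective (σ.slot i) := by
  intro j j' h
  rcases σ.1.mk_eq_mk_iff.1 h with h | h
  · simpa using h.symm
  · exact (σ.2 ⟨i, j⟩ (congrArg Sigma.fst h).symm).elim

namespace CompletePairing

variable {S : Type} [Fintype S] (κ : CompletePairing S)

theorem weight_map_mul (f : S → ℝ) : κ.weight (fun s => (s.map f).mul) = ∏ p, f p := by
  classical
  rw [weight, ← Finset.prod_fiberwise Finset.univ fun p => (Quot.mk _ p : κ.Pairs)]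
  refine Finset.prod_congr rfl ?_
  rintro ⟨p⟩ -
  have hfiber : (Finset.univ.filter fun q : S => (Quot.mk _ q : κ.Pairs) = Quot.mk _ p) =
      {p, κ.1 p} := by
    ext q
    simp only [Finset.mem_filter, Finset.mem_univ, true_and, Finset.mem_insert,
      Finset.mem_singleton]
    exact eq_comm.trans κ.mk_eq_mk_iff
  exact ((congrArg (∏ q ∈ ·, f q) hfiber).trans (Finset.prod_pair (κ.2.2 p).symm)).symm

theorem integral_prod_comp_mk {X : Type*} [MeasureSpace X] [SigmaFinite (volume : Measure X)]
    (g : S → X → ℝ) :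
    ∫ z : κ.Pairs → X, ∏ p, g p (z (Quot.mk _ p)) =
      κ.weight fun s => ∫ t, (s.map fun p => g p t).mul := by
  rw [weight, ← integral_fintype_prod_volume_eq_prod]
  congr 1
  funext z
  rw [← κ.weight_map_mul, weight]
  refine Finset.prod_congr rfl ?_
  rintro ⟨p⟩ -
  have hmk : (Quot.mk _ p : κ.Pairs) = Quot.mk _ (κ.1 p) := Quot.sound rfl
  change g p (z (Quot.mk _ p)) * g (κ.1 p) (z (Quot.mk _ (κ.1 p))) =
    g p (z (Quot.mk _ p)) * g (κ.1 p) (z (Quot.mk _ p))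
  rw [hmk]

end CompletePairing

section WienerMoments

variable {Ω : Type*} [MeasurableSpace Ω] {P : Measure Ω} (ξ : WhiteNoise P)

namespace WhiteNoise

theorem hasGaussianLaw_comp {S : Type*} [Finite S] (g : S → Lp ℝ 2 (volume : Measure T4)) :
    HasGaussianLaw (fun ω s => ξ.toFun (g s) ω) P :=
  have := Fintype.ofFinite S
  ((ξ.gaussian.comp_right g).hasGaussianLaw Finset.univ).map
    (ContinuousLinearMap.pi fun s : S => ContinuousLinearMap.proj (R := ℝ)
      (φ := fun _ : (Finset.univ : Finset S) => ℝ) ⟨s, Finset.mem_univ s⟩)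

theorem covariances_ofSet {S : Type*} {B : S → Set T4} (hB : ∀ p, MeasurableSet (B p))
    (s : Sym2 S) :
    covariances (fun p => ξ.ofSet (hB p)) P s =
      ∫ t, (s.map fun p => (B p).indicator (1 : T4 → ℝ) t).mul := by
  induction s with | _ p q
  have : IsProbabilityMeasure P := ξ.gaussian.isProbabilityMeasure
  have hL2 (p : S) : MemLp (ξ.ofSet (hB p)) 2 P :=
    (ξ.gaussian.hasGaussianLaw_eval _).memLp (by simp)
  have hmean : ∫ ω, ξ.ofSet (hB p) ω ∂P = 0 := ξ.centred _
  have hinter (t : T4) : (B p).indicator (1 : T4 → ℝ) t * (B q).indicator 1 t =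
      (B p ∩ B q).indicator 1 t := by
    rw [inter_indicator_one, Pi.mul_apply]
  change cov[ξ.ofSet (hB p), ξ.ofSet (hB q); P] =
    ∫ t, (B p).indicator 1 t * (B q).indicator 1 t
  simp_rw [hinter]
  rw [covariance_eq_sub (hL2 p) (hL2 q), hmean, zero_mul, sub_zero]
  refine (ξ.covariance _ _).trans ?_
  rw [L2.inner_indicatorConstLp_indicatorConstLp, integral_indicator_one ((hB p).inter (hB q))]
  simp [Measure.real]

theorem integral_prod_ofSet {S : Type} [Fintype S] {B : S → Set T4}
    (hB : ∀ p, MeasurableSet (B p)) :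
    ∫ ω, ∏ p, ξ.ofSet (hB p) ω ∂P = ∑ κ : CompletePairing S, ∫ z : κ.Pairs → T4,
      ∏ p, (B p).indicator (1 : T4 → ℝ) (z (Quot.mk _ p)) := by
  refine (integral_prod_of_hasGaussianLaw (X := fun p => ξ.ofSet (hB p))
    (ξ.hasGaussianLaw_comp _) fun _ => ξ.centred _).trans ?_
  simp_rw [CompletePairing.integral_prod_comp_mk]
  simp only [CompletePairing.weight, ← ξ.covariances_ofSet hB]

variable {K : Type} [Fintype K] {ι : K → Type} [∀ i, Fintype (ι i)]

theorem integral_prod_prod_ofSet (A : ∀ i, DisjointFamily (ι i)) :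
    ∫ ω, ∏ i, ∏ j, ξ.ofSet ((A i).2.1 j) ω ∂P =
      ∑ σ : ExternalPairing ι, ∫ z : σ.1.Pairs → T4,
        ∏ i, (univ.pi (A i).1).indicator (1 : (ι i → T4) → ℝ) fun j => z (σ.slot i j) := by
  classical
  let B (p : Σ i, ι i) : Set T4 := (A p.1).1 p.2
  have hB (p : Σ i, ι i) : MeasurableSet (B p) := (A p.1).2.1 p.2
  have hcalc := ξ.integral_prod_ofSet hB
  simp only [Fintype.prod_sigma] at hcalc
  rw [hcalc]
  refine (Fintype.sum_of_injective Subtype.val Subtype.val_injective _ _ ?_ fun σ => ?_).symm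
  · intro κ hκ
    obtain ⟨p, hp⟩ : ∃ p, (κ.1 p).1 = p.1 := by simpa using hκ
    have hdisj : Disjoint (B p) (B (κ.1 p)) := by
      have hne := κ.2.2 p
      generalize κ.1 p = q at hp hne
      obtain ⟨i, j⟩ := p
      obtain ⟨i', j'⟩ := q
      obtain rfl : i' = i := hp
      exact (A i').2.2 fun h : j = j' => hne (by rw [h])
    have hmk : (Quot.mk _ p : κ.Pairs) = Quot.mk _ (κ.1 p) := Quot.sound rfl
    have hzero (z : κ.Pairs → T4) :
        ∏ q, (B q).indicator (1 : T4 → ℝ) (z (Quot.mk _ q)) = 0 := by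
      by_contra hne
      have hmem (q : Σ i, ι i) : z (Quot.mk _ q) ∈ B q :=
        mem_of_indicator_ne_zero (Finset.prod_ne_zero_iff.1 hne q (Finset.mem_univ q))
      exact disjoint_left.1 hdisj (hmem p) (hmk ▸ hmem (κ.1 p))
    simp only [Fintype.prod_sigma] at hzero
    simp only [hzero, integral_zero]
  · congr 1
    funext z
    refine Finset.prod_congr rfl fun i _ => ?_
    simp only [indicator_apply, mem_univ_pi, Pi.one_apply, Finset.prod_ite_zero, Finset.mem_univ,
      forall_const, Finset.prod_const_one]
    congr

theorem memLp_prod_ofSet_of_ne_top {ι : Type} [Fintype ι] (A : DisjointFamily ι) {q : ENNReal}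
    (hq : q ≠ ⊤) : MemLp (fun ω => ∏ i, ξ.ofSet (A.2.1 i) ω) q P :=
  have : IsProbabilityMeasure P := ξ.gaussian.isProbabilityMeasure
  memLp_finsetProd_of_forall_ne_top Finset.univ
    (fun _ _ _ h => (ξ.gaussian.hasGaussianLaw_eval _).memLp h) hq

end WhiteNoise

/-- The integral of elementary functions, as an element of `L^q`; for `q = 2` this is
`elementaryIntegral`. -/
def boxIntegral {q : ENNReal} (hq : q ≠ ⊤) (ι : Type) [Fintype ι] :
    (DisjointFamily ι →₀ ℝ) →ₗ[ℝ] Lp ℝ q P :=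
  Finsupp.linearCombination ℝ fun A => (ξ.memLp_prod_ofSet_of_ne_top A hq).toLp _

section Basis

variable {ι : Type} [Fintype ι] {q : ENNReal} (A : DisjointFamily ι)

theorem boxIntegral_single_ae_eq (hq : q ≠ ⊤) :
    boxIntegral ξ hq ι (Finsupp.single A 1) =ᵐ[P] fun ω => ∏ i, ξ.ofSet (A.2.1 i) ω := by
  rw [boxIntegral, Finsupp.linearCombination_single, one_smul]
  exact MemLp.coeFn_toLp _

theorem boxFun_single_ae_eq :
    boxFun q ι (Finsupp.single A 1) =ᵐ[volume] (univ.pi A.1).indicator 1 := by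
  rw [boxFun, Finsupp.linearCombination_single, one_smul]
  exact indicatorConstLp_coeFn

end Basis

variable {K : Type} [Fintype K] {ι : K → Type} [∀ i, Fintype (ι i)]

section Lq

variable {q : ENNReal} [Fact (1 ≤ q)] [IsFiniteMeasure P]

theorem prodIntegral_boxIntegral (hq : q ≠ ⊤) (hK : (Fintype.card K : ENNReal) ≤ q)
    (c : ∀ i, DisjointFamily (ι i) →₀ ℝ) :
    prodIntegral P hq hK (fun i => boxIntegral ξ hq (ι i) (c i)) =
      ∑ σ : ExternalPairing ι, prodIntegral volume hq hK fun i =>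
        pullback hq (σ.slot_injective i) (boxFun q (ι i) (c i)) := by
  let L : MultilinearMap ℝ (fun i => DisjointFamily (ι i) →₀ ℝ) ℝ :=
    (prodIntegral P hq hK).toMultilinearMap.compLinearMap fun i => boxIntegral ξ hq (ι i)
  let R (σ : ExternalPairing ι) : MultilinearMap ℝ (fun i => DisjointFamily (ι i) →₀ ℝ) ℝ :=
    (prodIntegral volume hq hK).toMultilinearMap.compLinearMap fun i =>
      (pullback hq (σ.slot_injective i)).toLinearMap ∘ₗ boxFun q (ι i)
  have hLR : L = ∑ σ, R σ := by
    refine Module.Basis.ext_multilinear (fun i => Finsupp.basisSingleOne) fun A => ?_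
    simp only [Finsupp.coe_basisSingleOne, sum_apply]
    have hL : L (fun i => Finsupp.single (A i) 1) =
        ∫ ω, ∏ i, ∏ j, ξ.ofSet ((A i).2.1 j) ω ∂P :=
      prodIntegral_eq_integral_prod hq hK fun i => boxIntegral_single_ae_eq ξ (A i) hq
    have hR (σ : ExternalPairing ι) : R σ (fun i => Finsupp.single (A i) 1) =
        ∫ z : σ.1.Pairs → T4,
          ∏ i, (univ.pi (A i).1).indicator (1 : (ι i → T4) → ℝ) fun j => z (σ.slot i j) :=
      prodIntegral_eq_integral_prod hq hK fun i =>
        pullback_ae_eq hq (σ.slot_injective i) (boxFun_single_ae_eq (A i))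
    simp_rw [hL, hR, ξ.integral_prod_prod_ofSet]
  have happly := congrArg (fun M => M c) hLR
  simp only [sum_apply] at happly
  exact happly

theorem norm_continuousMultilinearMap_comp_le {E F K : Type*} [Fintype K] [NormedAddCommGroup E]
    [NormedSpace ℝ E] [NormedAddCommGroup F] [NormedSpace ℝ F]
    (M : ContinuousMultilinearMap ℝ (fun _ : K => F) ℝ) (T : K → E →L[ℝ] F) (f : E) :
    ‖M fun i => T i f‖ ≤ ‖M‖ * (∏ i, ‖T i‖) * ‖f‖ ^ Fintype.card K :=
  calc ‖M fun i => T i f‖ ≤ ‖M‖ * ∏ i, ‖T i f‖ := M.le_opNorm _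
    _ ≤ ‖M‖ * ∏ i, ‖T i‖ * ‖f‖ := by
      gcongr with i
      exact (T i).le_opNorm f
    _ = ‖M‖ * (∏ i, ‖T i‖) * ‖f‖ ^ Fintype.card K := by
      rw [Finset.prod_mul_distrib, Finset.prod_const, Finset.card_univ, mul_assoc]

-- Evenness of the exponent makes `‖·‖ ^ q` the value of `prodIntegral` on the diagonal.
theorem exists_norm_boxIntegral_le {m : ℕ} (hq : q ≠ ⊤) (hm : q = (2 * m : ℕ)) (ι : Type)
    [Fintype ι] : ∃ C : ℝ, ∀ c, ‖boxIntegral ξ hq ι c‖ ≤ C * ‖boxFun q ι c‖ := by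
  have hK : (Fintype.card (Fin (2 * m)) : ENNReal) ≤ q := by simp [hm]
  have hm0 : 2 * m ≠ 0 := by
    have := (one_pos.trans_le (Fact.out : 1 ≤ q)).ne'
    exact_mod_cast hm ▸ this
  set C : ℝ := ∑ σ : ExternalPairing (fun _ : Fin (2 * m) => ι),
    ‖prodIntegral (K := Fin (2 * m)) (volume : Measure (σ.1.Pairs → T4)) hq hK‖ *
      ∏ i : Fin (2 * m), ‖pullback (X := T4) (q := q) hq (σ.slot_injective i)‖
  refine ⟨max 1 C, fun c => le_of_pow_le_pow_left₀ hm0 (by positivity) ?_⟩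
  calc ‖boxIntegral ξ hq ι c‖ ^ (2 * m)
      = ∑ σ : ExternalPairing (fun _ : Fin (2 * m) => ι), prodIntegral volume hq hK fun i =>
          pullback hq (σ.slot_injective i) (boxFun q ι c) := by
        rw [norm_pow_eq_prodIntegral hq hm, prodIntegral_boxIntegral]
    _ ≤ C * ‖boxFun q ι c‖ ^ (2 * m) := by
        rw [Finset.sum_mul]
        refine Finset.sum_le_sum fun σ _ => (Real.le_norm_self _).trans ?_
        simpa using norm_continuousMultilinearMap_comp_le _
          (fun i => pullback hq (σ.slot_injective i)) _
    _ ≤ max 1 C ^ (2 * m) * ‖boxFun q ι c‖ ^ (2 * m) := by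
        gcongr
        exact (le_max_right 1 C).trans (le_self_pow₀ (le_max_left 1 C) hm0)
    _ = (max 1 C * ‖boxFun q ι c‖) ^ (2 * m) := (mul_pow _ _ _).symm

/-- The multiple Wiener-Itô integral as a map from `L^q` to `L^q`. -/
def wienerIntegralLq (hq : q ≠ ⊤) (ι : Type) [Fintype ι] :
    Lp ℝ q (volume : Measure (ι → T4)) →L[ℝ] Lp ℝ q P :=
  (boxIntegral ξ hq ι).extendOfNorm (boxFun q ι)

theorem wienerIntegralLq_boxFun {m : ℕ} (hq : q ≠ ⊤) (hm : q = (2 * m : ℕ)) {ι : Type} [Fintype ι]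
    (c : DisjointFamily ι →₀ ℝ) :
    wienerIntegralLq ξ hq ι (boxFun q ι c) = boxIntegral ξ hq ι c :=
  LinearMap.extendOfNorm_eq (denseRange_boxFun hq ι) (exists_norm_boxIntegral_le ξ hq hm ι) c

theorem lpInclusion_boxIntegral {p : ENNReal} [Fact (1 ≤ p)] (hp : p ≠ ⊤) (hq : q ≠ ⊤)
    (hpq : p ≤ q) {ι : Type} [Fintype ι] (c : DisjointFamily ι →₀ ℝ) :
    lpInclusion P hpq (boxIntegral ξ hq ι c) = boxIntegral ξ hp ι c := by
  have hlin : (lpInclusion P hpq).toLinearMap ∘ₗ boxIntegral ξ hq ι = boxIntegral ξ hp ι := by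
    refine Finsupp.lhom_ext' fun A => LinearMap.ext_ring ?_
    simp only [boxIntegral, LinearMap.comp_apply, Finsupp.lsingle_apply,
      Finsupp.linearCombination_single, one_smul]
    rfl
  exact LinearMap.congr_fun hlin c

theorem lpInclusion_wienerIntegralLq {m : ℕ} (hq : q ≠ ⊤) (hm : q = (2 * m : ℕ)) (h2 : 2 ≤ q)
    {ι : Type} [Fintype ι] (f : Lp ℝ q (volume : Measure (ι → T4))) :
    lpInclusion P h2 (wienerIntegralLq ξ hq ι f) =
      wienerIntegralLp ι ξ (lpInclusion volume h2 f) := by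
  refine congrFun (DenseRange.equalizer (denseRange_boxFun hq ι)
    (g := fun f => lpInclusion P h2 (wienerIntegralLq ξ hq ι f))
    (h := fun f => wienerIntegralLp ι ξ (lpInclusion volume h2 f)) (by fun_prop) (by fun_prop)
    (funext fun c => ?_)) f
  simp only [Function.comp_apply]
  rw [wienerIntegralLq_boxFun ξ hq hm, lpInclusion_boxIntegral ξ ENNReal.ofNat_ne_top,
    lpInclusion_boxFun]
  exact (wienerIntegralLq_boxFun ξ (m := 1) ENNReal.ofNat_ne_top (by simp) c).symm

theorem wienerIntegral_eq_wienerIntegralLq {m : ℕ} (hq : q ≠ ⊤) (hm : q = (2 * m : ℕ))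
    (h2 : 2 ≤ q) {ι : Type} [Fintype ι] {f : (ι → T4) → ℝ} (hf : MemLp f q volume) :
    wienerIntegral ξ f = wienerIntegralLq ξ hq ι (hf.toLp f) := by
  rw [wienerIntegral, dif_pos (hf.mono_exponent h2), ← coeFn_lpInclusion h2,
    lpInclusion_wienerIntegralLq ξ hq hm h2]
  rfl

theorem prodIntegral_wienerIntegralLq {m : ℕ} (hq : q ≠ ⊤) (hm : q = (2 * m : ℕ))
    (hK : (Fintype.card K : ENNReal) ≤ q) (f : ∀ i, Lp ℝ q (volume : Measure (ι i → T4))) :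
    prodIntegral P hq hK (fun i => wienerIntegralLq ξ hq (ι i) (f i)) =
      ∑ σ : ExternalPairing ι, prodIntegral volume hq hK fun i =>
        pullback hq (σ.slot_injective i) (f i) := by
  have hdense : DenseRange fun (c : ∀ i, DisjointFamily (ι i) →₀ ℝ) i => boxFun q (ι i) (c i) :=
    DenseRange.piMap fun i => denseRange_boxFun hq (ι i)
  refine congrFun (hdense.equalizer
    (g := fun f : (∀ i, Lp ℝ q (volume : Measure (ι i → T4))) =>
      prodIntegral P hq hK (fun i => wienerIntegralLq ξ hq (ι i) (f i)))
    (h := fun f => ∑ σ : ExternalPairing ι, prodIntegral volume hq hK fun i =>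
      pullback hq (σ.slot_injective i) (f i)) ?_ ?_ (funext fun c => ?_)) f
  · exact (prodIntegral P hq hK).cont.comp (by fun_prop)
  · exact continuous_finsetSum _ fun σ _ => (prodIntegral volume hq hK).cont.comp (by fun_prop)
  · simp only [Function.comp_apply, wienerIntegralLq_boxFun ξ hq hm, prodIntegral_boxIntegral]

end Lq

theorem integral_prod_wienerIntegral {f : ∀ i, (ι i → T4) → ℝ}
    (hf : ∀ i, MemLp (f i) ⊤ volume) :
    Integrable (fun ω => ∏ i, wienerIntegral ξ (f i) ω) P ∧
      ∫ ω, ∏ i, wienerIntegral ξ (f i) ω ∂P =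
        ∑ σ : ExternalPairing ι, ∫ z : σ.1.Pairs → T4, ∏ i, f i fun j => z (σ.slot i j) := by
  have : IsProbabilityMeasure P := ξ.gaussian.isProbabilityMeasure
  obtain ⟨q, hm⟩ : ∃ q : ENNReal, q = (2 * (Fintype.card K + 1) : ℕ) := ⟨_, rfl⟩
  have hq : q ≠ ⊤ := hm ▸ ENNReal.natCast_ne_top _
  have h2 : 2 ≤ q := by
    rw [hm]
    exact_mod_cast (by lia : 2 ≤ 2 * (Fintype.card K + 1))
  have : Fact (1 ≤ q) := ⟨le_trans (by norm_num) h2⟩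
  have hK : (Fintype.card K : ENNReal) ≤ q := by
    rw [hm]
    exact_mod_cast (by lia : Fintype.card K ≤ 2 * (Fintype.card K + 1))
  have hfq (i : K) : MemLp (f i) q volume := (hf i).mono_exponent le_top
  simp_rw [fun i => wienerIntegral_eq_wienerIntegralLq ξ hq hm h2 (hfq i)]
  refine ⟨integrable_prod_of_memLp hq hK fun i => Lp.memLp _, ?_⟩
  rw [← prodIntegral_apply hq hK, prodIntegral_wienerIntegralLq ξ hq hm hK]
  exact Finset.sum_congr rfl fun σ _ => prodIntegral_eq_integral_prod hq hK fun i =>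
    pullback_ae_eq hq (σ.slot_injective i) (MemLp.coeFn_toLp (hfq i))

end WienerMoments

/-! ### Valuations as integrals over all internal variables -/

section Gluing

variable {X I O W : Type*} {J : I → Type*}

/-- Points at `O` and at each `J i`, as points at `W ≃ O ⊕ Σ i, J i`: for integrals over
variables some of which, those in `O`, are shared by several factors of the integrand. -/
def glueAssign (e : O ⊕ (Σ i, J i) ≃ W) (p : (O → X) × (∀ i, J i → X)) (w : W) : X :=
  Sum.elim p.1 (fun s => p.2 s.1 s.2) (e.symm w)

theorem glueAssign_preimage_univ_pi (e : O ⊕ (Σ i, J i) ≃ W) (s : W → Set X) :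
    glueAssign e ⁻¹' univ.pi s = (univ.pi fun o => s (e (Sum.inl o))) ×ˢ
      (univ.pi fun i => univ.pi fun j => s (e (Sum.inr ⟨i, j⟩))) := by
  ext p
  simp only [mem_preimage, mem_univ_pi, mem_prod, glueAssign]
  rw [← e.forall_congr_right]
  simp [Sum.forall, Sigma.forall]

theorem measurable_glueAssign [MeasurableSpace X] (e : O ⊕ (Σ i, J i) ≃ W) :
    Measurable (glueAssign (X := X) e) := by
  refine measurable_pi_lambda _ fun w => ?_
  unfold glueAssign
  rcases e.symm w with o | s
  · exact (measurable_pi_apply o).comp measurable_fst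
  · exact (measurable_pi_apply s.2).comp ((measurable_pi_apply s.1).comp measurable_snd)

variable [MeasureSpace X] [IsFiniteMeasure (volume : Measure X)]
  [Fintype I] [Fintype O] [Fintype W] [∀ i, Fintype (J i)]

theorem measurePreserving_glueAssign (e : O ⊕ (Σ i, J i) ≃ W) :
    MeasurePreserving (glueAssign (X := X) e) volume volume := by
  refine ⟨measurable_glueAssign e, (Measure.pi_eq fun s hs => ?_).symm⟩
  rw [Measure.map_apply (measurable_glueAssign e) (MeasurableSet.univ_pi hs),
    glueAssign_preimage_univ_pi, Measure.volume_eq_prod, Measure.prod_prod, volume_pi_pi,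
    volume_pi_pi, ← e.prod_comp, Fintype.prod_sum_type, Fintype.prod_sigma]
  simp_rw [volume_pi_pi]

theorem integral_prod_eq_integral_prod_integral (e : O ⊕ (Σ i, J i) ≃ W)
    {F : ∀ i, (O → X) → (J i → X) → ℝ}
    (hF : ∀ i, Measurable fun p : (O → X) × (J i → X) => F i p.1 p.2)
    (hb : ∀ i, ∃ C, ∀ z w, |F i z w| ≤ C) :
    ∫ w : W → X, ∏ i, F i (fun o => w (e (Sum.inl o))) (fun j => w (e (Sum.inr ⟨i, j⟩))) =
      ∫ z : O → X, ∏ i, ∫ w : J i → X, F i z w := by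
  have hglue := measurePreserving_glueAssign (X := X) e
  have hmeas : Measurable fun w : W → X =>
      ∏ i, F i (fun o => w (e (Sum.inl o))) (fun j => w (e (Sum.inr ⟨i, j⟩))) :=
    Finset.measurable_prod _ fun i _ => (hF i).comp (Measurable.prodMk (by fun_prop) (by fun_prop))
  have hint : Integrable fun p : (O → X) × (∀ i, J i → X) => ∏ i, F i p.1 (p.2 i) := by
    choose C hC using hb
    refine Integrable.of_bound (C := ∏ i, C i) ?_ (Filter.Eventually.of_forall fun p => ?_)
    · exact (Finset.measurable_prod _ fun i _ => (hF i).comp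
        (Measurable.prodMk (by fun_prop) (by fun_prop))).aestronglyMeasurable
    · rw [Real.norm_eq_abs, Finset.abs_prod]
      exact Finset.prod_le_prod (fun i _ => abs_nonneg _) fun i _ => hC i _ _
  rw [← hglue.map_eq, integral_map hglue.measurable.aemeasurable hmeas.aestronglyMeasurable]
  simp only [glueAssign, Equiv.symm_apply_apply, Sum.elim_inl, Sum.elim_inr]
  rw [Measure.volume_eq_prod] at hint ⊢
  rw [integral_prod _ hint]
  exact integral_congr_ae (Filter.Eventually.of_forall fun z =>
    integral_fintype_prod_volume_eq_prod fun i => F i z)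

end Gluing

open Classical in
/-- By invariance, the integral over all variables but that at `v₀` does not depend on the latter,
and integrating it out gives a factor `volume univ`. -/
theorem integral_eq_volume_mul_of_add_const {X : Type*} [MeasureSpace X] [AddCommGroup X]
    [MeasurableAdd X] [IsFiniteMeasure (volume : Measure X)]
    [(volume : Measure X).IsAddLeftInvariant] {W : Type*} [Fintype W] (v₀ : W)
    {F : (W → X) → ℝ} (hF : Integrable F) (hF' : ∀ x a, F (fun v => x v + a) = F x) :
    ∫ x, F x = volume.real (univ : Set X) *
      ∫ z : {v // v ≠ v₀} → X, F fun v => if h : v = v₀ then 0 else z ⟨v, h⟩ := by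
  have split := (volume_preserving_piEquivPiSubtypeProd (fun _ : W => X) (· = v₀)).symm
  have hpinned (a : {v // v = v₀} → X) :
      (∫ z : {v // v ≠ v₀} → X, F ((MeasurableEquiv.piEquivPiSubtypeProd (fun _ : W => X)
        (· = v₀)).symm (a, z))) =
      ∫ z : {v // v ≠ v₀} → X, F fun v => if h : v = v₀ then 0 else z ⟨v, h⟩ := by
    have : (volume : Measure ({v // v ≠ v₀} → X)).IsAddLeftInvariant :=
      Measure.pi.isAddLeftInvariant _
    rw [← integral_add_left_eq_self _ (fun _ => a ⟨v₀, rfl⟩)]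
    refine integral_congr_ae (Filter.Eventually.of_forall fun z => ?_)
    refine Eq.trans (congrArg F (funext fun v => ?_)) (hF' _ (a ⟨v₀, rfl⟩))
    by_cases h : v = v₀
    · subst h; simp [MeasurableEquiv.piEquivPiSubtypeProd, Equiv.piEquivPiSubtypeProd]
    · simp [MeasurableEquiv.piEquivPiSubtypeProd, Equiv.piEquivPiSubtypeProd, h, add_comm]
  have hvol : volume.real (univ : Set ({v // v = v₀} → X)) = volume.real (univ : Set X) := by
    rw [Measure.real, Measure.real, volume_pi, Measure.pi_univ]
    simp
  rw [← split.integral_comp', Measure.volume_eq_prod, integral_prod]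
  · simp_rw [hpinned]
    rw [integral_const, smul_eq_mul]
    congr 1
    convert hvol
  · rw [← Measure.volume_eq_prod]
    exact split.integrable_comp_of_integrable hF

/-- The volume of the torus: the valuation of a diagram without leaves pins one vertex, so that it
is the integral over all variables divided by this volume. -/
def torusVolume : ℝ := volume.real (univ : Set T4)

theorem torusVolume_ne_zero : torusVolume ≠ 0 := by
  have : (volume : Measure T4) univ ≠ 0 := by
    rw [volume_pi, Measure.pi_univ]
    simp [AddCircle.measure_univ, Real.pi_pos]
  exact (ENNReal.toReal_pos this (measure_ne_top _ _)).ne'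

namespace FeynmanDiagram

variable {Λ : Type} (Γ : FeynmanDiagram Λ) {G : T4 → ℝ}

theorem assign_of_some {x : Λ → T4} {z : Γ.Internal → T4} {v : Γ.V} {l : Λ}
    (h : Γ.label v = some l) : Γ.assign x z v = x l := by
  unfold assign
  split <;> simp_all

theorem assign_of_none {x : Λ → T4} {z : Γ.Internal → T4} {v : Γ.V}
    (h : Γ.label v = none) : Γ.assign x z v = z ⟨v, h⟩ := by
  unfold assign
  split <;> simp_all

/-- The integral of the kernel over all internal variables, without a vertex being pinned. It is
better behaved than the valuation, of which it is a multiple. -/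
def fullIntegral (G : T4 → ℝ) (x : Λ → T4) : ℝ :=
  ∫ z : Γ.Internal → T4, Γ.kernel G (Γ.assign x z)

theorem measurable_kernel (hG : Measurable G) : Measurable (Γ.kernel G) := by
  unfold kernel
  refine Finset.measurable_prod _ fun e _ => hG.comp ?_
  exact (measurable_pi_apply _).sub (measurable_pi_apply _)

theorem abs_kernel_le {C : ℝ} (hC : ∀ x, |G x| ≤ C) (x : Γ.V → T4) :
    |Γ.kernel G x| ≤ C ^ Fintype.card Γ.E := by
  unfold kernel
  rw [Finset.abs_prod, ← Finset.card_univ, ← Finset.prod_const]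
  exact Finset.prod_le_prod (fun i _ => abs_nonneg _) fun e _ => hC _

theorem exists_abs_kernel_le (hb : ∃ C, ∀ x, |G x| ≤ C) : ∃ C, ∀ x, |Γ.kernel G x| ≤ C :=
  let ⟨_, hC⟩ := hb
  ⟨_, Γ.abs_kernel_le hC⟩

theorem measurable_assign :
    Measurable fun p : (Λ → T4) × (Γ.Internal → T4) => Γ.assign p.1 p.2 := by
  refine measurable_pi_lambda _ fun v => ?_
  rcases h : Γ.label v with _ | l
  · simp_rw [Γ.assign_of_none h]
    fun_prop
  · simp_rw [Γ.assign_of_some h]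
    fun_prop

theorem measurable_fullIntegral (hG : Measurable G) : Measurable (Γ.fullIntegral G) := by
  have h : StronglyMeasurable fun p : (Λ → T4) × (Γ.Internal → T4) =>
      Γ.kernel G (Γ.assign p.1 p.2) :=
    ((Γ.measurable_kernel hG).comp Γ.measurable_assign).stronglyMeasurable
  exact h.integral_prod_right.measurable

theorem exists_abs_fullIntegral_le (hb : ∃ C, ∀ x, |G x| ≤ C) :
    ∃ C, ∀ x, |Γ.fullIntegral G x| ≤ C := by
  obtain ⟨C, hC⟩ := Γ.exists_abs_kernel_le hb
  refine ⟨C * (volume : Measure (Γ.Internal → T4)).real univ, fun x => ?_⟩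
  rw [fullIntegral, ← Real.norm_eq_abs]
  exact norm_integral_le_of_norm_le_const (Filter.Eventually.of_forall fun z => hC _)

theorem integrable_kernel (hG : Measurable G) (hb : ∃ C, ∀ x, |G x| ≤ C) :
    Integrable (Γ.kernel G) :=
  let ⟨_, hC⟩ := Γ.exists_abs_kernel_le hb
  .of_bound (Γ.measurable_kernel hG).aestronglyMeasurable _ (Filter.Eventually.of_forall hC)

theorem kernel_add_const (x : Γ.V → T4) (a : T4) :
    Γ.kernel G (fun v => x v + a) = Γ.kernel G x := by
  simp [kernel]

theorem fullIntegral_of_leafless (h : ∀ v, Γ.label v = none) (x : Λ → T4) :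
    Γ.fullIntegral G x = ∫ y, Γ.kernel G y := by
  have hmp := volume_measurePreserving_piCongrLeft (fun _ : Γ.V => T4) (Equiv.subtypeUnivEquiv h)
  rw [← hmp.integral_comp', fullIntegral]
  congr! 3 with z
  funext v
  rw [Γ.assign_of_none (h v)]
  rfl

theorem connectedValuation_of_leaf {v₀ v : Γ.V} (hv : Γ.label v ≠ none) (x : Λ → T4) :
    Γ.connectedValuation G v₀ x = Γ.fullIntegral G x :=
  if_pos ⟨v, hv⟩

theorem connectedValuation_of_leafless (hG : Measurable G) (hb : ∃ C, ∀ x, |G x| ≤ C)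
    (h : ∀ v, Γ.label v = none) (v₀ : Γ.V) (x : Λ → T4) :
    Γ.connectedValuation G v₀ x = torusVolume⁻¹ * Γ.fullIntegral G x := by
  rw [connectedValuation, if_neg (by simpa using h), Γ.fullIntegral_of_leafless h,
    integral_eq_volume_mul_of_add_const v₀ (Γ.integrable_kernel hG hb) Γ.kernel_add_const,
    ← torusVolume, inv_mul_cancel_left₀ torusVolume_ne_zero]

theorem kernel_assign_eq_prod_component (x : Λ → T4) (z : Γ.Internal → T4) :
    Γ.kernel G (Γ.assign x z) = ∏ c, (Γ.component c).kernel G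
      ((Γ.component c).assign x fun v => z ⟨v.1.1, v.2⟩) := by
  classical
  unfold kernel
  rw [← (Equiv.sigmaFiberEquiv fun e : Γ.E => (Quot.mk Γ.Adj (Γ.src e))).prod_comp,
    Fintype.prod_sigma]
  refine Finset.prod_congr rfl fun c _ => ?_
  have assign_component (v : (Γ.component c).V) : (Γ.component c).assign x
      (fun v => z ⟨v.1.1, v.2⟩) v = Γ.assign x z v.1 := by
    rcases h : Γ.label v.1 with _ | l
    · rw [Γ.assign_of_none h, (Γ.component c).assign_of_none h]
    · rw [Γ.assign_of_some h, (Γ.component c).assign_of_some h]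
  simp_rw [assign_component]
  rfl

/-- Every internal vertex lies in exactly one component. The summand `Empty` is the absence of
variables shared by several components. -/
def componentInternalEquiv : Empty ⊕ (Σ c, (Γ.component c).Internal) ≃ Γ.Internal where
  toFun := Sum.elim Empty.elim fun s => ⟨s.2.1.1, s.2.2⟩
  invFun v := Sum.inr ⟨Quot.mk _ v.1, ⟨v.1, rfl⟩, v.2⟩
  left_inv := by
    rintro (h | ⟨c, ⟨v, rfl⟩, hv⟩)
    · exact h.elim
    · rfl
  right_inv _ := rfl

theorem prod_fullIntegral_component (hG : Measurable G) (hb : ∃ C, ∀ x, |G x| ≤ C)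
    (x : Λ → T4) : ∏ c, (Γ.component c).fullIntegral G x = Γ.fullIntegral G x := by
  have hvol : (volume : Measure (Empty → T4)).real univ = 1 := by
    rw [Measure.real, volume_pi, Measure.pi_univ]
    simp
  symm
  calc Γ.fullIntegral G x = ∫ z : Γ.Internal → T4, ∏ c, (Γ.component c).kernel G
        ((Γ.component c).assign x fun v => z ⟨v.1.1, v.2⟩) :=
      integral_congr_ae (Filter.Eventually.of_forall (Γ.kernel_assign_eq_prod_component x))
    _ = ∫ _ : Empty → T4, ∏ c, (Γ.component c).fullIntegral G x :=
      integral_prod_eq_integral_prod_integral Γ.componentInternalEquiv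
        (F := fun c _ w => (Γ.component c).kernel G ((Γ.component c).assign x w))
        (fun c => ((Γ.component c).measurable_kernel hG).comp
          ((Γ.component c).measurable_assign.comp (measurable_const.prodMk measurable_snd)))
        (fun c => let ⟨C, hC⟩ := (Γ.component c).exists_abs_kernel_le hb
          ⟨C, fun _ _ => hC _⟩)
    _ = ∏ c, (Γ.component c).fullIntegral G x := by rw [integral_const, hvol, one_smul]

theorem exists_valuation_eq (hG : Measurable G) (hb : ∃ C, ∀ x, |G x| ≤ C) :
    ∃ a : ℝ, ∀ x, Γ.valuation G x = a * Γ.fullIntegral G x := by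
  classical
  refine ⟨∏ c, if ∃ v, (Γ.component c).label v ≠ none then 1 else torusVolume⁻¹, fun x => ?_⟩
  rw [← Γ.prod_fullIntegral_component hG hb, ← Finset.prod_mul_distrib]
  refine Finset.prod_congr rfl fun c _ => ?_
  split_ifs with h
  · obtain ⟨v, hv⟩ := h
    exact ((Γ.component c).connectedValuation_of_leaf hv x).trans (one_mul _).symm
  · exact (Γ.component c).connectedValuation_of_leafless hG hb (by simpa using h) _ x

theorem measurable_valuation (hG : Measurable G) (hb : ∃ C, ∀ x, |G x| ≤ C) :
    Measurable (Γ.valuation G) := by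
  obtain ⟨a, ha⟩ := Γ.exists_valuation_eq hG hb
  rw [show Γ.valuation G = fun x => a * Γ.fullIntegral G x from funext ha]
  exact (Γ.measurable_fullIntegral hG).const_mul a

theorem exists_abs_valuation_le (hG : Measurable G) (hb : ∃ C, ∀ x, |G x| ≤ C) :
    ∃ C, ∀ x, |Γ.valuation G x| ≤ C := by
  obtain ⟨a, ha⟩ := Γ.exists_valuation_eq hG hb
  obtain ⟨C, hC⟩ := Γ.exists_abs_fullIntegral_le hb
  refine ⟨|a| * C, fun x => ?_⟩
  rw [ha, abs_mul]
  exact mul_le_mul_of_nonneg_left (hC x) (abs_nonneg a)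

/-- Every vertex is connected to a leaf: the condition under which no variable is pinned in the
valuation. It holds for the paired trees and is preserved by contractions. -/
def LeafConnected : Prop := ∀ v, ∃ l, Relation.EqvGen Γ.Adj v l ∧ Γ.label l ≠ none

variable {Γ}

theorem LeafConnected.valuation_eq (h : Γ.LeafConnected) (hG : Measurable G)
    (hb : ∃ C, ∀ x, |G x| ≤ C) (x : Λ → T4) : Γ.valuation G x = Γ.fullIntegral G x := by
  rw [← Γ.prod_fullIntegral_component hG hb]
  refine Finset.prod_congr rfl fun c _ => ?_
  induction c using Quot.ind with | mk v =>
  obtain ⟨l, hvl, hl⟩ := h v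
  exact (Γ.component _).connectedValuation_of_leaf
    (v := ⟨l, (Quot.eqvGen_sound hvl).symm⟩) hl x

theorem Connected.valuation_eq (h : Γ.Connected) (hlabel : ∀ v, Γ.label v = none)
    (hG : Measurable G) (hb : ∃ C, ∀ x, |G x| ≤ C) (x : Λ → T4) :
    Γ.valuation G x = torusVolume⁻¹ * Γ.fullIntegral G x := by
  obtain ⟨v⟩ := h.1
  let component_unique : Unique Γ.Component :=
    { default := Quot.mk _ v
      uniq := by
        rintro ⟨w⟩
        exact Quot.eqvGen_sound (h.2 w v) }
  rw [← Γ.prod_fullIntegral_component hG hb, valuation, Fintype.prod_subsingleton _ default,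
    Fintype.prod_subsingleton _ default]
  exact (Γ.component _).connectedValuation_of_leafless hG hb (fun v => hlabel v.1) _ x

theorem eqvGen_contract (S : Set Γ.Subdiagram) {v w : Γ.V} (h : Relation.EqvGen Γ.Adj v w) :
    Relation.EqvGen (Γ.contract S).Adj (Quot.mk _ v) (Quot.mk _ w) := by
  induction h with
  | rel v w h =>
    obtain ⟨e, rfl, rfl⟩ := h
    by_cases he : ∃ γ ∈ S, e ∈ γ.edges
    · obtain ⟨γ, hγ, heγ⟩ := he
      have : (Quot.mk _ (Γ.src e) : (Γ.contract S).V) = Quot.mk _ (Γ.tgt e) :=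
        Quot.sound ⟨γ, hγ, γ.src_mem e heγ, γ.tgt_mem e heγ⟩
      rw [this]
      exact Relation.EqvGen.refl _
    · push Not at he
      exact Relation.EqvGen.rel _ _ ⟨⟨e, he⟩, rfl, rfl⟩
  | refl v => exact Relation.EqvGen.refl _
  | symm v w _ ih => exact ih.symm
  | trans u v w _ _ ih₁ ih₂ => exact ih₁.trans _ _ _ ih₂

theorem Connected.contract (h : Γ.Connected) (S : Set Γ.Subdiagram) :
    (Γ.contract S).Connected := by
  refine ⟨h.1.map (Quot.mk _), ?_⟩
  rintro ⟨v⟩ ⟨w⟩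
  exact eqvGen_contract S (h.2 v w)

theorem LeafConnected.contract (h : Γ.LeafConnected) (S : Set Γ.Subdiagram) :
    (Γ.contract S).LeafConnected := by
  rintro ⟨v⟩
  obtain ⟨l, hvl, hl⟩ := h v
  exact ⟨Quot.mk _ l, eqvGen_contract S hvl, hl⟩

variable (Γ)

/-- The contribution of the forest `F` to the renormalised valuation. -/
def forestTerm (G : T4 → ℝ) (F : Finset Γ.Subdiagram) (x : Λ → T4) : ℝ :=
  (-1) ^ F.card * ((∏ γ ∈ F, (γ.toDiagram.contract (γ.restrict '' children F γ)).valuation G x) *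
    (Γ.contract (roots F)).valuation G x)

open Classical in
theorem renormalisedValuation_eq_sum (x : Λ → T4) :
    Γ.renormalisedValuation G x =
      ∑ F : Finset Γ.Subdiagram with IsForest F, Γ.forestTerm G F x := by
  simp only [renormalisedValuation, renormalise, extract, forestTerm, map_sum, map_mul, map_prod,
    map_pow, map_neg, map_one, MvPolynomial.eval_X]

theorem measurable_forestTerm (hG : Measurable G) (hb : ∃ C, ∀ x, |G x| ≤ C)
    (F : Finset Γ.Subdiagram) : Measurable (Γ.forestTerm G F) :=
  ((Finset.measurable_prod _ fun _ _ => measurable_valuation _ hG hb).mul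
    (measurable_valuation _ hG hb)).const_mul _

theorem exists_abs_forestTerm_le (hG : Measurable G) (hb : ∃ C, ∀ x, |G x| ≤ C)
    (F : Finset Γ.Subdiagram) : ∃ C, ∀ x, |Γ.forestTerm G F x| ≤ C := by
  choose C hC using fun Γ : FeynmanDiagram Λ => exists_abs_valuation_le Γ hG hb
  refine ⟨(∏ γ ∈ F, C (γ.toDiagram.contract (γ.restrict '' children F γ))) *
    C (Γ.contract (roots F)), fun x => ?_⟩
  rw [forestTerm, abs_mul, abs_pow, abs_neg, abs_one, one_pow, one_mul, abs_mul, Finset.abs_prod]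
  exact mul_le_mul (Finset.prod_le_prod (fun _ _ => abs_nonneg _) fun γ _ => hC _ x) (hC _ x)
    (abs_nonneg _) (Finset.prod_nonneg fun γ _ => (abs_nonneg _).trans (hC _ x))

theorem measurable_renormalisedValuation (hG : Measurable G) (hb : ∃ C, ∀ x, |G x| ≤ C) :
    Measurable (Γ.renormalisedValuation G) := by
  rw [funext Γ.renormalisedValuation_eq_sum]
  exact Finset.measurable_sum _ fun F _ => Γ.measurable_forestTerm hG hb F

theorem exists_abs_renormalisedValuation_le (hG : Measurable G) (hb : ∃ C, ∀ x, |G x| ≤ C) :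
    ∃ C, ∀ x, |Γ.renormalisedValuation G x| ≤ C := by
  classical
  choose C hC using Γ.exists_abs_forestTerm_le hG hb
  refine ⟨∑ F : Finset Γ.Subdiagram with IsForest F, C F, fun x => ?_⟩
  rw [renormalisedValuation_eq_sum]
  exact (Finset.abs_sum_le_sum_abs _ _).trans (Finset.sum_le_sum fun F _ => hC F x)

end FeynmanDiagram

namespace FeynmanDiagram

variable {Λ Λ' : Type} {Γ : FeynmanDiagram Λ} {Γ' : FeynmanDiagram Λ'}

/-- Isomorphisms of the underlying directed multigraphs. Labels are disregarded: such isomorphisms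
serve to compare diagrams without leaves over different sets of labels. -/
structure GraphIso (Γ : FeynmanDiagram Λ) (Γ' : FeynmanDiagram Λ') where
  vertEquiv : Γ.V ≃ Γ'.V
  edgeEquiv : Γ.E ≃ Γ'.E
  src_edgeEquiv : ∀ e, Γ'.src (edgeEquiv e) = vertEquiv (Γ.src e)
  tgt_edgeEquiv : ∀ e, Γ'.tgt (edgeEquiv e) = vertEquiv (Γ.tgt e)

namespace GraphIso

/-- The inverse isomorphism. -/
def symm (f : GraphIso Γ Γ') : GraphIso Γ' Γ where
  vertEquiv := f.vertEquiv.symm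
  edgeEquiv := f.edgeEquiv.symm
  src_edgeEquiv e := by rw [Equiv.eq_symm_apply, ← f.src_edgeEquiv, Equiv.apply_symm_apply]
  tgt_edgeEquiv e := by rw [Equiv.eq_symm_apply, ← f.tgt_edgeEquiv, Equiv.apply_symm_apply]

theorem eqvGen (f : GraphIso Γ Γ') {v w : Γ.V} (h : Relation.EqvGen Γ.Adj v w) :
    Relation.EqvGen Γ'.Adj (f.vertEquiv v) (f.vertEquiv w) := by
  induction h with
  | rel v w h =>
    obtain ⟨e, rfl, rfl⟩ := h
    exact .rel _ _ ⟨f.edgeEquiv e, f.src_edgeEquiv e, f.tgt_edgeEquiv e⟩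
  | refl v => exact .refl _
  | symm v w _ ih => exact ih.symm
  | trans u v w _ _ ih₁ ih₂ => exact ih₁.trans _ _ _ ih₂

theorem connected (f : GraphIso Γ Γ') (h : Γ.Connected) : Γ'.Connected := by
  refine ⟨h.1.map f.vertEquiv, fun v w => ?_⟩
  simpa using f.eqvGen (h.2 (f.vertEquiv.symm v) (f.vertEquiv.symm w))

theorem connected_iff (f : GraphIso Γ Γ') : Γ.Connected ↔ Γ'.Connected :=
  ⟨f.connected, f.symm.connected⟩

theorem fullIntegral_eq (f : GraphIso Γ Γ') {G : T4 → ℝ} (h : ∀ v, Γ.label v = none)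
    (h' : ∀ v, Γ'.label v = none) (x : Λ → T4) (x' : Λ' → T4) :
    Γ.fullIntegral G x = Γ'.fullIntegral G x' := by
  have hmp := (volume_measurePreserving_piCongrLeft (fun _ : Γ'.V => T4) f.vertEquiv).symm
  rw [Γ.fullIntegral_of_leafless h, Γ'.fullIntegral_of_leafless h', ← hmp.integral_comp']
  refine integral_congr_ae (Filter.Eventually.of_forall fun y => ?_)
  simp only [kernel]
  rw [← f.edgeEquiv.prod_comp]
  simp only [f.src_edgeEquiv, f.tgt_edgeEquiv]
  rfl

end GraphIso

theorem Subdiagram.Divergent.nonempty {γ : Γ.Subdiagram} (h : γ.Divergent) : γ.verts.Nonempty :=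
  let ⟨v⟩ := h.1.1
  ⟨v.1, v.2⟩

/-! ### Gluing diagrams along leaves -/

/-- The diagram `Γ` is obtained from the diagrams `Δ i` by turning their leaves with labels in
`U i` into internal vertices, indexed by `O`, and by identifying those leaves that have the same
image in `O` under `slot`. The leaves of `Δ i` with labels in `Λ'` remain leaves, the labels being
changed by `lab i`. The partial inverse `retract` of `node` and `vert` expresses that no further
vertices are identified; its values on the leaves of `Γ` are arbitrary. -/
structure Gluing {Λ Λ' K O : Type} {U : K → Type} (Γ : FeynmanDiagram Λ)
    (Δ : ∀ i, FeynmanDiagram (Λ' ⊕ U i)) (lab : K → Λ' → Λ) (slot : ∀ i, U i → O) where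
  vert : ∀ i, (Δ i).V → Γ.V
  edge : (Σ i, (Δ i).E) ≃ Γ.E
  node : O → Γ.V
  retract : Γ.V → Option (O ⊕ Σ i, (Δ i).V)
  src_edge : ∀ i e, Γ.src (edge ⟨i, e⟩) = vert i ((Δ i).src e)
  tgt_edge : ∀ i e, Γ.tgt (edge ⟨i, e⟩) = vert i ((Δ i).tgt e)
  vert_slot : ∀ i v u, (Δ i).label v = some (Sum.inr u) → vert i v = node (slot i u)
  label_leaf : ∀ i v l, (Δ i).label v = some (Sum.inl l) → Γ.label (vert i v) = some (lab i l)
  label_internal : ∀ i v, (Δ i).label v = none → Γ.label (vert i v) = none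
  label_node : ∀ o, Γ.label (node o) = none
  retract_node : ∀ o, retract (node o) = some (Sum.inl o)
  retract_vert : ∀ i v, (Δ i).label v = none → retract (vert i v) = some (Sum.inr ⟨i, v⟩)
  exists_of_internal : ∀ v, Γ.label v = none →
    (∃ o, v = node o) ∨ ∃ i w, (Δ i).label w = none ∧ v = vert i w

/-- The points at the leaves of the `i`-th piece of a glued diagram, given the points `x` at the
leaves and `z` at the glued vertices. -/
def piecePoints {Λ Λ' K O : Type} {U : K → Type} (lab : K → Λ' → Λ) (slot : ∀ i, U i → O)
    (x : Λ → T4) (z : O → T4) (i : K) : Λ' ⊕ U i → T4 :=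
  Sum.elim (fun l => x (lab i l)) fun u => z (slot i u)

theorem measurable_piecePoints {K O : Type} {U : K → Type} {lab : K → Λ' → Λ}
    {slot : ∀ i, U i → O} (x : Λ → T4) (i : K) :
    Measurable fun z : O → T4 => piecePoints lab slot x z i := by
  refine measurable_pi_lambda _ fun l => ?_
  rcases l with l | u
  · exact measurable_const
  · exact measurable_pi_apply _

namespace Gluing

variable {K O : Type} {U : K → Type} {Δ : ∀ i, FeynmanDiagram (Λ' ⊕ U i)} {lab : K → Λ' → Λ}
  {slot : ∀ i, U i → O} (g : Gluing Γ Δ lab slot)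

theorem vert_ne_node {i : K} {v : (Δ i).V} (hv : (Δ i).label v = none) (o : O) :
    g.vert i v ≠ g.node o := fun h => by
  simpa [h, g.retract_node] using g.retract_vert i v hv

theorem node_injective : Function.Injective g.node := fun o o' h => by
  simpa [h, g.retract_node] using (g.retract_node o).symm

theorem sigma_eq_of_vert_eq {i j : K} {v : (Δ i).V} {w : (Δ j).V}
    (hv : (Δ i).label v = none) (h : g.vert i v = g.vert j w) :
    (⟨i, v⟩ : Σ i, (Δ i).V) = ⟨j, w⟩ := by
  rcases hw : (Δ j).label w with _ | l | u
  · simpa [← h, g.retract_vert i v hv] using g.retract_vert j w hw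
  · simpa [← h, g.label_internal i v hv] using g.label_leaf j w l hw
  · exact absurd (h.trans (g.vert_slot j w u hw)) (g.vert_ne_node hv _)

theorem eq_of_vert_eq {i : K} {v w : (Δ i).V} (hv : (Δ i).label v = none)
    (h : g.vert i v = g.vert i w) : v = w := by
  simpa using g.sigma_eq_of_vert_eq hv h

theorem edge_injective (i : K) : Function.Injective fun e => g.edge ⟨i, e⟩ := fun e e' h => by
  simpa using g.edge.injective h

theorem internal_bijective : Function.Bijective
    (Sum.elim (fun o => (⟨g.node o, g.label_node o⟩ : Γ.Internal))
      fun s : (Σ i, (Δ i).Internal) => ⟨g.vert s.1 s.2.1, g.label_internal _ _ s.2.2⟩) := by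
  constructor
  · rintro (o | ⟨i, v, hv⟩) (o' | ⟨j, w, hw⟩) h
    · exact congrArg Sum.inl (g.node_injective (congrArg Subtype.val h))
    · exact absurd (congrArg Subtype.val h).symm (g.vert_ne_node hw o)
    · exact absurd (congrArg Subtype.val h) (g.vert_ne_node hv o')
    · cases g.sigma_eq_of_vert_eq hv (congrArg Subtype.val h)
      rfl
  · rintro ⟨v, hv⟩
    rcases g.exists_of_internal v hv with ⟨o, rfl⟩ | ⟨i, w, hw, rfl⟩
    · exact ⟨Sum.inl o, rfl⟩
    · exact ⟨Sum.inr ⟨i, w, hw⟩, rfl⟩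

/-- The internal vertices of a glued diagram are the glued vertices and the internal vertices of
the pieces. -/
def internalEquiv : O ⊕ (Σ i, (Δ i).Internal) ≃ Γ.Internal :=
  Equiv.ofBijective _ g.internal_bijective

theorem assign_vert (x : Λ → T4) (z : Γ.Internal → T4) (i : K) (v : (Δ i).V) :
    Γ.assign x z (g.vert i v) =
      (Δ i).assign (piecePoints lab slot x (fun o => z (g.internalEquiv (Sum.inl o))) i)
        (fun w => z (g.internalEquiv (Sum.inr ⟨i, w⟩))) v := by
  rcases h : (Δ i).label v with _ | l | u
  · rw [(Δ i).assign_of_none h, Γ.assign_of_none (g.label_internal i v h)]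
    rfl
  · rw [(Δ i).assign_of_some h, Γ.assign_of_some (g.label_leaf i v l h)]
    rfl
  · rw [(Δ i).assign_of_some h, g.vert_slot i v u h, Γ.assign_of_none (g.label_node _)]
    rfl

theorem kernel_eq_prod [Fintype K] (G : T4 → ℝ) (y : Γ.V → T4) :
    Γ.kernel G y = ∏ i, (Δ i).kernel G fun v => y (g.vert i v) := by
  simp only [kernel, ← g.edge.prod_comp, Fintype.prod_sigma, g.src_edge, g.tgt_edge]

theorem fullIntegral_eq (g : Gluing Γ Δ lab slot) [Fintype K] [Fintype O]
    {G : T4 → ℝ} (hG : Measurable G) (hb : ∃ C, ∀ x, |G x| ≤ C) (x : Λ → T4) :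
    Γ.fullIntegral G x =
      ∫ z : O → T4, ∏ i, (Δ i).fullIntegral G (piecePoints lab slot x z i) := by
  unfold fullIntegral
  simp_rw [g.kernel_eq_prod, g.assign_vert]
  refine integral_prod_eq_integral_prod_integral g.internalEquiv
    (F := fun i z w => (Δ i).kernel G ((Δ i).assign (piecePoints lab slot x z i) w))
    (fun i => ?_) fun i => ?_
  · exact ((Δ i).measurable_kernel hG).comp ((Δ i).measurable_assign.comp
      (((measurable_piecePoints x i).comp measurable_fst).prodMk measurable_snd))
  · obtain ⟨C, hC⟩ := (Δ i).exists_abs_kernel_le hb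
    exact ⟨C, fun _ _ => hC _⟩

/-- The image of a subdiagram of `Δ i` in `Γ`. -/
def push (i : K) (δ : (Δ i).Subdiagram) : Γ.Subdiagram where
  verts := g.vert i '' δ.verts
  edges := (fun e => g.edge ⟨i, e⟩) '' δ.edges
  internal := by
    rintro _ ⟨v, hv, rfl⟩
    exact g.label_internal i v (δ.internal v hv)
  src_mem := by
    rintro _ ⟨e, he, rfl⟩
    exact ⟨_, δ.src_mem e he, (g.src_edge i e).symm⟩
  tgt_mem := by
    rintro _ ⟨e, he, rfl⟩
    exact ⟨_, δ.tgt_mem e he, (g.tgt_edge i e).symm⟩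

section Push

variable {i j : K} {δ : (Δ i).Subdiagram} {δ' : (Δ j).Subdiagram}

theorem vert_mem_push_iff {v : (Δ i).V} (hv : (Δ i).label v = none) :
    g.vert i v ∈ (g.push i δ).verts ↔ v ∈ δ.verts := by
  constructor
  · rintro ⟨w, hw, h⟩
    rwa [g.eq_of_vert_eq hv h.symm]
  · exact fun h => ⟨v, h, rfl⟩

theorem edge_mem_push_iff {e : (Δ i).E} : g.edge ⟨i, e⟩ ∈ (g.push i δ).edges ↔ e ∈ δ.edges :=
  (g.edge_injective i).mem_set_image

theorem index_eq_of_edge_mem_push {e : (Δ i).E} (h : g.edge ⟨i, e⟩ ∈ (g.push j δ').edges) :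
    i = j := by
  obtain ⟨e', -, h⟩ := h
  exact (congrArg Sigma.fst (g.edge.injective h)).symm

theorem index_eq_of_not_disjoint (h : ¬ Disjoint (g.push i δ).verts (g.push j δ').verts) :
    i = j := by
  rw [Set.not_disjoint_iff] at h
  obtain ⟨_, ⟨v, hv, rfl⟩, ⟨w, -, h⟩⟩ := h
  exact congrArg Sigma.fst (g.sigma_eq_of_vert_eq (δ.internal v hv) h.symm)

theorem index_eq_of_push_le (hδ : δ.verts.Nonempty) (h : g.push i δ ≤ g.push j δ') : i = j := by
  refine g.index_eq_of_not_disjoint (δ := δ) (δ' := δ') ?_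
  obtain ⟨v, hv⟩ := hδ
  exact Set.not_disjoint_iff.2 ⟨_, ⟨v, hv, rfl⟩, h.1 ⟨v, hv, rfl⟩⟩

theorem push_le_push_iff {δ' : (Δ i).Subdiagram} : g.push i δ ≤ g.push i δ' ↔ δ ≤ δ' := by
  constructor
  · rintro ⟨hverts, hedges⟩
    exact ⟨fun v hv => (g.vert_mem_push_iff (δ.internal v hv)).1 (hverts ⟨v, hv, rfl⟩),
      fun e he => g.edge_mem_push_iff.1 (hedges ⟨e, he, rfl⟩)⟩
  · rintro ⟨hverts, hedges⟩
    exact ⟨image_mono hverts, image_mono hedges⟩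

theorem push_lt_push_iff {δ' : (Δ i).Subdiagram} : g.push i δ < g.push i δ' ↔ δ < δ' := by
  simp only [lt_iff_le_not_ge, g.push_le_push_iff]

theorem sigma_eq_of_push_eq (hδ : δ.verts.Nonempty) (h : g.push i δ = g.push j δ') :
    (⟨i, δ⟩ : Σ i, (Δ i).Subdiagram) = ⟨j, δ'⟩ := by
  obtain rfl := g.index_eq_of_push_le hδ h.le
  rw [le_antisymm (g.push_le_push_iff.1 h.le) (g.push_le_push_iff.1 h.ge)]

theorem disjoint_push_iff {δ' : (Δ i).Subdiagram} :
    Disjoint (g.push i δ).verts (g.push i δ').verts ↔ Disjoint δ.verts δ'.verts := by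
  simp only [Set.disjoint_left]
  constructor
  · exact fun h v hv hv' => h ⟨v, hv, rfl⟩ ⟨v, hv', rfl⟩
  · rintro h _ ⟨v, hv, rfl⟩ hv'
    exact h hv ((g.vert_mem_push_iff (δ.internal v hv)).1 hv')

end Push

theorem injOn_vert {i : K} (δ : (Δ i).Subdiagram) : InjOn (g.vert i) δ.verts :=
  fun _ hv _ _ h => g.eq_of_vert_eq (δ.internal _ hv) h

/-- A subdiagram of a piece and its image, as diagrams. -/
def pushIso {i : K} (δ : (Δ i).Subdiagram) : GraphIso δ.toDiagram (g.push i δ).toDiagram where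
  vertEquiv := Equiv.Set.imageOfInjOn (g.vert i) δ.verts (g.injOn_vert δ)
  edgeEquiv := Equiv.Set.imageOfInjOn (fun e => g.edge ⟨i, e⟩) δ.edges (g.edge_injective i).injOn
  src_edgeEquiv e := Subtype.ext (g.src_edge i e.1)
  tgt_edgeEquiv e := Subtype.ext (g.tgt_edge i e.1)

theorem push_full_iff {i : K} {δ : (Δ i).Subdiagram} : (g.push i δ).Full ↔ δ.Full := by
  constructor
  · intro h e he e' hsrc htgt
    refine g.edge_mem_push_iff.1 (h (g.edge ⟨i, e⟩) ⟨e, he, rfl⟩ _ ?_ ?_)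
    · rw [g.src_edge, g.src_edge, hsrc]
    · rw [g.tgt_edge, g.tgt_edge, htgt]
  · rintro h _ ⟨e, he, rfl⟩ e'' hsrc htgt
    obtain ⟨⟨j, e'⟩, rfl⟩ := g.edge.surjective e''
    simp only [g.src_edge, g.tgt_edge] at hsrc htgt
    obtain rfl : i = j :=
      congrArg Sigma.fst (g.sigma_eq_of_vert_eq (δ.internal _ (δ.src_mem e he)) hsrc.symm)
    exact g.edge_mem_push_iff.2 (h e he e'
      (g.eq_of_vert_eq (δ.internal _ (δ.src_mem e he)) hsrc.symm).symm
      (g.eq_of_vert_eq (δ.internal _ (δ.tgt_mem e he)) htgt.symm).symm)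

theorem deg_push {i : K} (δ : (Δ i).Subdiagram) : (g.push i δ).deg = δ.deg := by
  have hverts : (g.push i δ).verts.ncard = δ.verts.ncard := (g.injOn_vert δ).ncard_image
  have hedges : (g.push i δ).edges.ncard = δ.edges.ncard :=
    ncard_image_of_injective _ (g.edge_injective i)
  rw [Subdiagram.deg, Subdiagram.deg, hverts, hedges]

theorem push_divergent_iff {i : K} {δ : (Δ i).Subdiagram} :
    (g.push i δ).Divergent ↔ δ.Divergent := by
  rw [Subdiagram.Divergent, Subdiagram.Divergent, (g.pushIso δ).connected_iff, g.push_full_iff,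
    g.deg_push]

theorem label_eq_none_of_vert_mem {γ : Γ.Subdiagram} (hnode : ∀ o, g.node o ∉ γ.verts) {i : K}
    {v : (Δ i).V} (hv : g.vert i v ∈ γ.verts) : (Δ i).label v = none := by
  rcases h : (Δ i).label v with _ | l | u
  · rfl
  · simpa [g.label_leaf i v l h] using γ.internal _ hv
  · exact absurd (g.vert_slot i v u h ▸ hv) (hnode _)

/-- The preimage in the `i`-th piece of a subdiagram without glued vertices. -/
def pull (γ : Γ.Subdiagram) (hnode : ∀ o, g.node o ∉ γ.verts) (i : K) : (Δ i).Subdiagram where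
  verts := {v | g.vert i v ∈ γ.verts}
  edges := {e | g.edge ⟨i, e⟩ ∈ γ.edges}
  internal _ := g.label_eq_none_of_vert_mem hnode
  src_mem e he := by simpa only [mem_ofPred_eq, g.src_edge] using γ.src_mem _ he
  tgt_mem e he := by simpa only [mem_ofPred_eq, g.tgt_edge] using γ.tgt_mem _ he

theorem push_pull {γ : Γ.Subdiagram} (hnode : ∀ o, g.node o ∉ γ.verts) {i : K}
    (hpiece : ∀ j v, g.vert j v ∈ γ.verts → j = i) : g.push i (g.pull γ hnode i) = γ := by
  refine Subdiagram.ext (Subset.antisymm ?_ fun v hv => ?_) (Subset.antisymm ?_ fun e he => ?_)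
  · rintro _ ⟨v, hv, rfl⟩
    exact hv
  · rcases g.exists_of_internal v (γ.internal v hv) with ⟨o, rfl⟩ | ⟨j, w, -, rfl⟩
    · exact absurd hv (hnode o)
    · obtain rfl := hpiece j w hv
      exact ⟨w, hv, rfl⟩
  · rintro _ ⟨e, he, rfl⟩
    exact he
  · obtain ⟨⟨j, e⟩, rfl⟩ := g.edge.surjective e
    obtain rfl := hpiece j _ (g.src_edge j e ▸ γ.src_mem _ he)
    exact ⟨e, he, rfl⟩

/-! ### Contractions in a glued diagram -/

/-- The images in a glued diagram of sets of subdiagrams of the pieces. -/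
def pushSets (S : ∀ i, Set (Δ i).Subdiagram) : Set Γ.Subdiagram :=
  {γ | ∃ i, ∃ δ ∈ S i, g.push i δ = γ}

variable (S : ∀ i, Set (Δ i).Subdiagram)

theorem edge_mem_contract_iff (i : K) (e : (Δ i).E) :
    (∀ γ ∈ g.pushSets S, g.edge ⟨i, e⟩ ∉ γ.edges) ↔ ∀ δ ∈ S i, e ∉ δ.edges := by
  constructor
  · exact fun h δ hδ he => h _ ⟨i, δ, hδ, rfl⟩ (g.edge_mem_push_iff.2 he)
  · rintro h _ ⟨j, δ, hδ, rfl⟩ he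
    obtain rfl := g.index_eq_of_edge_mem_push he
    exact h δ hδ (g.edge_mem_push_iff.1 he)

/-- The edges which survive a contraction in a glued diagram are those that survive in its
pieces. -/
def contractEdge : (Σ i, ((Δ i).contract (S i)).E) ≃ (Γ.contract (g.pushSets S)).E :=
  Equiv.ofBijective
    (fun s => ⟨g.edge ⟨s.1, s.2.1⟩, (g.edge_mem_contract_iff S _ _).2 s.2.2⟩) <| by
      constructor
      · rintro ⟨i, e, he⟩ ⟨j, e', he'⟩ h
        cases g.edge.injective (congrArg Subtype.val h)
        rfl
      · rintro ⟨e, he⟩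
        obtain ⟨⟨i, e⟩, rfl⟩ := g.edge.surjective e
        exact ⟨⟨i, e, (g.edge_mem_contract_iff S _ _).1 he⟩, rfl⟩

/-- The passage to the contracted pieces. -/
def contractMk : O ⊕ (Σ i, (Δ i).V) → O ⊕ Σ i, ((Δ i).contract (S i)).V :=
  Sum.map id fun s => ⟨s.1, Quot.mk _ s.2⟩

/-- The retraction of a glued diagram on its pieces descends to contractions, since the subdiagrams
which are contracted lie within the pieces. -/
def contractRetract :
    (Γ.contract (g.pushSets S)).V → Option (O ⊕ Σ i, ((Δ i).contract (S i)).V) :=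
  Quot.lift (fun v => (g.retract v).map (contractMk S)) <| by
    rintro _ _ ⟨_, ⟨i, δ, hδ, rfl⟩, ⟨v, hv, rfl⟩, ⟨w, hw, rfl⟩⟩
    rw [g.retract_vert i v (δ.internal v hv), g.retract_vert i w (δ.internal w hw)]
    have hvw : (Quot.mk _ v : ((Δ i).contract (S i)).V) = Quot.mk _ w :=
      Quot.sound ⟨δ, hδ, hv, hw⟩
    exact congrArg (fun q => some (Sum.inr (⟨i, q⟩ : Σ i, ((Δ i).contract (S i)).V))) hvw

theorem contractRetract_mk_of_retract_eq {v : Γ.V} {s : O ⊕ Σ i, (Δ i).V}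
    (h : g.retract v = some s) : g.contractRetract S (Quot.mk _ v) =
      some (contractMk S s) :=
  congrArg (Option.map _) h

/-- Contraction is compatible with gluing. -/
def contract :
    Gluing (Γ.contract (g.pushSets S)) (fun i => (Δ i).contract (S i)) lab slot where
  vert i := Quot.map (g.vert i) <| by
    rintro v w ⟨δ, hδ, hv, hw⟩
    exact ⟨g.push i δ, ⟨i, δ, hδ, rfl⟩, ⟨v, hv, rfl⟩, ⟨w, hw, rfl⟩⟩
  edge := g.contractEdge S
  node o := Quot.mk _ (g.node o)
  retract := g.contractRetract S
  src_edge i e := congrArg (Quot.mk _) (g.src_edge i e.1)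
  tgt_edge i e := congrArg (Quot.mk _) (g.tgt_edge i e.1)
  vert_slot i := by
    rintro ⟨v⟩ u h
    exact congrArg (Quot.mk _) (g.vert_slot i v u h)
  label_leaf i := by
    rintro ⟨v⟩ l h
    exact g.label_leaf i v l h
  label_internal i := by
    rintro ⟨v⟩ h
    exact g.label_internal i v h
  label_node o := g.label_node o
  retract_node o := g.contractRetract_mk_of_retract_eq S (g.retract_node o)
  retract_vert i := by
    rintro ⟨v⟩ h
    exact g.contractRetract_mk_of_retract_eq S (g.retract_vert i v h)
  exists_of_internal := by
    rintro ⟨v⟩ h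
    rcases g.exists_of_internal v h with ⟨o, rfl⟩ | ⟨i, w, hw, rfl⟩
    · exact Or.inl ⟨o, rfl⟩
    · exact Or.inr ⟨i, Quot.mk _ w, hw, rfl⟩

theorem mem_verts_restrict_iff {i : K} (δ : (Δ i).Subdiagram) (C : Set (Δ i).Subdiagram)
    (v w : δ.toDiagram.V) :
    (∃ γ ∈ δ.restrict '' C, v ∈ γ.verts ∧ w ∈ γ.verts) ↔
      ∃ γ ∈ (g.push i δ).restrict '' (g.push i '' C),
        (g.pushIso δ).vertEquiv v ∈ γ.verts ∧ (g.pushIso δ).vertEquiv w ∈ γ.verts := by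
  simp only [exists_mem_image]
  exact exists_congr fun ρ => and_congr_right fun _ => and_congr
    (g.vert_mem_push_iff (δ.internal v.1 v.2)).symm (g.vert_mem_push_iff (δ.internal w.1 w.2)).symm

theorem notMem_edges_restrict_iff {i : K} (δ : (Δ i).Subdiagram) (C : Set (Δ i).Subdiagram)
    (e : δ.toDiagram.E) : (∀ γ ∈ δ.restrict '' C, e ∉ γ.edges) ↔
      ∀ γ ∈ (g.push i δ).restrict '' (g.push i '' C), (g.pushIso δ).edgeEquiv e ∉ γ.edges := by
  simp only [forall_mem_image]
  exact forall₂_congr fun ρ _ => not_congr g.edge_mem_push_iff.symm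

/-- A contraction inside a subdiagram of a piece and the corresponding one inside its image. -/
def pushContractIso {i : K} (δ : (Δ i).Subdiagram) (C : Set (Δ i).Subdiagram) :
    GraphIso (δ.toDiagram.contract (δ.restrict '' C))
      ((g.push i δ).toDiagram.contract ((g.push i δ).restrict '' (g.push i '' C))) where
  vertEquiv := Quot.congr (g.pushIso δ).vertEquiv (g.mem_verts_restrict_iff δ C)
  edgeEquiv := (g.pushIso δ).edgeEquiv.subtypeEquiv (g.notMem_edges_restrict_iff δ C)
  src_edgeEquiv e := congrArg (Quot.mk _) ((g.pushIso δ).src_edgeEquiv e.1)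
  tgt_edgeEquiv e := congrArg (Quot.mk _) ((g.pushIso δ).tgt_edgeEquiv e.1)

theorem valuation_push_contract {i : K} {δ : (Δ i).Subdiagram} {G : T4 → ℝ}
    (hG : Measurable G) (hb : ∃ C, ∀ x, |G x| ≤ C) (hδ : δ.toDiagram.Connected)
    (C : Set (Δ i).Subdiagram) (x : Λ → T4) (x' : Λ' ⊕ U i → T4) :
    ((g.push i δ).toDiagram.contract ((g.push i δ).restrict '' (g.push i '' C))).valuation G x =
      (δ.toDiagram.contract (δ.restrict '' C)).valuation G x' := by
  have leafless {Λ : Type} {Γ : FeynmanDiagram Λ} (γ : Γ.Subdiagram)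
      (S : Set γ.toDiagram.Subdiagram) (v : (γ.toDiagram.contract S).V) :
      (γ.toDiagram.contract S).label v = none := by
    obtain ⟨v⟩ := v
    rfl
  rw [(hδ.contract _).valuation_eq (leafless _ _) hG hb,
    (((g.pushIso δ).connected_iff.1 hδ).contract _).valuation_eq (leafless _ _) hG hb,
    (g.pushContractIso δ C).fullIntegral_eq (leafless _ _) (leafless _ _)]

end Gluing

end FeynmanDiagram

namespace FeynmanDiagram

namespace Gluing

/-! ### Forests of a glued diagram -/

variable {Λ Λ' K O : Type} {U : K → Type} {Γ : FeynmanDiagram Λ}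
  {Δ : ∀ i, FeynmanDiagram (Λ' ⊕ U i)} {lab : K → Λ' → Λ} {slot : ∀ i, U i → O}
  (g : Gluing Γ Δ lab slot) [Fintype K] {F : ∀ i, Finset (Δ i).Subdiagram}

open Classical in
/-- The forest of a glued diagram made of the images of the elements of forests of the pieces. -/
def pushForest (F : ∀ i, Finset (Δ i).Subdiagram) : Finset Γ.Subdiagram :=
  (Finset.univ.sigma F).image fun s => g.push s.1 s.2

theorem mem_pushForest {γ : Γ.Subdiagram} :
    γ ∈ g.pushForest F ↔ ∃ i, ∃ δ ∈ F i, g.push i δ = γ := by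
  simp [pushForest]

theorem push_mem_pushForest {i : K} {δ : (Δ i).Subdiagram} (hδ : δ ∈ F i) :
    g.push i δ ∈ g.pushForest F := g.mem_pushForest.2 ⟨i, δ, hδ, rfl⟩

theorem push_mem_pushForest_iff {i : K} {δ : (Δ i).Subdiagram} (hδ : δ.verts.Nonempty) :
    g.push i δ ∈ g.pushForest F ↔ δ ∈ F i := by
  refine ⟨fun h => ?_, g.push_mem_pushForest⟩
  obtain ⟨j, δ', hδ', h⟩ := g.mem_pushForest.1 h
  cases g.sigma_eq_of_push_eq hδ h.symm
  exact hδ'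

theorem isForest_pushForest_iff : IsForest (g.pushForest F) ↔ ∀ i, IsForest (F i) := by
  constructor
  · rintro ⟨hdiv, hnested⟩ i
    refine ⟨fun δ hδ => g.push_divergent_iff.1 (hdiv _ (g.push_mem_pushForest hδ)),
      fun δ hδ δ' hδ' => ?_⟩
    simpa only [g.push_le_push_iff, g.disjoint_push_iff] using
      hnested _ (g.push_mem_pushForest hδ) _ (g.push_mem_pushForest hδ')
  · intro h
    refine ⟨fun γ hγ => ?_, fun γ₁ hγ₁ γ₂ hγ₂ => ?_⟩
    · obtain ⟨i, δ, hδ, rfl⟩ := g.mem_pushForest.1 hγ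
      exact g.push_divergent_iff.2 ((h i).1 δ hδ)
    · obtain ⟨i, δ, hδ, rfl⟩ := g.mem_pushForest.1 hγ₁
      obtain ⟨j, δ', hδ', rfl⟩ := g.mem_pushForest.1 hγ₂
      by_cases hdisj : Disjoint (g.push i δ).verts (g.push j δ').verts
      · exact Or.inr (Or.inr hdisj)
      · obtain rfl := g.index_eq_of_not_disjoint hdisj
        simpa only [g.push_le_push_iff, g.disjoint_push_iff] using (h i).2 δ hδ δ' hδ'

theorem roots_pushForest (hF : ∀ i, ∀ δ ∈ F i, δ.verts.Nonempty) :
    roots (g.pushForest F) = g.pushSets fun i => roots (F i) := by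
  ext γ
  constructor
  · rintro ⟨hγ, hmax⟩
    obtain ⟨i, δ, hδ, rfl⟩ := g.mem_pushForest.1 hγ
    exact ⟨i, δ, ⟨hδ, fun δ' hδ' hle => g.push_le_push_iff.1
      (hmax (g.push_mem_pushForest hδ') (g.push_le_push_iff.2 hle))⟩, rfl⟩
  · rintro ⟨i, δ, ⟨hδ, hmax⟩, rfl⟩
    refine ⟨g.push_mem_pushForest hδ, fun γ' hγ' hle => ?_⟩
    obtain ⟨j, δ', hδ', rfl⟩ := g.mem_pushForest.1 hγ'
    obtain rfl := g.index_eq_of_push_le (hF i δ hδ) hle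
    exact g.push_le_push_iff.2 (hmax hδ' (g.push_le_push_iff.1 hle))

theorem children_pushForest (hF : ∀ i, ∀ δ ∈ F i, δ.verts.Nonempty) {i : K}
    (δ : (Δ i).Subdiagram) :
    children (g.pushForest F) (g.push i δ) = g.push i '' children (F i) δ := by
  ext γ
  constructor
  · rintro ⟨⟨hγ, hlt⟩, hmax⟩
    obtain ⟨j, δ₁, hδ₁, rfl⟩ := g.mem_pushForest.1 hγ
    obtain rfl := g.index_eq_of_push_le (hF j δ₁ hδ₁) hlt.le
    exact ⟨δ₁, ⟨⟨hδ₁, g.push_lt_push_iff.1 hlt⟩, fun δ₂ hδ₂ hle => g.push_le_push_iff.1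
      (hmax ⟨g.push_mem_pushForest hδ₂.1, g.push_lt_push_iff.2 hδ₂.2⟩
        (g.push_le_push_iff.2 hle))⟩, rfl⟩
  · rintro ⟨δ₁, ⟨⟨hδ₁, hlt⟩, hmax⟩, rfl⟩
    refine ⟨⟨g.push_mem_pushForest hδ₁, g.push_lt_push_iff.2 hlt⟩, ?_⟩
    rintro γ ⟨hγ, hγlt⟩ hle
    obtain ⟨j, δ₂, hδ₂, rfl⟩ := g.mem_pushForest.1 hγ
    obtain rfl := g.index_eq_of_push_le (hF j δ₂ hδ₂) hγlt.le
    exact g.push_le_push_iff.2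
      (hmax ⟨hδ₂, g.push_lt_push_iff.1 hγlt⟩ (g.push_le_push_iff.1 hle))

theorem injOn_push (hF : ∀ i, ∀ δ ∈ F i, δ.verts.Nonempty) :
    InjOn (fun s : Σ i, (Δ i).Subdiagram => g.push s.1 s.2)
      (Finset.univ.sigma F : Finset (Σ i, (Δ i).Subdiagram)) := by
  rintro ⟨i, δ⟩ hδ ⟨j, δ'⟩ - h
  exact g.sigma_eq_of_push_eq (hF i δ (Finset.mem_sigma.1 hδ).2) h

theorem card_pushForest (hF : ∀ i, ∀ δ ∈ F i, δ.verts.Nonempty) :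
    (g.pushForest F).card = ∑ i, (F i).card := by
  classical
  rw [pushForest, Finset.card_image_of_injOn (g.injOn_push hF), Finset.card_sigma]

theorem prod_pushForest (hF : ∀ i, ∀ δ ∈ F i, δ.verts.Nonempty)
    (f : Γ.Subdiagram → ℝ) :
    ∏ γ ∈ g.pushForest F, f γ = ∏ i, ∏ δ ∈ F i, f (g.push i δ) := by
  classical
  rw [pushForest, Finset.prod_image (g.injOn_push hF), Finset.prod_sigma]

theorem eq_of_pushForest_eq {F' : ∀ i, Finset (Δ i).Subdiagram}
    (hF : ∀ i, ∀ δ ∈ F i, δ.verts.Nonempty) (hF' : ∀ i, ∀ δ ∈ F' i, δ.verts.Nonempty)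
    (h : g.pushForest F = g.pushForest F') : F = F' := by
  refine funext fun i => Finset.ext fun δ => ⟨fun hδ => ?_, fun hδ => ?_⟩
  · exact (g.push_mem_pushForest_iff (hF i δ hδ)).1 (h ▸ g.push_mem_pushForest hδ)
  · exact (g.push_mem_pushForest_iff (hF' i δ hδ)).1 (h ▸ g.push_mem_pushForest hδ)

theorem exists_pushForest_eq {H : Finset Γ.Subdiagram}
    (hH : ∀ γ ∈ H, ∃ i δ, g.push i δ = γ) : ∃ F, g.pushForest F = H := by
  classical
  refine ⟨fun i => Finset.univ.filter fun δ => g.push i δ ∈ H, Finset.ext fun γ => ?_⟩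
  rw [mem_pushForest]
  constructor
  · rintro ⟨i, δ, hδ, rfl⟩
    exact (Finset.mem_filter.1 hδ).2
  · intro hγ
    obtain ⟨i, δ, rfl⟩ := hH γ hγ
    exact ⟨i, δ, Finset.mem_filter.2 ⟨Finset.mem_univ _, hγ⟩, rfl⟩

open Classical in
theorem sum_isForest_eq (hlocal : ∀ γ : Γ.Subdiagram, γ.Divergent → ∃ i δ, g.push i δ = γ)
    (f : Finset Γ.Subdiagram → ℝ) :
    ∑ H : Finset Γ.Subdiagram with IsForest H, f H =
      ∑ F ∈ Fintype.piFinset fun i => {F : Finset (Δ i).Subdiagram | IsForest F},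
        f (g.pushForest F) := by
  have mem_iff (F : ∀ i, Finset (Δ i).Subdiagram) :
      (F ∈ Fintype.piFinset fun i => {F : Finset (Δ i).Subdiagram | IsForest F}) ↔
        ∀ i, IsForest (F i) := by
    simp only [Fintype.mem_piFinset, Finset.mem_filter_univ]
  refine (Finset.sum_bij (fun F _ => g.pushForest F) (fun F hF => ?_)
    (fun F hF F' hF' h => ?_) (fun H hH => ?_) fun _ _ => rfl).symm
  · rw [Finset.mem_filter_univ]
    exact g.isForest_pushForest_iff.2 ((mem_iff F).1 hF)
  · exact g.eq_of_pushForest_eq (fun i δ hδ => (((mem_iff F).1 hF i).1 δ hδ).nonempty)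
      (fun i δ hδ => (((mem_iff F').1 hF' i).1 δ hδ).nonempty) h
  · rw [Finset.mem_filter_univ] at hH
    obtain ⟨F, rfl⟩ := g.exists_pushForest_eq fun γ hγ => hlocal γ (hH.1 γ hγ)
    exact ⟨F, (mem_iff F).2 (g.isForest_pushForest_iff.1 hH), rfl⟩

/-! ### Factorisation of renormalised valuations -/

section Factorisation

variable [Fintype O] {G : T4 → ℝ}

theorem valuation_contract_roots (hG : Measurable G) (hb : ∃ C, ∀ x, |G x| ≤ C)
    (hΓ : Γ.LeafConnected) (hΔ : ∀ i, (Δ i).LeafConnected)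
    (hF : ∀ i, ∀ δ ∈ F i, δ.verts.Nonempty) (x : Λ → T4) :
    (Γ.contract (roots (g.pushForest F))).valuation G x =
      ∫ z : O → T4, ∏ i, ((Δ i).contract (roots (F i))).valuation G
        (piecePoints lab slot x z i) := by
  rw [(hΓ.contract _).valuation_eq hG hb, g.roots_pushForest hF,
    (g.contract fun i => roots (F i)).fullIntegral_eq hG hb]
  simp_rw [((hΔ _).contract _).valuation_eq hG hb]

theorem forestTerm_pushForest (hG : Measurable G) (hb : ∃ C, ∀ x, |G x| ≤ C)
    (hΓ : Γ.LeafConnected) (hΔ : ∀ i, (Δ i).LeafConnected)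
    (hF : ∀ i, IsForest (F i)) (x : Λ → T4) :
    Γ.forestTerm G (g.pushForest F) x =
      ∫ z : O → T4, ∏ i, (Δ i).forestTerm G (F i) (piecePoints lab slot x z i) := by
  have hne (i : K) (δ) (hδ : δ ∈ F i) : δ.verts.Nonempty := ((hF i).1 δ hδ).nonempty
  rw [forestTerm, g.card_pushForest hne, g.prod_pushForest hne,
    g.valuation_contract_roots hG hb hΓ hΔ hne, ← mul_assoc, ← integral_const_mul]
  refine integral_congr_ae (Filter.Eventually.of_forall fun z => ?_)
  simp only [forestTerm, Finset.prod_mul_distrib, Finset.prod_pow_eq_pow_sum, ← mul_assoc]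
  congr 2
  refine Finset.prod_congr rfl fun i _ => Finset.prod_congr rfl fun δ hδ => ?_
  rw [g.children_pushForest hne, g.valuation_push_contract hG hb ((hF i).1 δ hδ).1]

theorem integrable_prod_forestTerm (hG : Measurable G) (hb : ∃ C, ∀ x, |G x| ≤ C)
    (F : ∀ i, Finset (Δ i).Subdiagram) (x : Λ → T4) :
    Integrable fun z : O → T4 =>
      ∏ i, (Δ i).forestTerm G (F i) (piecePoints lab slot x z i) := by
  choose C hC using fun i => (Δ i).exists_abs_forestTerm_le hG hb (F i)
  have hmeas : Measurable fun z : O → T4 =>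
      ∏ i, (Δ i).forestTerm G (F i) (piecePoints lab slot x z i) :=
    Finset.measurable_prod _ fun i _ =>
      ((Δ i).measurable_forestTerm hG hb (F i)).comp (measurable_piecePoints x i)
  refine Integrable.of_bound (C := ∏ i, C i) hmeas.aestronglyMeasurable
    (Filter.Eventually.of_forall fun z => ?_)
  rw [Real.norm_eq_abs, Finset.abs_prod]
  exact Finset.prod_le_prod (fun i _ => abs_nonneg _) fun i _ => hC i _

theorem renormalisedValuation_eq (hG : Measurable G) (hb : ∃ C, ∀ x, |G x| ≤ C)
    (hlocal : ∀ γ : Γ.Subdiagram, γ.Divergent → ∃ i δ, g.push i δ = γ)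
    (hΓ : Γ.LeafConnected) (hΔ : ∀ i, (Δ i).LeafConnected) (x : Λ → T4) :
    Γ.renormalisedValuation G x =
      ∫ z : O → T4, ∏ i, (Δ i).renormalisedValuation G (piecePoints lab slot x z i) := by
  classical
  simp only [renormalisedValuation_eq_sum, Finset.prod_univ_sum]
  rw [g.sum_isForest_eq hlocal,
    integral_finsetSum _ fun F _ => integrable_prod_forestTerm hG hb F x]
  refine Finset.sum_congr rfl fun F hF => g.forestTerm_pushForest hG hb hΓ hΔ (fun i => ?_) x
  simpa only [Finset.mem_filter_univ] using Fintype.mem_piFinset.1 hF i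

end Factorisation

end Gluing

end FeynmanDiagram

/-! ### Complete pairings of a disjoint union -/

section Join

variable {K : Type} {S : K → Type}

/-- The inclusion of the unpaired elements into the disjoint union of the pieces. -/
def unpairedIncl (κ : ∀ i, Pairing (S i)) (p : Σ i, (κ i).Unpaired) : Σ i, S i := ⟨p.1, p.2.1⟩

theorem unpairedIncl_injective (κ : ∀ i, Pairing (S i)) :
    Function.Injective (unpairedIncl κ) := by
  rintro ⟨i, u, hu⟩ ⟨j, v, hv⟩ h
  cases h
  rfl

section Definition

variable (κ : ∀ i, Pairing (S i)) (σ : ExternalPairing fun i => (κ i).Unpaired)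

open Classical in
/-- The involution given by `κ i` on the paired elements of the piece `i`, and by `σ` on the
unpaired elements of all pieces. -/
def joinFun (p : Σ i, S i) : Σ i, S i :=
  if h : (κ p.1).1 p.2 = p.2 then unpairedIncl κ (σ.1.1 ⟨p.1, p.2, h⟩) else ⟨p.1, (κ p.1).1 p.2⟩

theorem joinFun_of_unpaired {i : K} {s : S i} (h : (κ i).1 s = s) :
    joinFun κ σ ⟨i, s⟩ = unpairedIncl κ (σ.1.1 ⟨i, s, h⟩) :=
  dif_pos h

theorem joinFun_unpairedIncl (p : Σ i, (κ i).Unpaired) :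
    joinFun κ σ (unpairedIncl κ p) = unpairedIncl κ (σ.1.1 p) :=
  joinFun_of_unpaired κ σ p.2.2

theorem joinFun_of_paired {i : K} {s : S i} (h : (κ i).1 s ≠ s) :
    joinFun κ σ ⟨i, s⟩ = ⟨i, (κ i).1 s⟩ :=
  dif_neg h

theorem joinFun_involutive : Function.Involutive (joinFun κ σ) := by
  rintro ⟨i, s⟩
  by_cases h : (κ i).1 s = s
  · rw [joinFun_of_unpaired κ σ h, joinFun_unpairedIncl, σ.1.2.1]
    rfl
  · have h' : (κ i).1 ((κ i).1 s) ≠ (κ i).1 s := fun h' => h ((κ i).2.injective h')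
    rw [joinFun_of_paired κ σ h, joinFun_of_paired κ σ h', (κ i).2]

theorem joinFun_ne (p : Σ i, S i) : joinFun κ σ p ≠ p := by
  obtain ⟨i, s⟩ := p
  by_cases h : (κ i).1 s = s
  · rw [joinFun_of_unpaired κ σ h]
    exact fun h' => σ.1.2.2 _ (unpairedIncl_injective κ h')
  · rw [joinFun_of_paired κ σ h]
    simpa using h

/-- The complete pairing of a disjoint union made of internal pairings of the pieces and of an
external pairing of the elements which these leave unpaired. -/
def join : CompletePairing (Σ i, S i) :=
  ⟨joinFun κ σ, joinFun_involutive κ σ, joinFun_ne κ σ⟩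

theorem join_fst_eq_iff {i : K} {s : S i} : ((join κ σ).1 ⟨i, s⟩).1 = i ↔ (κ i).1 s ≠ s := by
  by_cases h : (κ i).1 s = s
  · simpa [join, joinFun_of_unpaired κ σ h, h] using! σ.2 ⟨i, s, h⟩
  · simp [join, joinFun_of_paired κ σ h, h]

end Definition

theorem join_right_injective (κ : ∀ i, Pairing (S i)) : Function.Injective (join κ) := by
  refine fun σ σ' h => Subtype.ext (Subtype.ext (funext fun p => unpairedIncl_injective κ ?_))
  rw [← joinFun_unpairedIncl, ← joinFun_unpairedIncl]
  exact congrFun (congrArg Subtype.val h) _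

namespace CompletePairing

variable (τ : CompletePairing (Σ i, S i))

open Classical in
/-- The map that exchanges the elements of a piece which `τ` pairs with each other, and fixes all
other elements of that piece. -/
def internalFun (i : K) (s : S i) : S i :=
  if h : (τ.1 ⟨i, s⟩).1 = i then h ▸ (τ.1 ⟨i, s⟩).2 else s

variable {τ}

theorem mk_internalFun {i : K} {s : S i} (h : (τ.1 ⟨i, s⟩).1 = i) :
    (⟨i, τ.internalFun i s⟩ : Σ i, S i) = τ.1 ⟨i, s⟩ := by
  rw [internalFun, dif_pos h]
  exact Sigma.ext h.symm (eqRec_heq h _)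

theorem internalFun_of_fst_ne {i : K} {s : S i} (h : (τ.1 ⟨i, s⟩).1 ≠ i) :
    τ.internalFun i s = s :=
  dif_neg h

theorem internalFun_eq_self_iff {i : K} {s : S i} :
    τ.internalFun i s = s ↔ (τ.1 ⟨i, s⟩).1 ≠ i := by
  refine ⟨fun h h' => τ.2.2 ⟨i, s⟩ ?_, internalFun_of_fst_ne⟩
  rw [← mk_internalFun h', h]

variable (τ)

theorem internalFun_involutive (i : K) : Function.Involutive (τ.internalFun i) := by
  intro s
  by_cases h : (τ.1 ⟨i, s⟩).1 = i
  · have hs : τ.1 ⟨i, τ.internalFun i s⟩ = ⟨i, s⟩ := by rw [mk_internalFun h, τ.2.1]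
    simpa [hs] using mk_internalFun (τ := τ) (s := τ.internalFun i s) (by rw [hs])
  · rw [internalFun_of_fst_ne h, internalFun_of_fst_ne h]

/-- The pairing of a piece induced by a complete pairing of a disjoint union. -/
def internal (i : K) : Pairing (S i) := ⟨τ.internalFun i, τ.internalFun_involutive i⟩

theorem internalFun_apply_unpairedIncl (p : Σ i, (τ.internal i).Unpaired) :
    τ.internalFun _ (τ.1 (unpairedIncl τ.internal p)).2 = (τ.1 (unpairedIncl τ.internal p)).2 := by
  rw [internalFun_eq_self_iff, Sigma.eta, τ.2.1]
  exact (internalFun_eq_self_iff.1 p.2.2).symm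

/-- The pairing which a complete pairing of a disjoint union induces between elements of different
pieces. -/
def external : ExternalPairing fun i => (τ.internal i).Unpaired :=
  ⟨⟨fun p => ⟨_, _, τ.internalFun_apply_unpairedIncl p⟩,
    fun _ => unpairedIncl_injective _ (τ.2.1 _),
    fun p h => τ.2.2 (unpairedIncl τ.internal p) (congrArg (unpairedIncl τ.internal) h)⟩,
    fun p => (internalFun_eq_self_iff (τ := τ)).1 p.2.2⟩

theorem join_internal_external : join τ.internal τ.external = τ := by
  refine Subtype.ext (funext fun ⟨i, s⟩ => ?_)
  by_cases h : τ.internalFun i s = s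
  · exact joinFun_of_unpaired τ.internal τ.external h
  · exact (joinFun_of_paired τ.internal τ.external h).trans
      (mk_internalFun (not_not.1 (mt internalFun_of_fst_ne h)))

theorem internal_join (κ : ∀ i, Pairing (S i)) (σ : ExternalPairing fun i => (κ i).Unpaired) :
    (join κ σ).internal = κ := by
  refine funext fun i => Subtype.ext (funext fun s => ?_)
  change (join κ σ).internalFun i s = _
  by_cases h : (κ i).1 s = s
  · rw [internalFun_of_fst_ne ((join_fst_eq_iff κ σ).not_left.2 h), h]
  · simpa using (mk_internalFun ((join_fst_eq_iff κ σ).2 h)).trans (joinFun_of_paired κ σ h)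

end CompletePairing

theorem join_bijective : Function.Bijective
    fun p : (Σ κ : ∀ i, Pairing (S i), ExternalPairing fun i => (κ i).Unpaired) =>
      join p.1 p.2 := by
  refine ⟨fun ⟨κ, σ⟩ ⟨κ', σ'⟩ h => ?_, fun τ => ⟨⟨_, τ.external⟩, τ.join_internal_external⟩⟩
  obtain rfl : κ = κ' := by
    rw [← CompletePairing.internal_join κ σ, ← CompletePairing.internal_join κ' σ']
    exact congrArg CompletePairing.internal h
  obtain rfl := join_right_injective κ h
  rfl

end Join

/-! ### Trees and paired diagrams -/

/-- The vertex of the tree with `n` internal vertices that corresponds to a leaf. -/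
def leafVertex (n : ℕ) : Leaf → Fin (n + 2)
  | .bottom => 0
  | .top => Fin.last (n + 1)

theorem vertexCases_leafVertex {α : Type} {n : ℕ} (f : Leaf → α) (f' : Fin n → α) (l : Leaf) :
    vertexCases (f .bottom) (f .top) f' (leafVertex n l) = f l := by
  cases l with
  | bottom => rw [leafVertex, vertexCases, ← Fin.castSucc_zero, Fin.lastCases_castSucc,
      Fin.cases_zero]
  | top => rw [leafVertex, vertexCases, Fin.lastCases_last]

theorem exists_eq_leafVertex_or_innerVertex {n : ℕ} (v : Fin (n + 2)) :
    (∃ l, v = leafVertex n l) ∨ ∃ j, v = innerVertex j := by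
  induction v using Fin.lastCases with
  | last => exact Or.inl ⟨.top, rfl⟩
  | cast w =>
    induction w using Fin.cases with
    | zero => exact Or.inl ⟨.bottom, rfl⟩
    | succ j => exact Or.inr ⟨j, rfl⟩

section Internal

variable {n : ℕ} (κ : Pairing (Fin n))

/-- The vertex of `internalDiagram n κ` that a vertex of the tree becomes. -/
def treeVertex (v : Fin (n + 2)) : (internalDiagram n κ).V := Quot.mk _ v

theorem treeVertex_innerVertex_apply (j : Fin n) :
    treeVertex κ (innerVertex (κ.1 j)) = treeVertex κ (innerVertex j) :=
  (Quot.sound ⟨j, rfl, rfl⟩).symm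

theorem label_treeVertex_leafVertex (l : Leaf) :
    (internalDiagram n κ).label (treeVertex κ (leafVertex n l)) = some (Sum.inl l) :=
  vertexCases_leafVertex (fun l => some (Sum.inl l)) _ l

theorem label_treeVertex_of_unpaired {j : Fin n} (h : κ.1 j = j) :
    (internalDiagram n κ).label (treeVertex κ (innerVertex j)) = some (Sum.inr ⟨j, h⟩) :=
  (vertexCases_innerVertex (some (Sum.inl Leaf.bottom)) (some (Sum.inl Leaf.top)) _ j).trans
    (dif_pos h)

theorem label_treeVertex_of_paired {j : Fin n} (h : κ.1 j ≠ j) :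
    (internalDiagram n κ).label (treeVertex κ (innerVertex j)) = none :=
  (vertexCases_innerVertex (some (Sum.inl Leaf.bottom)) (some (Sum.inl Leaf.top)) _ j).trans
    (dif_neg h)

variable {κ}

theorem exists_eq_treeVertex (v : (internalDiagram n κ).V) :
    (∃ l, v = treeVertex κ (leafVertex n l)) ∨ ∃ j, v = treeVertex κ (innerVertex j) := by
  obtain ⟨v⟩ := v
  rcases exists_eq_leafVertex_or_innerVertex v with ⟨l, rfl⟩ | ⟨j, rfl⟩
  · exact Or.inl ⟨l, rfl⟩
  · exact Or.inr ⟨j, rfl⟩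

theorem eq_treeVertex_of_label_eq_inl {v : (internalDiagram n κ).V} {l : Leaf}
    (h : (internalDiagram n κ).label v = some (Sum.inl l)) :
    v = treeVertex κ (leafVertex n l) := by
  rcases exists_eq_treeVertex v with ⟨l', rfl⟩ | ⟨j, rfl⟩
  · rw [label_treeVertex_leafVertex] at h
    cases h
    rfl
  · by_cases hj : κ.1 j = j
    · simp [label_treeVertex_of_unpaired κ hj] at h
    · simp [label_treeVertex_of_paired κ hj] at h

theorem eq_treeVertex_of_label_eq_inr {v : (internalDiagram n κ).V} {u : κ.Unpaired}
    (h : (internalDiagram n κ).label v = some (Sum.inr u)) :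
    v = treeVertex κ (innerVertex u.1) := by
  rcases exists_eq_treeVertex v with ⟨l, rfl⟩ | ⟨j, rfl⟩
  · simp [label_treeVertex_leafVertex] at h
  · by_cases hj : κ.1 j = j
    · rw [label_treeVertex_of_unpaired κ hj] at h
      cases h
      rfl
    · simp [label_treeVertex_of_paired κ hj] at h

theorem exists_eq_treeVertex_of_label_eq_none {v : (internalDiagram n κ).V}
    (h : (internalDiagram n κ).label v = none) :
    ∃ j, κ.1 j ≠ j ∧ v = treeVertex κ (innerVertex j) := by
  rcases exists_eq_treeVertex v with ⟨l, rfl⟩ | ⟨j, rfl⟩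
  · simp [label_treeVertex_leafVertex] at h
  · refine ⟨j, fun hj => ?_, rfl⟩
    simp [label_treeVertex_of_unpaired κ hj] at h

variable (κ)

theorem leafConnected_internalDiagram : (internalDiagram n κ).LeafConnected := by
  have connected_bottom (v : Fin (n + 2)) :
      Relation.EqvGen (internalDiagram n κ).Adj (treeVertex κ v)
        (treeVertex κ (leafVertex n .bottom)) := by
    induction v using Fin.induction with
    | zero => exact .refl _
    | succ e ih => exact (Relation.EqvGen.rel _ _ ⟨e, rfl, rfl⟩).symm.trans _ _ _ ih
  rintro ⟨v⟩
  exact ⟨_, connected_bottom v, by simp [label_treeVertex_leafVertex]⟩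

end Internal

section Paired

variable {k : ℕ} {n : Fin k → ℕ} (τ : CompletePairing (Σ i, Fin (n i)))

/-- The vertex of `pairedDiagram n τ` that a vertex of the `i`-th tree becomes. -/
def pairedVertex (i : Fin k) (v : Fin (n i + 2)) : (pairedDiagram n τ).V := Quot.mk _ ⟨i, v⟩

/-- The vertex of a paired diagram that corresponds to a noise. -/
def noiseVertex (p : Σ i, Fin (n i)) : (pairedDiagram n τ).V :=
  pairedVertex τ p.1 (innerVertex p.2)

theorem noiseVertex_apply (p : Σ i, Fin (n i)) : noiseVertex τ (τ.1 p) = noiseVertex τ p :=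
  (Quot.sound ⟨p, rfl, rfl⟩).symm

theorem label_pairedVertex_leafVertex (i : Fin k) (l : Leaf) :
    (pairedDiagram n τ).label (pairedVertex τ i (leafVertex (n i) l)) = some (i, l) :=
  vertexCases_leafVertex (fun l => some (i, l)) _ l

theorem label_noiseVertex (p : Σ i, Fin (n i)) :
    (pairedDiagram n τ).label (noiseVertex τ p) = none :=
  vertexCases_innerVertex (some (p.1, Leaf.bottom)) (some (p.1, Leaf.top)) _ p.2

variable {τ}

theorem exists_eq_innerVertex_of_label_eq_none {i : Fin k} {v : Fin (n i + 2)}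
    (h : (pairedDiagram n τ).label (pairedVertex τ i v) = none) : ∃ j, v = innerVertex j := by
  rcases exists_eq_leafVertex_or_innerVertex v with ⟨l, rfl⟩ | hv
  · simp [label_pairedVertex_leafVertex] at h
  · exact hv

variable (τ)

theorem leafConnected_pairedDiagram : (pairedDiagram n τ).LeafConnected := by
  have connected_bottom (i : Fin k) (v : Fin (n i + 2)) :
      Relation.EqvGen (pairedDiagram n τ).Adj (pairedVertex τ i v)
        (pairedVertex τ i (leafVertex (n i) .bottom)) := by
    induction v using Fin.induction with
    | zero => exact .refl _
    | succ e ih => exact (Relation.EqvGen.rel _ _ ⟨⟨i, e⟩, rfl, rfl⟩).symm.trans _ _ _ ih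
  rintro ⟨i, v⟩
  exact ⟨_, connected_bottom i v, by simp [label_pairedVertex_leafVertex]⟩

section NoiseLift

variable {α : Type} (f : (Σ i, Fin (n i)) → α) (hf : ∀ p, f (τ.1 p) = f p)

/-- The function on the vertices of a paired diagram which, at the internal vertices, is given by
the function `f` of the noises. -/
def noiseLift : (pairedDiagram n τ).V → Option α :=
  Quot.lift (fun v => vertexCases none none (fun j => some (f ⟨v.1, j⟩)) v.2) <| by
    rintro v w ⟨p, rfl, rfl⟩
    simp only [vertexCases_innerVertex, Sigma.eta, hf p]

theorem noiseLift_noiseVertex (p : Σ i, Fin (n i)) :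
    noiseLift τ f hf (noiseVertex τ p) = some (f p) :=
  vertexCases_innerVertex _ _ _ p.2

end NoiseLift

theorem noiseVertex_eq_iff {p q : Σ i, Fin (n i)} :
    noiseVertex τ p = noiseVertex τ q ↔ q = p ∨ q = τ.1 p := by
  constructor
  · intro h
    have hlift := congrArg (noiseLift τ (fun p => (Quot.mk _ p : τ.Pairs))
      fun p => τ.mk_eq_mk_iff.2 (Or.inr (τ.2.1 p).symm)) h
    rw [noiseLift_noiseVertex, noiseLift_noiseVertex, Option.some_inj] at hlift
    exact τ.mk_eq_mk_iff.1 hlift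
  · rintro (rfl | rfl)
    · rfl
    · exact (noiseVertex_apply τ p).symm

/-! ### Divergent subdiagrams of paired diagrams -/

variable {τ}

theorem exists_noiseVertex_of_mem_edges {γ : (pairedDiagram n τ).Subdiagram} {i : Fin k}
    {e : Fin (n i + 1)} (he : (⟨i, e⟩ : Σ i, Fin (n i + 1)) ∈ γ.edges) :
    ∃ j j' : Fin (n i), e = j.succ ∧ j < j' ∧ noiseVertex τ ⟨i, j⟩ ∈ γ.verts ∧
      noiseVertex τ ⟨i, j'⟩ ∈ γ.verts := by
  have hsrc : pairedVertex τ i e.castSucc ∈ γ.verts := γ.src_mem _ he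
  have htgt : pairedVertex τ i e.succ ∈ γ.verts := γ.tgt_mem _ he
  obtain ⟨j, hj⟩ := exists_eq_innerVertex_of_label_eq_none (γ.internal _ hsrc)
  obtain ⟨j', hj'⟩ := exists_eq_innerVertex_of_label_eq_none (γ.internal _ htgt)
  obtain rfl : e = j.succ := Fin.castSucc_injective _ hj
  have hlt : j.succ = j'.castSucc := Fin.succ_injective _ hj'
  rw [hj'] at htgt
  exact ⟨j, j', rfl, Fin.castSucc_lt_castSucc_iff.1 (hlt ▸ Fin.castSucc_lt_succ), hsrc, htgt⟩

theorem ncard_preimage_noiseVertex_le (s : Set (pairedDiagram n τ).V) :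
    (noiseVertex τ ⁻¹' s).ncard ≤ 2 * s.ncard := by
  classical
  rw [ncard_eq_toFinset_card', ncard_eq_toFinset_card']
  refine Finset.card_le_mul_card_image_of_maps_to (f := noiseVertex τ)
    (fun p hp => by simpa using hp) 2 fun v hv => ?_
  by_cases hv : ∃ p, noiseVertex τ p = v
  · obtain ⟨p, rfl⟩ := hv
    refine (Finset.card_le_card (t := {p, τ.1 p}) fun q hq => ?_).trans Finset.card_le_two
    simpa using (noiseVertex_eq_iff τ).1 (Finset.mem_filter.1 hq).2.symm
  · rw [Finset.filter_false_of_mem fun p _ hp => hv ⟨p, hp⟩]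
    exact Nat.zero_le 2

theorem exists_isGreatest_noise {s : Set (pairedDiagram n τ).V} {p : Σ i, Fin (n i)}
    (hp : noiseVertex τ p ∈ s) :
    ∃ j, IsGreatest {j : Fin (n p.1) | noiseVertex τ ⟨p.1, j⟩ ∈ s} j :=
  (toFinite _).isCompact.exists_isGreatest ⟨p.2, hp⟩

-- An edge of `γ` is determined by the lower of the two noises that it joins, which is not the
-- highest noise of `γ` in its tree. If `γ` meets two trees this leaves at most `2 |V| - 2` edges.
theorem fst_eq_of_divergent {γ : (pairedDiagram n τ).Subdiagram} (hγ : γ.Divergent)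
    {p q : Σ i, Fin (n i)} (hp : noiseVertex τ p ∈ γ.verts) (hq : noiseVertex τ q ∈ γ.verts) :
    p.1 = q.1 := by
  by_contra hpq
  obtain ⟨a, ha, ha_max⟩ := exists_isGreatest_noise hp
  obtain ⟨b, hb, hb_max⟩ := exists_isGreatest_noise hq
  set noises : Set (Σ i, Fin (n i)) := noiseVertex τ ⁻¹' γ.verts
  set highest : Set (Σ i, Fin (n i)) := {⟨p.1, a⟩, ⟨q.1, b⟩}
  have highest_ncard : highest.ncard = 2 := ncard_pair fun h => hpq (Sigma.mk.inj h).1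
  have highest_subset : highest ⊆ noises := pair_subset ha hb
  have edges_subset : γ.edges ⊆
      (fun r : Σ i, Fin (n i) => (⟨r.1, r.2.succ⟩ : Σ i, Fin (n i + 1))) '' (noises \ highest) := by
    rintro ⟨i, e⟩ he
    obtain ⟨j, j', rfl, hlt, hj, hj'⟩ := exists_noiseVertex_of_mem_edges he
    refine ⟨⟨i, j⟩, ⟨hj, ?_⟩, rfl⟩
    rintro (h | h) <;> cases h
    · exact hlt.not_ge (ha_max hj')
    · exact hlt.not_ge (hb_max hj')
  have edges_ncard : γ.edges.ncard ≤ (noises \ highest).ncard :=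
    (ncard_le_ncard edges_subset (toFinite _)).trans (ncard_image_le (toFinite _))
  have sdiff_ncard : (noises \ highest).ncard + highest.ncard = noises.ncard :=
    ncard_sdiff_add_ncard_of_subset highest_subset
  have noises_ncard : noises.ncard ≤ 2 * γ.verts.ncard := ncard_preimage_noiseVertex_le γ.verts
  have deg_neg : 4 * ((γ.verts.ncard : ℤ) - 1) - 2 * (γ.edges.ncard : ℤ) < 0 := hγ.2.2
  omega

end Paired

/-! ### Gluing the diagrams of internally paired trees -/

section Join

variable {k : ℕ} {n : Fin k → ℕ} (κ : ∀ i, Pairing (Fin (n i)))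
  (σ : ExternalPairing fun i => (κ i).Unpaired)

/-- The vertex of `pairedDiagram n (join κ σ)` that a vertex of the `i`-th internally paired tree
becomes. -/
def joinVertex (i : Fin k) :
    (internalDiagram (n i) (κ i)).V → (pairedDiagram n (join κ σ)).V :=
  Quot.lift (pairedVertex (join κ σ) i) <| by
    rintro v w ⟨j, rfl, rfl⟩
    by_cases h : (κ i).1 j = j
    · rw [h]
    · exact (noiseVertex_apply (join κ σ) ⟨i, j⟩).symm.trans
        (congrArg (noiseVertex _) (joinFun_of_paired κ σ h))

/-- The vertex of `pairedDiagram n (join κ σ)` formed by two noises that `σ` pairs. -/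
def externalVertex : σ.1.Pairs → (pairedDiagram n (join κ σ)).V :=
  Quot.lift (fun p => noiseVertex (join κ σ) (unpairedIncl κ p)) <| by
    rintro p _ rfl
    rw [← joinFun_unpairedIncl]
    exact (noiseVertex_apply (join κ σ) _).symm

open Classical in
/-- The external pair, or the vertex of an internally paired tree, to which a noise belongs. -/
def noiseOrigin (p : Σ i, Fin (n i)) : σ.1.Pairs ⊕ Σ i, (internalDiagram (n i) (κ i)).V :=
  if h : (κ p.1).1 p.2 = p.2 then Sum.inl (σ.slot p.1 ⟨p.2, h⟩)
  else Sum.inr ⟨p.1, treeVertex (κ p.1) (innerVertex p.2)⟩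

theorem noiseOrigin_unpairedIncl (p : Σ i, (κ i).Unpaired) :
    noiseOrigin κ σ (unpairedIncl κ p) = Sum.inl (Quot.mk _ p) :=
  dif_pos p.2.2

theorem noiseOrigin_of_paired {i : Fin k} {j : Fin (n i)} (h : (κ i).1 j ≠ j) :
    noiseOrigin κ σ ⟨i, j⟩ = Sum.inr ⟨i, treeVertex (κ i) (innerVertex j)⟩ :=
  dif_neg h

theorem noiseOrigin_join (p : Σ i, Fin (n i)) :
    noiseOrigin κ σ ((join κ σ).1 p) = noiseOrigin κ σ p := by
  obtain ⟨i, j⟩ := p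
  change noiseOrigin κ σ (joinFun κ σ ⟨i, j⟩) = _
  by_cases h : (κ i).1 j = j
  · change noiseOrigin κ σ (joinFun κ σ (unpairedIncl κ ⟨i, j, h⟩)) =
      noiseOrigin κ σ (unpairedIncl κ ⟨i, j, h⟩)
    rw [joinFun_unpairedIncl, noiseOrigin_unpairedIncl, noiseOrigin_unpairedIncl]
    exact congrArg Sum.inl (σ.1.mk_eq_mk_iff.2 (Or.inr (σ.1.2.1 _).symm))
  · have h' : (κ i).1 ((κ i).1 j) ≠ (κ i).1 j := fun h' => h ((κ i).2.injective h')
    rw [joinFun_of_paired κ σ h, noiseOrigin_of_paired κ σ h, noiseOrigin_of_paired κ σ h',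
      treeVertex_innerVertex_apply]

/-- The paired diagram of a joined pairing is glued from the diagrams of the internally paired
trees along the external pairs. -/
def pairedGluing : (pairedDiagram n (join κ σ)).Gluing (fun i => internalDiagram (n i) (κ i))
    (fun i l => (i, l)) σ.slot where
  vert := joinVertex κ σ
  edge := Equiv.refl _
  node := externalVertex κ σ
  retract := noiseLift (join κ σ) (noiseOrigin κ σ) (noiseOrigin_join κ σ)
  src_edge _ _ := rfl
  tgt_edge _ _ := rfl
  vert_slot i v u h := by
    rw [eq_treeVertex_of_label_eq_inr h]
    rfl
  label_leaf i v l h := by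
    rw [eq_treeVertex_of_label_eq_inl h]
    exact label_pairedVertex_leafVertex (join κ σ) i l
  label_internal i v h := by
    obtain ⟨j, -, rfl⟩ := exists_eq_treeVertex_of_label_eq_none h
    exact label_noiseVertex (join κ σ) ⟨i, j⟩
  label_node := by
    rintro ⟨p⟩
    exact label_noiseVertex (join κ σ) (unpairedIncl κ p)
  retract_node := by
    rintro ⟨p⟩
    exact (noiseLift_noiseVertex (join κ σ) _ _ _).trans
      (congrArg some (noiseOrigin_unpairedIncl κ σ p))
  retract_vert i v h := by
    obtain ⟨j, hj, rfl⟩ := exists_eq_treeVertex_of_label_eq_none h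
    exact (noiseLift_noiseVertex (join κ σ) _ _ ⟨i, j⟩).trans
      (congrArg some (noiseOrigin_of_paired κ σ hj))
  exists_of_internal := by
    rintro ⟨i, v⟩ h
    obtain ⟨j, rfl⟩ := exists_eq_innerVertex_of_label_eq_none h
    by_cases hj : (κ i).1 j = j
    · exact Or.inl ⟨σ.slot i ⟨j, hj⟩, rfl⟩
    · exact Or.inr ⟨i, treeVertex (κ i) (innerVertex j), label_treeVertex_of_paired (κ i) hj, rfl⟩

theorem exists_noiseVertex_mem_of_joinVertex_mem {γ : (pairedDiagram n (join κ σ)).Subdiagram}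
    {i : Fin k} {v : (internalDiagram (n i) (κ i)).V} (hv : joinVertex κ σ i v ∈ γ.verts) :
    ∃ j, noiseVertex (join κ σ) ⟨i, j⟩ ∈ γ.verts := by
  obtain ⟨v⟩ := v
  obtain ⟨j, rfl⟩ := exists_eq_innerVertex_of_label_eq_none (γ.internal _ hv)
  exact ⟨j, hv⟩

theorem externalVertex_notMem_of_divergent {γ : (pairedDiagram n (join κ σ)).Subdiagram}
    (hγ : γ.Divergent) (o : σ.1.Pairs) : externalVertex κ σ o ∉ γ.verts := by
  obtain ⟨p⟩ := o
  intro hp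
  have hp' : noiseVertex (join κ σ) (unpairedIncl κ (σ.1.1 p)) ∈ γ.verts := by
    rw [← joinFun_unpairedIncl]
    exact (noiseVertex_apply (join κ σ) _).symm ▸ hp
  exact σ.2 p (fst_eq_of_divergent hγ hp' hp)

theorem exists_push_eq_of_divergent {γ : (pairedDiagram n (join κ σ)).Subdiagram}
    (hγ : γ.Divergent) : ∃ i δ, (pairedGluing κ σ).push i δ = γ := by
  have hnode := externalVertex_notMem_of_divergent κ σ hγ
  obtain ⟨v, hv⟩ := hγ.nonempty
  rcases (pairedGluing κ σ).exists_of_internal v (γ.internal v hv) with ⟨o, rfl⟩ | ⟨i, w, -, rfl⟩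
  · exact (hnode o hv).elim
  · obtain ⟨j, hj⟩ := exists_noiseVertex_mem_of_joinVertex_mem κ σ hv
    refine ⟨i, _, (pairedGluing κ σ).push_pull hnode fun i' w' hw' => ?_⟩
    obtain ⟨j', hj'⟩ := exists_noiseVertex_mem_of_joinVertex_mem κ σ hw'
    exact fst_eq_of_divergent hγ hj' hj

theorem renormalisedValuation_join {G : T4 → ℝ} (hG : Measurable G)
    (hb : ∃ C, ∀ x, |G x| ≤ C) (x : Fin k × Leaf → T4) :
    (pairedDiagram n (join κ σ)).renormalisedValuation G x =
      ∫ z : σ.1.Pairs → T4, ∏ i, (internalDiagram (n i) (κ i)).renormalisedValuation G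
        (Sum.elim (fun l => x (i, l)) fun u => z (σ.slot i u)) :=
  (pairedGluing κ σ).renormalisedValuation_eq hG hb
    (fun _ => exists_push_eq_of_divergent κ σ) (leafConnected_pairedDiagram _)
    (fun _ => leafConnected_internalDiagram _) x

end Join

/-! ### Expectations of products of renormalised trees -/

theorem memLp_top_renormalisedValuation {G : T4 → ℝ} (hG : Measurable G)
    (hb : ∃ C, ∀ x, |G x| ≤ C) {n : ℕ} (κ : Pairing (Fin n)) (x : Leaf → T4) :
    MemLp (fun z : κ.Unpaired → T4 =>
      (internalDiagram n κ).renormalisedValuation G (Sum.elim x z)) ⊤ volume := by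
  obtain ⟨C, hC⟩ := (internalDiagram n κ).exists_abs_renormalisedValuation_le hG hb
  have measurable_elim : Measurable fun z : κ.Unpaired → T4 => Sum.elim x z :=
    measurable_pi_iff.2 (Sum.forall.2 ⟨fun _ => measurable_const, measurable_pi_apply⟩)
  exact memLp_top_of_bound (((internalDiagram n κ).measurable_renormalisedValuation hG hb).comp
    measurable_elim).aestronglyMeasurable C (Filter.Eventually.of_forall fun _ => hC _)

theorem integral_prod_renormalisedPairedTree {Ω : Type*} [MeasurableSpace Ω] {P : Measure Ω}
    (ξ : WhiteNoise P) {G : T4 → ℝ} (hG : Measurable G) (hb : ∃ C, ∀ x, |G x| ≤ C) {k : ℕ}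
    {n : Fin k → ℕ} (x y : Fin k → T4) (κ : ∀ i, Pairing (Fin (n i))) :
    Integrable (fun ω => ∏ i, renormalisedPairedTree ξ G (n i) (κ i) (x i) (y i) ω) P ∧
      ∫ ω, ∏ i, renormalisedPairedTree ξ G (n i) (κ i) (x i) (y i) ω ∂P =
        ∑ σ : ExternalPairing fun i => (κ i).Unpaired,
          (pairedDiagram n (join κ σ)).renormalisedValuation G
            (fun l => Leaf.point (x l.1) (y l.1) l.2) := by
  simp only [renormalisedValuation_join κ _ hG hb]
  exact integral_prod_wienerIntegral ξ
    fun i => memLp_top_renormalisedValuation hG hb (κ i) (Leaf.point (x i) (y i))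

/-! ### Integration over the torus by unfolding -/

theorem measurable_circleRep : Measurable circleRep :=
  measurable_subtype_coe.comp (AddCircle.measurableEquivIco (2 * Real.pi) (-Real.pi)).measurable

theorem circleRep_coe {a : ℝ} (ha : a ∈ Ico (-Real.pi) Real.pi) : circleRep a = a := by
  rw [circleRep, AddCircle.equivIco_coe_eq]
  rwa [show -Real.pi + 2 * Real.pi = Real.pi by ring]

theorem measurePreserving_circleRep :
    MeasurePreserving circleRep volume (volume.restrict (Ico (-Real.pi) Real.pi)) := by
  refine ⟨measurable_circleRep, ?_⟩
  have measurePreserving_mk := AddCircle.measurePreserving_mk (2 * Real.pi) (-Real.pi)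
  rw [show -Real.pi + 2 * Real.pi = Real.pi by ring,
    ← Measure.restrict_congr_set Ico_ae_eq_Ioc] at measurePreserving_mk
  rw [← measurePreserving_mk.map_eq,
    Measure.map_map measurable_circleRep measurePreserving_mk.measurable]
  refine Eq.trans (Measure.map_congr ?_) Measure.map_id
  filter_upwards [ae_restrict_mem measurableSet_Ico] with a ha
  exact circleRep_coe ha

/-- The interval of length `2π` centred at `2πm`, one of the translates of a fundamental domain
of the circle. -/
def periodIco (m : ℤ) : Set ℝ := Ico (-Real.pi + 2 * Real.pi * m) (Real.pi + 2 * Real.pi * m)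

theorem measurePreserving_circleRep_add (m : ℤ) :
    MeasurePreserving (fun a => circleRep a + 2 * Real.pi * m) volume
      (volume.restrict (periodIco m)) := by
  have measurePreserving_add := (measurePreserving_add_right (volume : Measure ℝ)
    (2 * Real.pi * m)).restrict_preimage (s := periodIco m) measurableSet_Ico
  rw [periodIco, preimage_add_const_Ico, add_sub_cancel_right, add_sub_cancel_right]
    at measurePreserving_add
  exact measurePreserving_add.comp measurePreserving_circleRep

/-- The index `m` of the interval `periodIco m` that contains a real number. -/
def periodIndex (a : ℝ) : ℤ := ⌊(a + Real.pi) / (2 * Real.pi)⌋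

theorem periodIndex_mono : Monotone periodIndex := fun a b hab =>
  Int.floor_mono (by have := Real.pi_pos; gcongr)

theorem mem_periodIco_iff {a : ℝ} {m : ℤ} : a ∈ periodIco m ↔ periodIndex a = m := by
  rw [periodIndex, Int.floor_eq_iff, le_div_iff₀ Real.two_pi_pos, div_lt_iff₀ Real.two_pi_pos,
    periodIco, mem_Ico]
  constructor <;> rintro ⟨hlower, hupper⟩ <;> constructor <;> linarith

section Unfolding

variable {ι : Type*}

/-- The cube of side length `2π` centred at `2πm`. -/
def periodCube (m : ι → ℤ) : Set (ι → ℝ) := univ.pi fun i => periodIco (m i)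

theorem mem_periodCube_iff {y : ι → ℝ} {m : ι → ℤ} :
    y ∈ periodCube m ↔ (fun i => periodIndex (y i)) = m := by
  simp only [periodCube, mem_univ_pi, mem_periodIco_iff, funext_iff]

theorem measurableSet_periodCube [Countable ι] (m : ι → ℤ) : MeasurableSet (periodCube m) :=
  MeasurableSet.univ_pi fun _ => measurableSet_Ico

theorem pairwise_disjoint_periodCube :
    Pairwise (Function.onFun Disjoint (periodCube (ι := ι))) := fun _ _ h =>
  disjoint_left.2 fun _ hy hy' =>
    h ((mem_periodCube_iff.1 hy).symm.trans (mem_periodCube_iff.1 hy'))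

theorem exists_subset_iUnion_periodCube [Finite ι] {B : Set (ι → ℝ)}
    (hB : Bornology.IsBounded B) : ∃ s : Finset (ι → ℤ), B ⊆ ⋃ m ∈ s, periodCube m := by
  classical
  cases nonempty_fintype ι
  obtain ⟨R, hR⟩ := hB.exists_norm_le
  refine ⟨Fintype.piFinset fun _ => Finset.Icc (periodIndex (-R)) (periodIndex R), fun y hy => ?_⟩
  refine mem_biUnion (Fintype.mem_piFinset.2 fun i => Finset.mem_Icc.2 ?_)
    (mem_periodCube_iff.2 rfl)
  have hyi : |y i| ≤ R := (norm_le_pi_norm y i).trans (hR y hy)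
  exact ⟨periodIndex_mono (abs_le.1 hyi).1, periodIndex_mono (abs_le.1 hyi).2⟩

/-- The representative in `periodCube m` of a point of the torus. -/
def torusRep (m : ι → ℤ) (x : ι → AddCircle (2 * Real.pi)) (i : ι) : ℝ :=
  circleRep (x i) + 2 * Real.pi * m i

theorem coe_torusRep (m : ι → ℤ) (x : ι → AddCircle (2 * Real.pi)) (i : ι) :
    ((torusRep m x i : ℝ) : AddCircle (2 * Real.pi)) = x i := by
  rw [torusRep, AddCircle.coe_add, circleRep, AddCircle.coe_equivIco,
    show 2 * Real.pi * (m i : ℝ) = m i • (2 * Real.pi) by rw [zsmul_eq_mul, mul_comm],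
    AddCircle.coe_zsmul, AddCircle.coe_period, smul_zero, add_zero]

variable [Fintype ι]

theorem measurePreserving_torusRep (m : ι → ℤ) :
    MeasurePreserving (torusRep m) volume (volume.restrict (periodCube m)) := by
  rw [volume_pi, volume_pi, periodCube, Measure.restrict_pi_pi]
  exact measurePreserving_pi _ _ fun i => measurePreserving_circleRep_add (m i)

theorem tsum_lintegral_torusRep {f : (ι → ℝ) → ENNReal} (hf : Measurable f) :
    ∑' m, ∫⁻ x, f (torusRep m x) = ∫⁻ y, f y := by
  have iUnion_periodCube : ⋃ m, periodCube m = (univ : Set (ι → ℝ)) :=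
    iUnion_eq_univ_iff.2 fun _ => ⟨_, mem_periodCube_iff.2 rfl⟩
  simp_rw [(measurePreserving_torusRep _).lintegral_comp hf]
  rw [← lintegral_iUnion measurableSet_periodCube pairwise_disjoint_periodCube,
    iUnion_periodCube, setLIntegral_univ]

theorem setLIntegral_periodCube_coe (m : ι → ℤ) {f : (ι → AddCircle (2 * Real.pi)) → ENNReal}
    (hf : Measurable f) : ∫⁻ y in periodCube m, f (fun i => y i) = ∫⁻ x, f x := by
  have measurable_coe : Measurable fun (y : ι → ℝ) i => (y i : AddCircle (2 * Real.pi)) :=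
    measurable_pi_lambda _ fun i => AddCircle.measurable_mk'.comp (measurable_pi_apply i)
  have h := (measurePreserving_torusRep m).lintegral_comp (hf.comp measurable_coe)
  simpa only [Function.comp_apply, coe_torusRep] using h.symm

theorem exists_setLIntegral_coe_le {B : Set (ι → ℝ)} (hB : Bornology.IsBounded B) :
    ∃ N : ℕ, ∀ f : (ι → AddCircle (2 * Real.pi)) → ENNReal, Measurable f →
      ∫⁻ y in B, f (fun i => y i) ≤ N * ∫⁻ x, f x := by
  obtain ⟨s, hs⟩ := exists_subset_iUnion_periodCube hB
  refine ⟨s.card, fun f hf => ?_⟩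
  calc ∫⁻ y in B, f (fun i => y i)
      ≤ ∫⁻ y in ⋃ m ∈ s, periodCube m, f (fun i => y i) := lintegral_mono_set hs
    _ = ∑ m ∈ s, ∫⁻ y in periodCube m, f (fun i => y i) :=
        lintegral_biUnion_finset (pairwise_disjoint_periodCube.set_pairwise _)
          (fun m _ => measurableSet_periodCube m) _
    _ = s.card * ∫⁻ x, f x := by
        simp only [setLIntegral_periodCube_coe _ hf, Finset.sum_const, nsmul_eq_mul]

end Unfolding

theorem measurable_toTorus : Measurable toTorus :=
  measurable_pi_lambda _ fun i =>
    AddCircle.measurable_mk'.comp (EuclideanSpace.proj (𝕜 := ℝ) i).continuous.measurable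

theorem exists_setLIntegral_toTorus_le {B : Set (EuclideanSpace ℝ (Fin 4))}
    (hB : Bornology.IsBounded B) :
    ∃ N : ℕ, ∀ f : T4 → ENNReal, Measurable f → ∫⁻ y in B, f (toTorus y) ≤ N * ∫⁻ x, f x := by
  have equiv_symm_bounded : Bornology.IsBounded (WithLp.toLp 2 ⁻¹' B) :=
    (PiLp.antilipschitzWith_toLp 2 _).isBounded_preimage hB
  obtain ⟨N, hN⟩ := exists_setLIntegral_coe_le equiv_symm_bounded
  refine ⟨N, fun f hf => (le_of_eq ?_).trans (hN f hf)⟩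
  exact ((PiLp.volume_preserving_toLp (Fin 4)).setLIntegral_comp_preimage_emb
    (MeasurableEquiv.toLp 2 _).measurableEmbedding (fun y => f (toTorus y)) B).symm

/-! ### Convolution of a function on the torus with a mollifier -/

section Convolution

variable {φ : EuclideanSpace ℝ (Fin 4) → ℝ} {g : T4 → ℝ}

theorem measurable_integral_mul_sub_toTorus (hφ : Measurable φ) (hg : Measurable g) :
    Measurable fun x => ∫ y, φ y * g (x - toTorus y) := by
  have measurable_integrand : Measurable fun p : T4 × EuclideanSpace ℝ (Fin 4) =>
      φ p.2 * g (p.1 - toTorus p.2) :=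
    (hφ.comp measurable_snd).mul
      (hg.comp (measurable_fst.sub (measurable_toTorus.comp measurable_snd)))
  exact measurable_integrand.stronglyMeasurable.integral_prod_right.measurable

theorem lintegral_sub_torus (f : T4 → ENNReal) (x : T4) : ∫⁻ w, f (x - w) = ∫⁻ w, f w := by
  have : (volume : Measure (AddCircle (2 * Real.pi))).IsNegInvariant := inferInstance
  have : (volume : Measure T4).IsNegInvariant := Measure.pi.isNegInvariant _
  exact lintegral_sub_left_eq_self f x

theorem exists_abs_integral_mul_sub_toTorus_le (hφ : Continuous φ) (hφ' : HasCompactSupport φ)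
    (hg : Integrable g) (hgm : Measurable g) :
    ∃ C, ∀ x, |∫ y, φ y * g (x - toTorus y)| ≤ C := by
  obtain ⟨b, hb⟩ := hφ'.exists_bound_of_continuous hφ
  obtain ⟨N, hN⟩ := exists_setLIntegral_toTorus_le hφ'.isCompact.isBounded
  have bound_ne_top : ENNReal.ofReal b * (N * ∫⁻ w, ‖g w‖ₑ) ≠ ⊤ :=
    ENNReal.mul_ne_top ENNReal.ofReal_ne_top (ENNReal.mul_ne_top (ENNReal.natCast_ne_top N) hg.2.ne)
  refine ⟨(ENNReal.ofReal b * (N * ∫⁻ w, ‖g w‖ₑ)).toReal, fun x => ?_⟩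
  rw [← Real.norm_eq_abs, ← toReal_enorm]
  refine ENNReal.toReal_mono bound_ne_top ?_
  have measurable_sub : Measurable fun w => ‖g (x - w)‖ₑ :=
    (hgm.comp (measurable_id.const_sub x)).enorm
  have support_subset : (fun y => ‖φ y * g (x - toTorus y)‖ₑ).support ⊆ tsupport φ :=
    fun y hy => subset_tsupport φ fun h => hy (by simp [h])
  calc ‖∫ y, φ y * g (x - toTorus y)‖ₑ
      ≤ ∫⁻ y, ‖φ y * g (x - toTorus y)‖ₑ := enorm_integral_le_lintegral_enorm _
    _ = ∫⁻ y in tsupport φ, ‖φ y * g (x - toTorus y)‖ₑ :=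
        (setLIntegral_eq_of_support_subset support_subset).symm
    _ ≤ ∫⁻ y in tsupport φ, ENNReal.ofReal b * ‖g (x - toTorus y)‖ₑ := by
        gcongr with y
        rw [enorm_mul, ← ofReal_norm]
        gcongr
        exact hb y
    _ = ENNReal.ofReal b * ∫⁻ y in tsupport φ, ‖g (x - toTorus y)‖ₑ :=
        lintegral_const_mul _ (measurable_sub.comp measurable_toTorus)
    _ ≤ ENNReal.ofReal b * (N * ∫⁻ w, ‖g w‖ₑ) := by
        rw [← lintegral_sub_torus (fun w => ‖g w‖ₑ) x]
        gcongr
        exact hN _ measurable_sub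

end Convolution

/-! ### The mollified Green's function is bounded -/

/-- The heat kernel on `ℝ⁴`, whose periodisation is `heatKernel`. -/
def euclideanHeatKernel (t : ℝ) (y : Fin 4 → ℝ) : ℝ :=
  ((4 * Real.pi * t) ^ 2)⁻¹ * Real.exp (-(∑ i, y i ^ 2) / (4 * t))

theorem euclideanHeatKernel_nonneg (t : ℝ) (y : Fin 4 → ℝ) : 0 ≤ euclideanHeatKernel t y := by
  unfold euclideanHeatKernel
  positivity

theorem measurable_euclideanHeatKernel :
    Measurable fun p : ℝ × (Fin 4 → ℝ) => euclideanHeatKernel p.1 p.2 := by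
  unfold euclideanHeatKernel
  fun_prop

theorem euclideanHeatKernel_eq_prod {t : ℝ} (ht : 0 < t) (y : Fin 4 → ℝ) :
    euclideanHeatKernel t y = ∏ i, gaussianPDFReal 0 (2 * t).toNNReal (y i) := by
  have sqrt_pow_four : √(2 * Real.pi * (2 * t)) ^ 4 = (2 * Real.pi * (2 * t)) ^ 2 := by
    rw [show √(2 * Real.pi * (2 * t)) ^ 4 = (√(2 * Real.pi * (2 * t)) ^ 2) ^ 2 by ring,
      Real.sq_sqrt (by positivity)]
  simp only [gaussianPDFReal_def, Finset.prod_mul_distrib, Finset.prod_const, Finset.card_univ,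
    Fintype.card_fin, ← Real.exp_sum, ← Finset.sum_div, sub_zero, Finset.sum_neg_distrib,
    Real.coe_toNNReal (2 * t) (by positivity)]
  rw [euclideanHeatKernel, inv_pow, sqrt_pow_four]
  ring_nf

theorem lintegral_euclideanHeatKernel {t : ℝ} (ht : 0 < t) :
    ∫⁻ y, ENNReal.ofReal (euclideanHeatKernel t y) = 1 := by
  have variance_ne_zero : (2 * t).toNNReal ≠ 0 := by simpa using ht
  have integrable_prod : Integrable fun y : Fin 4 → ℝ =>
      ∏ i, gaussianPDFReal 0 (2 * t).toNNReal (y i) :=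
    Integrable.fintype_prod fun _ => integrable_gaussianPDFReal _ _
  simp_rw [euclideanHeatKernel_eq_prod ht]
  rw [← ofReal_integral_eq_lintegral_ofReal integrable_prod (Filter.Eventually.of_forall fun y =>
      Finset.prod_nonneg fun i _ => gaussianPDFReal_nonneg _ _ _),
    integral_fintype_prod_volume_eq_prod]
  simp only [integral_gaussianPDFReal_eq_one 0 variance_ne_zero, Finset.prod_const_one,
    ENNReal.ofReal_one]

/-- The heat kernel on the torus with values in `[0, ∞]`, for which no summability is needed. -/
def eheatKernel (t : ℝ) (x : T4) : ENNReal :=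
  ∑' m, ENNReal.ofReal (euclideanHeatKernel t (torusRep m x))

theorem toReal_eheatKernel (t : ℝ) (x : T4) : (eheatKernel t x).toReal = heatKernel t x := by
  rw [eheatKernel, ENNReal.tsum_toReal_eq fun _ => ENNReal.ofReal_ne_top]
  simp_rw [ENNReal.toReal_ofReal (euclideanHeatKernel_nonneg _ _)]
  rfl

theorem measurable_ofReal_euclideanHeatKernel (m : Fin 4 → ℤ) :
    Measurable fun p : ℝ × T4 => ENNReal.ofReal (euclideanHeatKernel p.1 (torusRep m p.2)) :=
  (measurable_euclideanHeatKernel.comp (measurable_fst.prodMk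
    ((measurePreserving_torusRep m).measurable.comp measurable_snd))).ennreal_ofReal

theorem measurable_eheatKernel : Measurable fun p : ℝ × T4 => eheatKernel p.1 p.2 :=
  Measurable.tsum measurable_ofReal_euclideanHeatKernel

theorem lintegral_eheatKernel {t : ℝ} (ht : 0 < t) : ∫⁻ x, eheatKernel t x = 1 := by
  have measurable_translate (m : Fin 4 → ℤ) :
      Measurable fun x => ENNReal.ofReal (euclideanHeatKernel t (torusRep m x)) :=
    (measurable_ofReal_euclideanHeatKernel m).comp measurable_prodMk_left
  unfold eheatKernel
  rw [lintegral_tsum fun m => (measurable_translate m).aemeasurable,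
    tsum_lintegral_torusRep (f := fun y => ENNReal.ofReal (euclideanHeatKernel t y))
      (measurable_euclideanHeatKernel.comp measurable_prodMk_left).ennreal_ofReal,
    lintegral_euclideanHeatKernel ht]

attribute [irreducible] eheatKernel

theorem measurable_exp_mul_eheatKernel : Measurable fun p : T4 × ℝ =>
    ENNReal.ofReal (Real.exp (-p.2)) * eheatKernel p.2 p.1 := by
  have measurable_exp : Measurable fun p : T4 × ℝ => ENNReal.ofReal (Real.exp (-p.2)) := by
    fun_prop
  have measurable_kernel : Measurable fun p : T4 × ℝ => eheatKernel p.2 p.1 :=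
    measurable_eheatKernel.comp measurable_swap
  exact measurable_exp.mul measurable_kernel

theorem toReal_exp_mul_eheatKernel (t : ℝ) (x : T4) :
    (ENNReal.ofReal (Real.exp (-t)) * eheatKernel t x).toReal =
      Real.exp (-t) * heatKernel t x := by
  rw [ENNReal.toReal_mul, ENNReal.toReal_ofReal (Real.exp_nonneg _), toReal_eheatKernel]

theorem measurable_greenFunction : Measurable greenFunction := by
  have h : Measurable fun p : T4 × ℝ => Real.exp (-p.2) * heatKernel p.2 p.1 := by
    simpa only [toReal_exp_mul_eheatKernel] using measurable_exp_mul_eheatKernel.ennreal_toReal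
  exact (h.stronglyMeasurable.integral_prod_right (ν := volume.restrict (Ioi (0 : ℝ)))).measurable

theorem integrable_greenFunction : Integrable greenFunction := by
  refine ⟨measurable_greenFunction.aestronglyMeasurable, ?_⟩
  calc ∫⁻ x, ‖greenFunction x‖ₑ
      ≤ ∫⁻ x : T4, ∫⁻ t in Ioi (0 : ℝ), ENNReal.ofReal (Real.exp (-t)) * eheatKernel t x := by
        refine lintegral_mono fun x => (enorm_integral_le_lintegral_enorm _).trans
          (lintegral_mono fun t => ?_)
        rw [← toReal_exp_mul_eheatKernel, Real.enorm_of_nonneg ENNReal.toReal_nonneg]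
        exact ENNReal.ofReal_toReal_le
    _ = ∫⁻ t in Ioi (0 : ℝ), ∫⁻ x : T4, ENNReal.ofReal (Real.exp (-t)) * eheatKernel t x :=
        lintegral_lintegral_swap measurable_exp_mul_eheatKernel.aemeasurable
    _ = ∫⁻ t in Ioi (0 : ℝ), ENNReal.ofReal (Real.exp (-t)) := by
        refine setLIntegral_congr_fun measurableSet_Ioi fun t ht => ?_
        have measurable_kernel : Measurable (eheatKernel t) :=
          measurable_eheatKernel.comp measurable_prodMk_left
        rw [lintegral_const_mul _ measurable_kernel, lintegral_eheatKernel ht, mul_one]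
    _ < ⊤ := by
        rw [← ofReal_integral_eq_lintegral_ofReal (integrableOn_exp_neg_Ioi 0)
          (Filter.Eventually.of_forall fun t => Real.exp_nonneg _)]
        exact ENNReal.ofReal_lt_top

theorem measurable_mollifiedGreen {ρ : EuclideanSpace ℝ (Fin 4) → ℝ} (hρ : Measurable ρ) (ε : ℝ) :
    Measurable (mollifiedGreen ρ ε) :=
  measurable_integral_mul_sub_toTorus ((hρ.comp (measurable_const_smul ε⁻¹)).const_mul _)
    measurable_greenFunction

theorem exists_abs_mollifiedGreen_le {ρ : EuclideanSpace ℝ (Fin 4) → ℝ} (hρ : Continuous ρ)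
    (hρ' : HasCompactSupport ρ) {ε : ℝ} (hε : ε ≠ 0) : ∃ C, ∀ x, |mollifiedGreen ρ ε x| ≤ C :=
  exists_abs_integral_mul_sub_toTorus_le
    (continuous_const.mul (hρ.comp (continuous_const_smul ε⁻¹)))
    (hρ'.comp_smul (inv_ne_zero hε)).mul_left integrable_greenFunction measurable_greenFunction

end AndersonBPHZ

end

open AndersonBPHZ MeasureTheory in
theorem proposition2_general {Ω : Type*} [MeasurableSpace Ω] {P : Measure Ω} (ξ : WhiteNoise P)
    {G : T4 → ℝ} (hG : Measurable G) (hb : ∃ C, ∀ x, |G x| ≤ C) {k : ℕ} (n : Fin k → ℕ)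
    (x y : Fin k → T4) :
    Integrable (fun ω => ∏ i, renormalisedTree ξ G (n i) (x i) (y i) ω) P ∧
      ∫ ω, ∏ i, renormalisedTree ξ G (n i) (x i) (y i) ω ∂P =
        ∑ κ : CompletePairing (Σ i, Fin (n i)),
          (pairedDiagram n κ).renormalisedValuation G
            (fun l => Leaf.point (x l.1) (y l.1) l.2) := by
  have h (κ : ∀ i, Pairing (Fin (n i))) := integral_prod_renormalisedPairedTree ξ hG hb x y κ
  simp only [renormalisedTree, Finset.prod_univ_sum, Fintype.piFinset_univ]
  refine ⟨integrable_finsetSum _ fun κ _ => (h κ).1, ?_⟩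
  rw [integral_finsetSum _ fun κ _ => (h κ).1, ← join_bijective.sum_comp, Fintype.sum_sigma]
  exact Finset.sum_congr rfl fun κ _ => (h κ).2

open AndersonBPHZ MeasureTheory in
theorem proposition2 {Ω : Type*} [MeasurableSpace Ω] (P : Measure Ω) [IsProbabilityMeasure P]
    (ξ : WhiteNoise P)
    (ρ : EuclideanSpace ℝ (Fin 4) → ℝ) (hρ : IsMollifier ρ)
    (ε : ℝ) (hε : ε ∈ Set.Ioo (0 : ℝ) 1)
    (k : ℕ) (n : Fin k → ℕ) (hn : ∀ i, 1 ≤ n i) (x y : Fin k → T4) :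
    Integrable (fun ω => ∏ i, renormalisedTree ξ (mollifiedGreen ρ ε) (n i) (x i) (y i) ω) P ∧
      ∫ ω, ∏ i, renormalisedTree ξ (mollifiedGreen ρ ε) (n i) (x i) (y i) ω ∂P =
        ∑ κ : CompletePairing (Σ i, Fin (n i)),
          (pairedDiagram n κ).renormalisedValuation (mollifiedGreen ρ ε)
            (fun l => Leaf.point (x l.1) (y l.1) l.2) := by
  exact proposition2_general ξ (measurable_mollifiedGreen hρ.smooth.continuous.measurable ε)
    (exists_abs_mollifiedGreen_le hρ.smooth.continuous hρ.compact hε.1.ne') n x y
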